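/- Let $\pi:Y\to X$ be a smooth fibration (surjective submersion), $\dim X=n\ge 1$, $\dim Y=n+m$, let $r\ge 1$, and let $\rho$ be a smooth $n$-form on the jet prolongation $J^{r-1}Y$. Let $p_l$ denote the $l$-contact component of a form, $h=p_0$ the horizontalization, and $d_H=\sum_l p_l\,d\,p_l$ the horizontal differential (all up to pull-backs by the jet projections). In fibred coordinates $(x^i,y^\sigma)$, with contact forms $\omega^\sigma=dy^\sigma-y^\sigma_i\,dx^i$ and formal derivatives $d_I$ acting on forms, the interior Euler operator on an $(n+1)$-form $\eta$ of order $s$ is $$\mathcal I(\eta)=\omega^\sigma\wedge\sum_{|I|\le s}(-1)^{|I|}\,d_I\Big(\frac{\partial}{\partial y^\sigma_I}\rfloor p_1\eta\Big),$$ the sum being over unordered multi-indices $I\in\mathbb N^n$. A residual form of $\eta$ over a fibred chart is a smooth contact $n$-form $R$ on some jet prolongation of the chart domain with $p_1\eta=\mathcal I(\eta)+p_1\,d\,p_1R$. For a Lagrangian (horizontal $n$-form) $\lambda$ and a vertical vector field $\psi$, the Noether current of $\lambda$ associated with $\psi$, defined over a fibred chart by a residual form $R$ of $d\lambda$, is $\epsilon_\psi(\lambda)=J\psi\rfloor(-p_1R)$,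 where $J\psi$ is the jet prolongation of $\psi$. A smooth local section $\gamma$ of $\pi$ is an extremal of the Lagrangian $h\rho$ if $\mathcal I d(h\rho)$ vanishes along the jets of $\gamma$. A vertical vector field $\psi$ on $Y$ generates symmetry transformations of $\gamma$ if its local one-parameter group $\phi_t$ transforms $\gamma$ into extremals $\phi_t\circ\gamma$ of $h\rho$ (locally around each point of $\gamma$ and for small $t$). Theorem. Let $\gamma$ be an extremal of $h\rho$ and let $\psi_1,\psi_2$ be smooth vertical vector fields on $Y$ that generate symmetry transformations of $\gamma$. Then, over every fibred chart, the differential $d(\psi_1\rfloor\mathcal I d(h\rho))$ of the Lagrangian "deformed" by $\psi_1$ has a residual form, and for every choice of it the weak conservation law $$d_H\,\epsilon_{\psi_2}\big(\psi_1\rfloor \mathcal I d(h\rho)\big)=0$$ holds along $\gamma$, i.e. at all jets of $\gamma$ at points $x$ with $\gamma(x)$ in the chart domain. In particular it holds along all extremals if $\psi_1,\psi_2$ generate symmetry transformations of all extremals of $h\rho$. -/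

import Mathlib

open scoped Manifold ContDiff Topology

noncomputable section

namespace VarJet

/-! ### Multi-indices and jet coordinates

`N` is the dimension of the base and `M` the dimension of the fibres.  Multi-indices are unordered,
i.e. elements of `ℕ ^ N`, so that the coordinates `y^σ_I` are independent. -/

/-- Multi-indices in `N` variables. -/
abbrev MIdx (N : ℕ) := Fin N → ℕ

/-- The length `|I|` of a multi-index. -/
def MIdx.len {N : ℕ} (I : MIdx N) : ℕ := ∑ i, I i

/-- The multi-indices of length at most `k`. -/
def midx (N k : ℕ) : Finset (MIdx N) :=
  (Fintype.piFinset fun _ : Fin N => Finset.range (k + 1)).filter fun I => I.len ≤ k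

theorem mem_midx {N k : ℕ} {I : MIdx N} : I ∈ midx N k ↔ I.len ≤ k := by
  simp only [midx, Finset.mem_filter, Fintype.mem_piFinset, Finset.mem_range, and_iff_right_iff_imp]
  intro h i
  have h1 : I i ≤ I.len := Finset.single_le_sum (f := I) (fun _ _ => Nat.zero_le _) (Finset.mem_univ i)
  omega

theorem zero_mem_midx (N k : ℕ) : (0 : MIdx N) ∈ midx N k := by
  simp [mem_midx, MIdx.len]

/-- Fibred coordinates `(x^i, y^σ)`. -/
abbrev Pt (N M : ℕ) := (Fin N → ℝ) × (Fin M → ℝ)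

/-- Coordinates `(x^i, y^σ_I)`, `|I| ≤ k`, of jets of order `k`. -/
abbrev FinJet (N M k : ℕ) := (Fin N → ℝ) × (Fin M → {I : MIdx N // I ∈ midx N k} → ℝ)

/-- Coordinates `(x^i, y^σ_I)`, without bound on `|I|`.  Everything that lives on a jet space of
finite order is pulled back to this space, so that formulas that hold "up to pull-backs by
projections" become plain equalities. -/
abbrev Jet (N M : ℕ) := (Fin N → ℝ) × (Fin M → MIdx N → ℝ)

variable {N M : ℕ}

/-- The projection onto the jets of order `k`. -/
def trunc (k : ℕ) (z : Jet N M) : FinJet N M k := (z.1, fun σ I => z.2 σ I.1)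

/-- The projection onto the jets of order `0`. -/
def Jet.pt (z : Jet N M) : Pt N M := (z.1, fun σ => z.2 σ 0)

def FinJet.pt {k : ℕ} (z : FinJet N M k) : Pt N M :=
  (z.1, fun σ => z.2 σ ⟨0, zero_mem_midx N k⟩)

/-- For a family of operators `F i` (`i = 1, …, N`) the operator `F^I = F₁^{I₁} ∘ ⋯ ∘ F_N^{I_N}`. -/
def iter {α : Type*} (F : Fin N → α → α) (I : MIdx N) (a : α) : α :=
  (List.finRange N).foldr (fun i b => (F i)^[I i] b) a

/-- The partial derivative `∂_i`. -/
def pderiv (i : Fin N) (f : (Fin N → ℝ) → ℝ) (x : Fin N → ℝ) : ℝ :=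
  lineDeriv ℝ f x (Pi.single i 1)

/-- The jet at `x` of a local section given in coordinates by `u`, i.e. `y^σ_I = ∂_I u^σ (x)`. -/
def jet (u : (Fin N → ℝ) → (Fin M → ℝ)) (x : Fin N → ℝ) : Jet N M :=
  (x, fun σ I => iter pderiv I (fun x' => u x' σ) x)

/-! ### Differential forms in jet coordinates -/

/-- `q`-forms on the space of jets, as functions of a point and of `q` tangent vectors.  All those
that are used arise from smooth alternating forms on jet spaces of finite order (see `lift`) by the
operations below. -/
abbrev Form (N M q : ℕ) := Jet N M → (Fin q → Jet N M) → ℝ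

/-- The pull-back of a `q`-form on the jets of order `k`. -/
def lift {k q : ℕ} (η : FinJet N M k → FinJet N M k [⋀^Fin q]→L[ℝ] ℝ) : Form N M q :=
  fun z v => η (trunc k z) fun a => trunc k (v a)

/-- The formal derivative `d_i`, as a vector field on the space of jets:
`d_i = ∂/∂x^i + ∑ y^σ_{Ii} ∂/∂y^σ_I`. -/
def totalField (i : Fin N) (z : Jet N M) : Jet N M :=
  (Pi.single i 1, fun σ I => z.2 σ (I + Pi.single i 1))

/-- The vector field `∂/∂y^σ_I`. -/
def vertField (σ : Fin M) (I : MIdx N) (_z : Jet N M) : Jet N M :=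
  (0, Pi.single σ (Pi.single I 1))

/-- The horizontal part `∑ dx^i(v) d_i` of a tangent vector. -/
def hor (z v : Jet N M) : Jet N M := ∑ i, v.1 i • totalField i z

/-- The vertical part of a tangent vector; its component of index `(σ, I)` is
`ω^σ_I(v)`, with `ω^σ_I = dy^σ_I - y^σ_{Ii} dx^i` the contact forms. -/
def ver (z v : Jet N M) : Jet N M := v - hor z v

/-- The `l`-contact component `p_l η`: the part of `η` with exactly `l` contact factors. -/
def p {q : ℕ} (l : ℕ) (η : Form N M q) : Form N M q := fun z v =>
  ∑ S ∈ Finset.powersetCard l (Finset.univ : Finset (Fin q)),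
    η z fun a => if a ∈ S then ver z (v a) else hor z (v a)

/-- The exterior derivative. -/
def extD {q : ℕ} (η : Form N M q) : Form N M (q + 1) := fun z v =>
  ∑ a : Fin (q + 1), (-1) ^ (a : ℕ) * lineDeriv ℝ (fun z' => η z' (a.removeNth v)) z (v a)

/-- The horizontal differential `d_H = ∑_l p_l d p_l`. -/
def dH {q : ℕ} (η : Form N M q) : Form N M (q + 1) :=
  ∑ l ∈ Finset.range (q + 1), p l (extD (p l η))

/-- The contraction `ξ ⌋ η` of a form with a vector field. -/
def contr {q : ℕ} (ξ : Jet N M → Jet N M) (η : Form N M (q + 1)) : Form N M q :=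
  fun z v => η z (Fin.cons (ξ z) v)

/-- The wedge product of a `1`-form and a `q`-form. -/
def wedgeOne {q : ℕ} (α : Form N M 1) (β : Form N M q) : Form N M (q + 1) := fun z v =>
  ∑ a : Fin (q + 1), (-1) ^ (a : ℕ) * (α z (fun _ => v a) * β z (a.removeNth v))

/-- The formal derivative `d_i` of forms: the total derivative on functions, extended so as to
commute with `d` and to satisfy the Leibniz rule, i.e. the Lie derivative along `d_i`. -/
def formalDeriv (i : Fin N) : {q : ℕ} → Form N M q → Form N M q
  | 0, η => contr (totalField i) (extD η)
  | _ + 1, η => contr (totalField i) (extD η) + extD (contr (totalField i) η)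

/-- The contact `1`-form `ω^σ = dy^σ - y^σ_i dx^i`. -/
def contactForm (σ : Fin M) : Form N M 1 := fun z v => (ver z (v 0)).2 σ 0

/-- The interior Euler operator on `(n+1)`-forms `η` on the jets of order `r`:
`∑_σ ω^σ ∧ ∑_{|I| ≤ r} (-1)^{|I|} d_I (∂/∂y^σ_I ⌋ p_1 η)`. -/
def interiorEuler {q : ℕ} (r : ℕ) (η : Form N M (q + 1)) : Form N M (q + 1) :=
  ∑ σ : Fin M, wedgeOne (contactForm σ)
    (∑ I ∈ midx N r, (-1 : ℝ) ^ I.len • iter (fun i => formalDeriv i) I (contr (vertField σ I) (p 1 η)))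

/-- `R` is a residual form for the form `η` on the jets of order `r` over the coordinate domain
`D`: a smooth contact form on some jet space over `D` with `p_1 η = 𝓘(η) + p_1 d p_1 R`. -/
structure IsResidual {q s : ℕ} (D : Set (Pt N M)) (r : ℕ) (η : Form N M (q + 1))
    (R : FinJet N M s → FinJet N M s [⋀^Fin q]→L[ℝ] ℝ) : Prop where
  smooth : ContDiffOn ℝ ∞ R {z | FinJet.pt z ∈ D}
  contact : ∀ z : Jet N M, z.pt ∈ D → p 0 (lift R) z = 0
  decomposition : ∀ z : Jet N M, z.pt ∈ D →
    p 1 η z = interiorEuler r η z + p 1 (extD (p 1 (lift R))) z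

/-- The total derivative `d_i f` of a function. -/
def totalDeriv (i : Fin N) (f : Jet N M → ℝ) (z : Jet N M) : ℝ :=
  lineDeriv ℝ f z (totalField i z)

/-- The prolongation of the vertical vector field `∑ ψ^σ ∂/∂y^σ`:
`∑ d_I ψ^σ ∂/∂y^σ_I`. -/
def prolong (ψ : Pt N M → Fin M → ℝ) (z : Jet N M) : Jet N M :=
  (0, fun σ I => iter totalDeriv I (fun z' => ψ z'.pt σ) z)

/-- The Noether current `ε_ψ(λ) = Jψ ⌋ (- p_1 R)` associated with a vertical vector field `ψ` and
with a Lagrangian `λ` whose differential `dλ` has the residual form `R`. -/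
def noetherCurrent {q s : ℕ} (ψ : Pt N M → Fin M → ℝ)
    (R : FinJet N M s → FinJet N M s [⋀^Fin (q + 1)]→L[ℝ] ℝ) : Form N M q :=
  contr (prolong ψ) (-(p 1 (lift R)))

/-! ### Fibred manifolds -/

section Global

variable {X Y : Type*} [TopologicalSpace X] [ChartedSpace (Fin N → ℝ) X]
  [TopologicalSpace Y] [ChartedSpace (Pt N M) Y]

/-- Fibred charts of `Y` for the projection `π : Y → X`. -/
structure FibredChart (π : Y → X) where
  base : OpenPartialHomeomorph X (Fin N → ℝ)
  total : OpenPartialHomeomorph Y (Pt N M)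
  base_mem : base ∈ IsManifold.maximalAtlas 𝓘(ℝ, Fin N → ℝ) ∞ X
  total_mem : total ∈ IsManifold.maximalAtlas 𝓘(ℝ, Pt N M) ∞ Y
  mapsTo : ∀ y ∈ total.source, π y ∈ base.source
  fibred : ∀ y ∈ total.source, (total y).1 = base (π y)

/-- The local section `x' ↦ ∑_{|I| ≤ k} y^σ_I (x' - x)^I / I!` with `k`-jet `z = (x, y^σ_I)`. -/
def taylor {k : ℕ} (z : FinJet N M k) (x' : Fin N → ℝ) : Fin M → ℝ := fun σ =>
  ∑ I : {I : MIdx N // I ∈ midx N k},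
    z.2 σ I * ∏ i, ((x' i - z.1 i) ^ (I.1 i) / ((I.1 i).factorial : ℝ))

variable {π : Y → X}

/-- The change of coordinates on jets of order `k` from the fibred chart `c` to `c'`: represent the
jet by a local section, write the section in the chart `c'`, and take its `k`-jet there. -/
def transition (c c' : FibredChart (N := N) (M := M) π) {k : ℕ} (z : FinJet N M k) :
    FinJet N M k :=
  trunc k (jet
    (fun x'' => (c'.total (c.total.symm
      (c.base (c'.base.symm x''), taylor z (c.base (c'.base.symm x''))))).2)
    (c'.base (c.base.symm z.1)))

variable (π) in
/-- A smooth `q`-form on `J^k Y`: a form in the jet coordinates of each fibred chart, such that the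
local expressions are related by pull-back along the changes of jet coordinates. -/
structure JetForm (k q : ℕ) where
  expr : FibredChart (N := N) (M := M) π → FinJet N M k → FinJet N M k [⋀^Fin q]→L[ℝ] ℝ
  smooth : ∀ c, ContDiffOn ℝ ∞ (expr c) {z | FinJet.pt z ∈ c.total.target}
  compat : ∀ c c', ∀ z : FinJet N M k, FinJet.pt z ∈ c.total.target →
    c.total.symm (FinJet.pt z) ∈ c'.total.source →
    expr c z = (expr c' (transition c c' z)).compContinuousLinearMap
      (fderiv ℝ (transition c c') z)

/-- The Lagrangian `hρ = p_0 ρ` (on the jets of order `k + 1`), in a fibred chart. -/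
def lagrangian {k q : ℕ} (ρ : JetForm (N := N) (M := M) π k q)
    (c : FibredChart (N := N) (M := M) π) : Form N M q :=
  p 0 (lift (ρ.expr c))

/-- The Euler–Lagrange form `𝓘 d(hρ)` (on the jets of order `2(k + 1) + 1`), in a fibred chart. -/
def eulerLagrange {k q : ℕ} (ρ : JetForm (N := N) (M := M) π k q)
    (c : FibredChart (N := N) (M := M) π) : Form N M (q + 1) :=
  interiorEuler (k + 1) (extD (lagrangian ρ c))

/-- A smooth local section of `π`, defined on the open set `V`. -/
structure IsLocalSection (π : Y → X) (V : Set X) (γ : X → Y) : Prop where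
  isOpen : IsOpen V
  smooth : ContMDiffOn 𝓘(ℝ, Fin N → ℝ) 𝓘(ℝ, Pt N M) ∞ γ V
  proj_eq : ∀ x ∈ V, π (γ x) = x

/-- The jet, in the jet coordinates of a fibred chart, of a local section at a point. -/
def jetOf (c : FibredChart (N := N) (M := M) π) (γ : X → Y) (x : X) : Jet N M :=
  jet (fun x' => (c.total (γ (c.base.symm x'))).2) (c.base x)

/-- `γ`, defined on `V`, is an extremal of `hρ`: the Euler–Lagrange form vanishes along the jets
of `γ`. -/
structure IsExtremal {k q : ℕ} (ρ : JetForm (N := N) (M := M) π k q) (V : Set X) (γ : X → Y) :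
    Prop where
  isLocalSection : IsLocalSection (N := N) (M := M) π V γ
  vanish : ∀ c : FibredChart (N := N) (M := M) π, ∀ x ∈ V, γ x ∈ c.total.source →
    eulerLagrange ρ c (jetOf c γ x) = 0

/-- Smooth vertical vector fields on `Y`. -/
structure IsVerticalField [IsManifold 𝓘(ℝ, Pt N M) ∞ Y] (π : Y → X)
    (ψ : ∀ y : Y, TangentSpace 𝓘(ℝ, Pt N M) y) : Prop where
  smooth : ContMDiff 𝓘(ℝ, Pt N M) 𝓘(ℝ, Pt N M).tangent ∞
    (fun y => (⟨y, ψ y⟩ : TangentBundle 𝓘(ℝ, Pt N M) Y))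
  vertical : ∀ y, mfderiv 𝓘(ℝ, Pt N M) 𝓘(ℝ, Fin N → ℝ) π y (ψ y) = 0

/-- The components `ψ^σ` of a vertical vector field in a fibred chart. -/
def comps (c : FibredChart (N := N) (M := M) π)
    (ψ : ∀ y : Y, TangentSpace 𝓘(ℝ, Pt N M) y) (a : Pt N M) : Fin M → ℝ :=
  (show Pt N M from mfderiv 𝓘(ℝ, Pt N M) 𝓘(ℝ, Pt N M) c.total (c.total.symm a)
    (ψ (c.total.symm a))).2

/-- `Φ t y`, for `|t| < ε` and `y` in the open set `U`, is the local one-parameter group of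
transformations (the local flow) of `ψ`. -/
structure IsLocalFlow (ψ : ∀ y : Y, TangentSpace 𝓘(ℝ, Pt N M) y) (U : Set Y) (ε : ℝ)
    (Φ : ℝ → Y → Y) : Prop where
  isOpen : IsOpen U
  pos : 0 < ε
  smooth : ContMDiffOn (𝓘(ℝ, ℝ).prod 𝓘(ℝ, Pt N M)) 𝓘(ℝ, Pt N M) ∞
    (fun a : ℝ × Y => Φ a.1 a.2) (Set.Ioo (-ε) ε ×ˢ U)
  start : ∀ y ∈ U, Φ 0 y = y
  integral : ∀ y ∈ U, IsMIntegralCurveOn (I := 𝓘(ℝ, Pt N M)) (fun t => Φ t y) ψ (Set.Ioo (-ε) ε)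

/-- The vertical vector field `ψ` is the generator of symmetry transformations of the extremal `γ`
(defined on `V`): its local flow near every point of `γ` transforms `γ` into extremals.  As the
flow of a vertical field covers the identity of `X`, it transforms `γ` into `Φ t ∘ γ`. -/
def GeneratesSymmetries {k q : ℕ} (ρ : JetForm (N := N) (M := M) π k q) (V : Set X) (γ : X → Y)
    (ψ : ∀ y : Y, TangentSpace 𝓘(ℝ, Pt N M) y) : Prop :=
  ∀ x ∈ V, ∃ (U : Set Y) (ε : ℝ) (Φ : ℝ → Y → Y), γ x ∈ U ∧ IsLocalFlow ψ U ε Φ ∧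
    ∀ t ∈ Set.Ioo (-ε) ε, IsExtremal ρ (V ∩ γ ⁻¹' U) (fun x' => Φ t (γ x'))

/-- The Lagrangian `ψ ⌋ 𝓘 d(hρ)` "deformed" by a vertical vector field `ψ`, in a fibred chart. -/
def deformedLagrangian {k q : ℕ} (ρ : JetForm (N := N) (M := M) π k q)
    (ψ : ∀ y : Y, TangentSpace 𝓘(ℝ, Pt N M) y) (c : FibredChart (N := N) (M := M) π) :
    Form N M q :=
  contr (prolong (comps c ψ)) (eulerLagrange ρ c)

end Global

end VarJet

end

noncomputable section

namespace VarJet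

/-! ### Iterated operators -/

section Iter

variable {N : ℕ} {α β : Type*}

/-! The proof is a computation in one fibred chart. Let `L` be the coefficient of the Lagrangian
`hρ`, of order `k + 1`, let `E_σ(L)` be its Euler–Lagrange expressions, and write `Jψ` for the
derivative along the prolongation of `ψ`. The deformed Lagrangian has the coefficient `L₁ = ∑ ψ₁^σ
E_σ(L)`.

Four facts carry the argument.

Residual forms of `dλ` exist for every Lagrangian `λ` of finite order: integrating by parts in `∑
∂λ/∂y^σ_I ω^σ_I` leaves `∑ E_σ(λ) ω^σ` and a formal divergence, and a formal divergence is `p_1 d`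
of a 1-contact form (`exists_byParts`, `exists_isResidual`).

For any residual form, contracting its defining identity with `Jψ₂` gives the first variation
formula `d_H ε_{ψ₂}(λ) = (Jψ₂(λ) - ∑ ψ₂^σ E_σ(λ)) vol`, with `λ` also denoting the coefficient
(`dH_noetherCurrent`). So the choice of the residual form plays no role.

The Euler–Lagrange expressions of the deformed Lagrangian satisfy `E_ν(L₁) = Jψ₁(E_ν(L)) + ∑
∂ψ₁^σ/∂y^ν E_σ(L)` (`JetRing.E_deformed`). This is pure algebra: the Euler operator kills total
derivatives, and `Jψ₁` commutes with formal derivatives.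

If the flow of `ψ` carries `γ` into extremals, differentiating `E_σ(L) = 0` along the jets of the
transformed sections at time `0` gives `Jψ(E_σ(L)) = 0` along `γ`
(`lineDeriv_prolong_comps_eq_zero`).

Take `λ = L₁ vol`. Along `γ`, `Jψ₂(L₁) = ∑ (Jψ₂(ψ₁^σ) E_σ(L) + ψ₁^σ Jψ₂(E_σ(L)))` vanishes because
`γ` is extremal and `ψ₂` generates symmetry transformations. The expressions `E_ν(L₁)` vanish
because `γ` is extremal and `ψ₁` generates symmetry transformations. Hence both terms of the first
variation formula are zero. -/

theorem iter_zero (F : Fin N → α → α) (a : α) : iter F 0 a = a := by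
  unfold iter
  induction List.finRange N with
  | nil => rfl
  | cons i l ih => simp

/-- The transfer principle for iterated operators: a relation respected by each single step survives
iteration. It identifies formal derivatives of forms with those of coefficients, and both formal and
partial derivatives with operators on restricted classes of functions. -/
theorem iter_rel (r : α → β → Prop) {F : Fin N → α → α} {G : Fin N → β → β}
    (h : ∀ i a b, r a b → r (F i a) (G i b)) (I : MIdx N) {a : α} {b : β} (hab : r a b) :
    r (iter F I a) (iter G I b) := by
  unfold iter
  induction List.finRange N with
  | nil => exact hab
  | cons i l ih =>
    simp only [List.foldr_cons]
    generalize I i = k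
    induction k with
    | zero => exact ih
    | succ k ihk => simpa only [Function.iterate_succ_apply'] using h _ _ _ ihk

theorem iter_comp {F : Fin N → α → α} {g : α → α} (h : ∀ i a, g (F i a) = F i (g a))
    (I : MIdx N) (a : α) : g (iter F I a) = iter F I (g a) :=
  iter_rel (fun a b => g a = b) (fun i a b hab => by rw [← hab, h]) I rfl

/-- The fold applies the operators in a fixed order, so the extra `F j` arises in the middle and
commutativity moves it to the outside. The induction runs over duplicate-free lists, where `j` is
met at most once. -/
theorem iter_add_single {F : Fin N → α → α} (h : ∀ i j a, F i (F j a) = F j (F i a))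
    (I : MIdx N) (j : Fin N) (a : α) : iter F (I + Pi.single j 1) a = F j (iter F I a) := by
  have key : ∀ l : List (Fin N), l.Nodup →
      l.foldr (fun i b => (F i)^[(I + Pi.single j 1 : MIdx N) i] b) a =
        if j ∈ l then F j (l.foldr (fun i b => (F i)^[I i] b) a)
        else l.foldr (fun i b => (F i)^[I i] b) a := by
    intro l
    induction l with
    | nil => simp
    | cons i l ih =>
      intro hl
      rw [List.nodup_cons] at hl
      simp only [List.foldr_cons, ih hl.2]
      by_cases hij : j = i
      · subst hij
        simp [hl.1, Function.iterate_succ_apply']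
      · have h0 : (I + Pi.single j 1 : MIdx N) i = I i := by simp [Ne.symm hij]
        rw [h0]
        by_cases hj : j ∈ l
        · simp only [hj, if_true, List.mem_cons, or_true]
          have : Function.Commute (F i) (F j) := fun a => h i j a
          exact (this.iterate_left (I i)) _
        · simp [hj, hij]
  have := key (List.finRange N) (List.nodup_finRange N)
  rwa [if_pos (List.mem_finRange j)] at this

theorem iter_add_single' {F : Fin N → α → α} (h : ∀ i j a, F i (F j a) = F j (F i a))
    (I : MIdx N) (j : Fin N) (a : α) : iter F (I + Pi.single j 1) a = iter F I (F j a) := by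
  rw [iter_add_single h, iter_comp (g := F j) (fun i a => h j i a)]

end Iter

/-! ### Multi-indices -/

section MultiIndex

variable {N : ℕ}

theorem MIdx.len_zero : MIdx.len (0 : MIdx N) = 0 := by simp [MIdx.len]

theorem MIdx.len_add (I J : MIdx N) : (I + J).len = I.len + J.len := by
  simp [MIdx.len, Finset.sum_add_distrib]

theorem MIdx.len_single (j : Fin N) : MIdx.len (Pi.single j 1 : MIdx N) = 1 := by
  simp [MIdx.len]

theorem MIdx.len_add_single (I : MIdx N) (j : Fin N) : (I + Pi.single j 1).len = I.len + 1 := by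
  rw [MIdx.len_add, MIdx.len_single]

theorem MIdx.len_eq_zero {I : MIdx N} (h : I.len = 0) : I = 0 := by
  funext i
  have := Finset.sum_eq_zero_iff.1 h i (Finset.mem_univ i)
  simpa using this

theorem MIdx.sub_add_single {I : MIdx N} {j : Fin N} (h : I j ≠ 0) :
    I - Pi.single j 1 + Pi.single j 1 = I := by
  funext i
  by_cases hij : i = j
  · subst hij
    simp only [Pi.add_apply, Pi.sub_apply, Pi.single_eq_same]
    omega
  · simp [hij]

theorem MIdx.add_single_sub (I : MIdx N) (j : Fin N) :
    I + Pi.single j 1 - Pi.single j 1 = I := by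
  funext i
  simp

theorem MIdx.exists_eq_add_single {I : MIdx N} (h : I.len ≠ 0) :
    ∃ (J : MIdx N) (j : Fin N), I = J + Pi.single j 1 := by
  obtain ⟨j, -, hj⟩ := Finset.exists_ne_zero_of_sum_ne_zero h
  exact ⟨I - Pi.single j 1, j, (MIdx.sub_add_single hj).symm⟩

theorem MIdx.induction {P : MIdx N → Prop} (zero : P 0)
    (add : ∀ I j, P I → P (I + Pi.single j 1)) (I : MIdx N) : P I := by
  induction h : I.len generalizing I with
  | zero => rw [MIdx.len_eq_zero h]; exact zero
  | succ k ih =>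
    obtain ⟨J, j, rfl⟩ := MIdx.exists_eq_add_single (I := I) (by omega)
    rw [MIdx.len_add_single] at h
    exact add J j (ih J (by omega))

theorem midx_mono {k l : ℕ} (h : k ≤ l) : midx N k ⊆ midx N l := fun I hI =>
  mem_midx.2 ((mem_midx.1 hI).trans h)

theorem midx_zero : midx N 0 = {0} := by
  ext I
  rw [mem_midx, Finset.mem_singleton]
  exact ⟨fun h => MIdx.len_eq_zero (by omega), fun h => by simp [h, MIdx.len_zero]⟩

/-- A sum over the multi-indices of length at most `r + 1` of terms that vanish unless `I j ≠ 0`. -/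
theorem sum_midx_succ_shift {A : Type*} [AddCommMonoid A] (r : ℕ) (j : Fin N) (f : MIdx N → A)
    (hf : ∀ I, I j = 0 → f I = 0) :
    ∑ I ∈ midx N (r + 1), f I = ∑ I ∈ midx N r, f (I + Pi.single j 1) := by
  symm
  refine Finset.sum_of_injOn (fun I => I + Pi.single j 1) ?_ ?_ ?_ ?_
  · intro _ _ _ _ h
    exact add_right_cancel h
  · intro I hI
    simp only [Finset.mem_coe, mem_midx, MIdx.len_add_single] at hI ⊢
    omega
  · intro I hI hI'
    by_contra h
    refine hI' ⟨I - Pi.single j 1, ?_, MIdx.sub_add_single fun h0 => h (hf I h0)⟩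
    have h0 := MIdx.sub_add_single (I := I) (j := j) fun h0 => h (hf I h0)
    have h1 := MIdx.len_add_single (I - Pi.single j 1) j
    rw [h0] at h1
    simp only [Finset.mem_coe, mem_midx] at hI ⊢
    omega
  · intros; rfl

end MultiIndex

/-! ### Variational calculus in a differential ring -/

/-- A commutative algebra with commuting derivations `d i` (the formal derivatives) and
`δ σ I` (the partial derivatives with respect to `y^σ_I`), and the commutation relations of the
ring of functions on the jets. -/
structure JetRing (N M : ℕ) (A : Type*) [CommRing A] [Algebra ℝ A] where
  d : Fin N → Derivation ℝ A A
  δ : Fin M → MIdx N → Derivation ℝ A A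
  d_comm : ∀ i j a, d i (d j a) = d j (d i a)
  δ_comm : ∀ σ I τ J a, δ σ I (δ τ J a) = δ τ J (δ σ I a)
  δ_d : ∀ σ I j a, δ σ I (d j a) = d j (δ σ I a) + if I j = 0 then 0 else δ σ (I - Pi.single j 1) a

namespace JetRing

variable {N M : ℕ} {A : Type*} [CommRing A] [Algebra ℝ A] (S : JetRing N M A)

/-- The iterated formal derivative `d_I`. -/
def D (I : MIdx N) : A → A := iter (fun i => S.d i) I

theorem D_zero (a : A) : S.D 0 a = a := iter_zero _ a

theorem D_add_single (I : MIdx N) (j : Fin N) (a : A) :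
    S.D (I + Pi.single j 1) a = S.d j (S.D I a) := iter_add_single S.d_comm I j a

theorem D_add_single' (I : MIdx N) (j : Fin N) (a : A) :
    S.D (I + Pi.single j 1) a = S.D I (S.d j a) := iter_add_single' S.d_comm I j a

theorem D_map_add (I : MIdx N) (a b : A) : S.D I (a + b) = S.D I a + S.D I b := by
  induction I using MIdx.induction with
  | zero => simp [D_zero]
  | add I j ih => simp [D_add_single, ih]

theorem D_map_smul (I : MIdx N) (c : ℝ) (a : A) : S.D I (c • a) = c • S.D I a := by
  induction I using MIdx.induction with
  | zero => simp [D_zero]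
  | add I j ih => simp [D_add_single, ih]

/-- `d_I` as a linear map. -/
def DL (I : MIdx N) : A →ₗ[ℝ] A where
  toFun := S.D I
  map_add' := S.D_map_add I
  map_smul' := S.D_map_smul I

theorem D_map_zero (I : MIdx N) : S.D I 0 = 0 := (S.DL I).map_zero

theorem D_map_neg (I : MIdx N) (a : A) : S.D I (-a) = -S.D I a := (S.DL I).map_neg a

theorem D_map_sum {ι : Type*} (I : MIdx N) (s : Finset ι) (f : ι → A) :
    S.D I (∑ i ∈ s, f i) = ∑ i ∈ s, S.D I (f i) := map_sum (S.DL I) f s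

theorem D_comm_derivation {X : Derivation ℝ A A} (hX : ∀ i a, X (S.d i a) = S.d i (X a))
    (I : MIdx N) (a : A) : X (S.D I a) = S.D I (X a) :=
  iter_comp (g := X) (fun i a => hX i a) I a

/-- `a` depends only on the jets of order `k`. -/
def Ord (k : ℕ) (a : A) : Prop := ∀ σ I, k < MIdx.len I → S.δ σ I a = 0

variable {S}

theorem Ord.mono {k l : ℕ} {a : A} (h : S.Ord k a) (hkl : k ≤ l) : S.Ord l a :=
  fun σ I hI => h σ I (hkl.trans_lt hI)

theorem Ord.mul {k : ℕ} {a b : A} (ha : S.Ord k a) (hb : S.Ord k b) : S.Ord k (a * b) :=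
  fun σ I hI => by simp [ha σ I hI, hb σ I hI]

theorem Ord.δ {k : ℕ} {a : A} (h : S.Ord k a) (σ : Fin M) (I : MIdx N) : S.Ord k (S.δ σ I a) :=
  fun τ J hJ => by rw [S.δ_comm, h τ J hJ, map_zero]

theorem Ord.d {k : ℕ} {a : A} (h : S.Ord k a) (j : Fin N) : S.Ord (k + 1) (S.d j a) := by
  intro σ I hI
  rw [S.δ_d, h σ I (by omega), map_zero, zero_add]
  split_ifs with h0
  · rfl
  · refine h _ _ ?_
    have := MIdx.len_add_single (I - Pi.single j 1) j
    rw [MIdx.sub_add_single h0] at this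
    omega

theorem Ord.D {k : ℕ} {a : A} (h : S.Ord k a) (I : MIdx N) : S.Ord (k + I.len) (S.D I a) := by
  induction I using MIdx.induction with
  | zero => simpa [D_zero] using h.mono (by omega)
  | add I j ih =>
    rw [D_add_single, MIdx.len_add_single]
    exact ih.d j

variable (S)

/-- The bilinear operator `∑_I (-1)^|I| d_I (∂g/∂y^σ_I · h)`. -/
def F (r : ℕ) (σ : Fin M) (g h : A) : A :=
  ∑ I ∈ midx N r, (-1 : ℝ) ^ I.len • S.D I (S.δ σ I g * h)

/-- The Euler–Lagrange expression `∑_I (-1)^|I| d_I (∂L/∂y^σ_I)`. -/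
def E (r : ℕ) (σ : Fin M) (L : A) : A := ∑ I ∈ midx N r, (-1 : ℝ) ^ I.len • S.D I (S.δ σ I L)

variable {S}

theorem E_eq_F (r : ℕ) (σ : Fin M) (L : A) : S.E r σ L = S.F r σ L 1 := by simp [E, F]

theorem F_sum_left {ι : Type*} (r : ℕ) (σ : Fin M) (s : Finset ι) (g : ι → A) (h : A) :
    S.F r σ (∑ i ∈ s, g i) h = ∑ i ∈ s, S.F r σ (g i) h := by
  simp only [F]
  rw [Finset.sum_comm]
  refine Finset.sum_congr rfl fun I _ => ?_
  rw [map_sum, Finset.sum_mul, D_map_sum, Finset.smul_sum]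

theorem E_sum {ι : Type*} (r : ℕ) (σ : Fin M) (s : Finset ι) (g : ι → A) :
    S.E r σ (∑ i ∈ s, g i) = ∑ i ∈ s, S.E r σ (g i) := by
  simp only [E_eq_F, F_sum_left]

theorem E_add (r : ℕ) (σ : Fin M) (g h : A) : S.E r σ (g + h) = S.E r σ g + S.E r σ h := by
  simp [E, D_map_add, Finset.sum_add_distrib]

theorem E_smul (r : ℕ) (σ : Fin M) (c : ℝ) (g : A) : S.E r σ (c • g) = c • S.E r σ g := by
  simp only [E, Finset.smul_sum, Derivation.map_smul, D_map_smul]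
  exact Finset.sum_congr rfl fun I _ => smul_comm _ _ _

theorem E_mul (r : ℕ) (σ : Fin M) (g h : A) : S.E r σ (g * h) = S.F r σ g h + S.F r σ h g := by
  simp only [E, F, ← Finset.sum_add_distrib, ← smul_add, ← D_map_add]
  refine Finset.sum_congr rfl fun I _ => ?_
  rw [Derivation.leibniz, smul_eq_mul, smul_eq_mul, mul_comm (S.δ σ I g), mul_comm (S.δ σ I h),
    add_comm]

theorem F_eq_of_ord {r r' k : ℕ} {σ : Fin M} {g h : A} (hg : S.Ord k g) (hr : k ≤ r)
    (hr' : k ≤ r') : S.F r σ g h = S.F r' σ g h := by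
  have : ∀ r, k ≤ r → S.F r σ g h = S.F k σ g h := by
    intro r hr
    refine (Finset.sum_subset (midx_mono hr) fun I _ hI => ?_).symm
    rw [mem_midx, not_le] at hI
    rw [hg σ I hI, zero_mul, D_map_zero, smul_zero]
  rw [this r hr, this r' hr']

/-- Integration by parts inside `F`. The commutator `[∂/∂y_I, d_j]` contributes a second sum which,
after the shift of the index, is `-∑ (-1)^|I| d_I d_j(∂g/∂y_I · h)`. By the Leibniz rule one half of
it cancels the first sum. -/
theorem F_d {r : ℕ} {σ : Fin M} {g : A} (hg : S.Ord r g) (j : Fin N) (h : A) :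
    S.F (r + 1) σ (S.d j g) h = -S.F r σ g (S.d j h) := by
  have h1 : S.F (r + 1) σ (S.d j g) h =
      ∑ I ∈ midx N (r + 1), (-1 : ℝ) ^ I.len • S.D I (S.d j (S.δ σ I g) * h) +
      ∑ I ∈ midx N (r + 1), (-1 : ℝ) ^ I.len •
        S.D I ((if I j = 0 then 0 else S.δ σ (I - Pi.single j 1) g) * h) := by
    simp only [F, ← Finset.sum_add_distrib, ← smul_add, ← D_map_add, ← add_mul, S.δ_d]
  have h2 : ∑ I ∈ midx N (r + 1), (-1 : ℝ) ^ I.len • S.D I (S.d j (S.δ σ I g) * h) =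
      ∑ I ∈ midx N r, (-1 : ℝ) ^ I.len • S.D I (S.d j (S.δ σ I g) * h) := by
    refine (Finset.sum_subset (midx_mono (Nat.le_succ r)) fun I _ hI => ?_).symm
    rw [mem_midx, not_le] at hI
    rw [hg σ I hI, map_zero, zero_mul, D_map_zero, smul_zero]
  rw [h1, h2, sum_midx_succ_shift r j _ fun I hI => by simp [hI, D_map_zero], F,
    ← Finset.sum_add_distrib, ← Finset.sum_neg_distrib]
  refine Finset.sum_congr rfl fun I _ => ?_
  rw [if_neg (by simp), MIdx.add_single_sub, MIdx.len_add_single, pow_succ, D_add_single',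
    Derivation.leibniz, D_map_add, smul_eq_mul, smul_eq_mul, mul_comm h (S.d j _)]
  module

theorem F_D {r R : ℕ} {σ : Fin M} {g : A} (hg : S.Ord r g) (J : MIdx N) (hR : r + J.len ≤ R)
    (h : A) : S.F R σ (S.D J g) h = (-1 : ℝ) ^ J.len • S.F r σ g (S.D J h) := by
  induction J using MIdx.induction generalizing R h with
  | zero =>
    simp only [D_zero, MIdx.len_zero, pow_zero, one_smul]
    exact F_eq_of_ord hg (by omega) le_rfl
  | add J j ih =>
    rw [MIdx.len_add_single] at hR ⊢
    rw [D_add_single, F_eq_of_ord ((hg.D J).d j) hR le_rfl, F_d (hg.D J), ih le_rfl,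
      D_add_single', pow_succ]
    simp

/-- The Euler–Lagrange expressions of a total derivative vanish. -/
theorem E_d {r R : ℕ} {σ : Fin M} {g : A} (hg : S.Ord r g) (hR : r + 1 ≤ R) (j : Fin N) :
    S.E R σ (S.d j g) = 0 := by
  -- `E` is `F` with second argument `1`, and `d_j 1 = 0`.
  rw [E_eq_F, F_eq_of_ord (hg.d j) hR le_rfl, F_d hg]
  simp [F, D_map_zero]

/-- Moving one `d_j` from one factor to the other changes the product by a sign and a total
derivative, which `E` kills. The bound on `R` leaves every intermediate product of order at most `R
- 1`, as `E_d` needs. -/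
theorem E_mul_D {r s R : ℕ} {σ : Fin M} {a b : A} (ha : S.Ord s a) (hb : S.Ord r b) (J : MIdx N)
    (hR : s + r + J.len ≤ R) :
    S.E R σ (a * S.D J b) = (-1 : ℝ) ^ J.len • S.E R σ (S.D J a * b) := by
  induction J using MIdx.induction generalizing s r a b with
  | zero => simp [D_zero, MIdx.len_zero]
  | add J j ih =>
    rw [MIdx.len_add_single] at hR ⊢
    rw [D_add_single', ih ha (hb.d j) (by omega), D_add_single, pow_succ]
    have h1 : S.Ord (R - 1) (S.D J a * b) :=
      ((ha.D J).mono (by omega)).mul (hb.mono (by omega))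
    have h2 := E_d (σ := σ) h1 (R := R) (by omega) j
    rw [Derivation.leibniz, E_add, smul_eq_mul, smul_eq_mul, mul_comm b] at h2
    rw [eq_neg_of_add_eq_zero_left h2]
    simp

/-- The Euler–Lagrange expressions of the Lagrangian deformed by the prolongation `X` of `ψ`. -/
theorem E_deformed {r R : ℕ} {L : A} (hL : S.Ord r L) (hR : 2 * r ≤ R) (ψ : Fin M → A)
    (hψ : ∀ σ, S.Ord 0 (ψ σ)) (X : Derivation ℝ A A) (hXd : ∀ i a, X (S.d i a) = S.d i (X a))
    (hX : ∀ a, S.Ord r a → X a = ∑ σ, ∑ J ∈ midx N r, S.D J (ψ σ) * S.δ σ J a) (ν : Fin M) :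
    S.E R ν (∑ σ, ψ σ * S.E r σ L) = X (S.E r ν L) + ∑ σ, S.δ ν 0 (ψ σ) * S.E r σ L := by
  -- The sign `(-1)^|J|` in `E_σ(L)` cancels the one from moving `d_J` onto `ψ^σ`: up to total
  -- derivatives the deformed Lagrangian is the variation of `L`.
  have h1 : S.E R ν (∑ σ, ψ σ * S.E r σ L) =
      ∑ σ, ∑ J ∈ midx N r, S.E R ν (S.D J (ψ σ) * S.δ σ J L) := by
    rw [E_sum]
    refine Finset.sum_congr rfl fun σ _ => ?_
    rw [show S.E r σ L = ∑ I ∈ midx N r, (-1 : ℝ) ^ I.len • S.D I (S.δ σ I L) from rfl,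
      Finset.mul_sum, E_sum]
    refine Finset.sum_congr rfl fun J hJ => ?_
    rw [mem_midx] at hJ
    rw [mul_smul_comm, E_smul, E_mul_D (hψ σ) (hL.δ σ J) J (by omega), smul_smul, ← mul_pow]
    simp
  -- After `d_J` is moved off `ψ^σ`, only the term `I = 0` of `F` is left, because `ψ^σ` has order
  -- zero.
  have h2 : ∀ σ, ∑ J ∈ midx N r, S.F R ν (S.D J (ψ σ)) (S.δ σ J L) =
      S.δ ν 0 (ψ σ) * S.E r σ L := by
    intro σ
    rw [E, Finset.mul_sum]
    refine Finset.sum_congr rfl fun J hJ => ?_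
    rw [mem_midx] at hJ
    rw [F_D (hψ σ) J (by omega), F, midx_zero, Finset.sum_singleton]
    simp [D_zero, MIdx.len_zero]
  -- This half of the product rule is `X` applied to `E_ν(L)`: `X` passes through `d_I`, and partial
  -- derivatives commute. The range of summation shrinks to `r` since `∂L/∂y^σ_J` has order `r`.
  have h3 : ∑ σ, ∑ J ∈ midx N r, S.F R ν (S.δ σ J L) (S.D J (ψ σ)) = X (S.E r ν L) := by
    have : ∀ σ, ∀ J, S.F R ν (S.δ σ J L) (S.D J (ψ σ)) = S.F r ν (S.δ σ J L) (S.D J (ψ σ)) :=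
      fun σ J => F_eq_of_ord (hL.δ σ J) (by omega) le_rfl
    simp only [this]
    simp only [F, E, map_sum, Derivation.map_smul]
    have h4 : ∀ I, X (S.D I (S.δ ν I L)) =
        ∑ σ, ∑ J ∈ midx N r, S.D I (S.δ ν I (S.δ σ J L) * S.D J (ψ σ)) := by
      intro I
      rw [S.D_comm_derivation hXd, hX _ (hL.δ ν I), D_map_sum]
      refine Finset.sum_congr rfl fun σ _ => ?_
      rw [D_map_sum]
      refine Finset.sum_congr rfl fun J _ => ?_
      rw [S.δ_comm ν I, mul_comm]
    simp only [h4, Finset.smul_sum]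
    conv_rhs => rw [Finset.sum_comm]
    exact Finset.sum_congr rfl fun σ _ => Finset.sum_comm
  rw [h1]
  simp only [E_mul, Finset.sum_add_distrib, h2, h3]
  exact add_comm _ _

/-- Integration by parts: the difference between `a w_I` and `(-1)^|I| d_I a w_0` is the formal
divergence `∑ (d_j B^{J,j} w_J + B^{J,j} w_{J+j})`. -/
theorem exists_byParts (I : MIdx N) (a : A) : ∃ B : MIdx N → Fin N → A,
    ∀ (r : ℕ), I.len ≤ r → ∀ (V : Type) [AddCommGroup V] [Module A V] (w : MIdx N → V),
      a • w I = ((-1 : ℝ) ^ I.len • S.D I a) • w 0 -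
        ∑ J ∈ midx N r, ∑ j, (S.d j (B J j) • w J + B J j • w (J + Pi.single j 1)) := by
  induction I using MIdx.induction generalizing a with
  | zero => exact ⟨0, fun r _ V _ _ w => by simp [D_zero, MIdx.len_zero]⟩
  | add I j ih =>
    -- The single coefficient `-a` in the slot `(I, j)` turns `a w_{I+j}` into `(-d_j a) w_I`, to
    -- which the induction hypothesis applies.
    obtain ⟨B, hB⟩ := ih (-S.d j a)
    refine ⟨B + Pi.single I (Pi.single j (-a)), fun r hr V _ _ w => ?_⟩
    rw [MIdx.len_add_single] at hr ⊢
    have h1 := hB r (by omega) V w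
    have h2 : ∑ J ∈ midx N r, ∑ i, (S.d i ((Pi.single I (Pi.single j (-a)) : MIdx N → Fin N → A) J i) • w J +
        (Pi.single I (Pi.single j (-a)) : MIdx N → Fin N → A) J i • w (J + Pi.single i 1)) =
        -(S.d j a • w I) - a • w (I + Pi.single j 1) := by
      rw [Finset.sum_eq_single I, Finset.sum_eq_single j]
      · simp [sub_eq_add_neg]
      · intro i _ hi
        simp [hi]
      · simp
      · intro J _ hJ
        simp [hJ]
      · intro h
        exact absurd (mem_midx.2 (by omega)) h
    simp only [Pi.add_apply, map_add, add_smul, add_add_add_comm, Finset.sum_add_distrib] at h1 h2 ⊢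
    rw [D_add_single', pow_succ]
    rw [D_map_neg] at h1
    have h3 : ((-1 : ℝ) ^ I.len * -1) • S.D I (S.d j a) =
      (-1 : ℝ) ^ I.len • -S.D I (S.d j a) := by module
    rw [h3, h2, eq_add_of_sub_eq h1.symm]
    simp only [neg_smul]
    abel

end JetRing

/-! ### Smooth functions of finite order on the space of jets -/

section FiniteOrder

variable {N M : ℕ}

/-- `trunc` as a linear map. -/
def truncL (k : ℕ) : Jet N M →ₗ[ℝ] FinJet N M k where
  toFun := trunc k
  map_add' _ _ := rfl
  map_smul' _ _ := rfl

/-- The projection of jets of order `l` onto jets of order `k ≤ l`. -/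
def restrict {k l : ℕ} (h : k ≤ l) : FinJet N M l →L[ℝ] FinJet N M k :=
  (ContinuousLinearMap.fst ℝ _ _).prod
    (ContinuousLinearMap.pi fun σ => ContinuousLinearMap.pi fun I =>
      (ContinuousLinearMap.proj (R := ℝ) (φ := fun _ : {I : MIdx N // I ∈ midx N l} => ℝ)
        ⟨I.1, midx_mono h I.2⟩).comp
        ((ContinuousLinearMap.proj (R := ℝ)
          (φ := fun _ : Fin M => {I : MIdx N // I ∈ midx N l} → ℝ) σ).comp
          (ContinuousLinearMap.snd ℝ _ _)))

theorem restrict_trunc {k l : ℕ} (h : k ≤ l) (z : Jet N M) : restrict h (trunc l z) = trunc k z := rfl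

theorem FinJet.contDiff_pt {k : ℕ} : ContDiff ℝ ∞ (FinJet.pt : FinJet N M k → Pt N M) := by
  unfold FinJet.pt
  fun_prop

theorem FinJet.isOpen_pt {k : ℕ} {D : Set (Pt N M)} (hD : IsOpen D) :
    IsOpen {z : FinJet N M k | z.pt ∈ D} := hD.preimage FinJet.contDiff_pt.continuous

theorem eventually_pt_mem {D : Set (Pt N M)} (hD : IsOpen D) {z : Jet N M} (hz : z.pt ∈ D)
    (v : Jet N M) : ∀ᶠ t : ℝ in 𝓝 0, (z + t • v).pt ∈ D := by
  have h : ContinuousAt (fun t : ℝ => z.pt + t • v.pt) 0 := by fun_prop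
  exact h.eventually_mem (hD.mem_nhds (by simpa using hz))

/-- `f` is, over `D`, a smooth function of the jets of order `k`. -/
def HasOrder {E : Type*} [NormedAddCommGroup E] [NormedSpace ℝ E] (D : Set (Pt N M)) (k : ℕ)
    (f : Jet N M → E) : Prop :=
  ∃ g : FinJet N M k → E, ContDiffOn ℝ ∞ g {z | FinJet.pt z ∈ D} ∧
    ∀ z : Jet N M, z.pt ∈ D → f z = g (trunc k z)

variable {E E' : Type*} [NormedAddCommGroup E] [NormedSpace ℝ E] [NormedAddCommGroup E']
  [NormedSpace ℝ E'] {D : Set (Pt N M)} {k l : ℕ}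

theorem HasOrder.congr {f f' : Jet N M → E} (h : HasOrder D k f)
    (hf : ∀ z : Jet N M, z.pt ∈ D → f' z = f z) : HasOrder D k f' := by
  obtain ⟨g, hg, hfg⟩ := h
  exact ⟨g, hg, fun z hz => (hf z hz).trans (hfg z hz)⟩

theorem HasOrder.mono {f : Jet N M → E} (h : HasOrder D k f) (hkl : k ≤ l) : HasOrder D l f := by
  obtain ⟨g, hg, hfg⟩ := h
  exact ⟨g ∘ restrict hkl, hg.comp (restrict hkl).contDiff.contDiffOn fun z hz => hz,
    fun z hz => hfg z hz⟩

theorem HasOrder.const (c : E) : HasOrder D k (fun _ => c) := ⟨fun _ => c, contDiffOn_const, fun _ _ => rfl⟩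

theorem HasOrder.prodMk {f : Jet N M → E} {f' : Jet N M → E'} (h : HasOrder D k f)
    (h' : HasOrder D k f') : HasOrder D k (fun z => (f z, f' z)) := by
  obtain ⟨g, hg, hfg⟩ := h
  obtain ⟨g', hg', hfg'⟩ := h'
  exact ⟨fun z => (g z, g' z), hg.prodMk hg', fun z hz => congrArg₂ Prod.mk (hfg z hz) (hfg' z hz)⟩

theorem HasOrder.pi {ι : Type*} [Fintype ι] {f : Jet N M → ι → E}
    (h : ∀ i, HasOrder D k (fun z => f z i)) : HasOrder D k f := by
  choose g hg hfg using h
  exact ⟨fun z i => g i z, contDiffOn_pi.2 hg, fun z hz => funext fun i => hfg i z hz⟩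

theorem HasOrder.comp {f : Jet N M → E} (h : HasOrder D k f) {φ : E → E'} (hφ : ContDiff ℝ ∞ φ) :
    HasOrder D k (fun z => φ (f z)) := by
  obtain ⟨g, hg, hfg⟩ := h
  exact ⟨φ ∘ g, hφ.comp_contDiffOn hg, fun z hz => congrArg φ (hfg z hz)⟩

theorem HasOrder.add {f f' : Jet N M → E} (h : HasOrder D k f) (h' : HasOrder D k f') :
    HasOrder D k (f + f') := (h.prodMk h').comp (φ := fun a => a.1 + a.2) (by fun_prop)

theorem HasOrder.mul {f f' : Jet N M → ℝ} (h : HasOrder D k f) (h' : HasOrder D k f') :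
    HasOrder D k (f * f') := (h.prodMk h').comp (φ := fun a => a.1 * a.2) (by fun_prop)

theorem HasOrder.sum {ι : Type*} {s : Finset ι} {f : ι → Jet N M → E}
    (h : ∀ i ∈ s, HasOrder D k (f i)) : HasOrder D k (∑ i ∈ s, f i) := by
  classical
  induction s using Finset.induction_on with
  | empty => exact HasOrder.const 0
  | insert i s hi ih =>
    rw [Finset.sum_insert hi]
    exact (h i (by simp)).add (ih fun j hj => h j (by simp [hj]))

theorem HasOrder.trunc_of_components {η : Jet N M → Jet N M}
    (h₁ : ∀ i, HasOrder D l (fun z => (η z).1 i))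
    (h₂ : ∀ σ, ∀ I ∈ midx N k, HasOrder D l (fun z => (η z).2 σ I)) :
    HasOrder D l (fun z => trunc k (η z)) :=
  (HasOrder.pi h₁).prodMk (HasOrder.pi fun σ => HasOrder.pi fun I => h₂ σ I.1 I.2)

theorem hasOrder_coord (σ : Fin M) {I : MIdx N} (hI : I.len ≤ k) :
    HasOrder D k (fun z : Jet N M => z.2 σ I) :=
  ⟨fun z => z.2 σ ⟨I, mem_midx.2 hI⟩, by fun_prop, fun _ _ => rfl⟩

theorem hasOrder_pt {φ : Pt N M → E} (hφ : ContDiffOn ℝ ∞ φ D) :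
    HasOrder D k (fun z : Jet N M => φ z.pt) :=
  ⟨fun z => φ z.pt, hφ.comp FinJet.contDiff_pt.contDiffOn fun _ hz => hz, fun _ _ => rfl⟩

/-! ### Derivatives of functions of finite order -/

theorem lineDeriv_congr_of_isOpen (hD : IsOpen D) {f f' : Jet N M → E}
    (h : ∀ z : Jet N M, z.pt ∈ D → f z = f' z) {z : Jet N M} (hz : z.pt ∈ D) (v : Jet N M) :
    lineDeriv ℝ f z v = lineDeriv ℝ f' z v :=
  Filter.EventuallyEq.deriv_eq ((eventually_pt_mem hD hz v).mono fun _ ht => h _ ht)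

/-- The space `Jet` has infinitely many coordinates and no norm, so only derivatives along lines are
taken there. Since `trunc k` is linear and membership in `D` depends on the 0-jet alone, they are
computed by the Fréchet derivative of the finite-order representative. -/
theorem hasLineDerivAt_of_trunc (hD : IsOpen D) {f : Jet N M → E} {g : FinJet N M k → E}
    {g' : FinJet N M k →L[ℝ] E} (hfg : ∀ z : Jet N M, z.pt ∈ D → f z = g (trunc k z))
    {z : Jet N M} (hz : z.pt ∈ D) (hg : HasFDerivAt g g' (trunc k z)) (v : Jet N M) :
    HasLineDerivAt ℝ f (g' (trunc k v)) z v := by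
  have h := hg.hasLineDerivAt (trunc k v)
  unfold HasLineDerivAt at h ⊢
  exact h.congr_of_eventuallyEq ((eventually_pt_mem hD hz v).mono fun t ht => hfg _ ht)

theorem HasOrder.exists_hasLineDerivAt (hD : IsOpen D) {f : Jet N M → E} (h : HasOrder D k f)
    {z : Jet N M} (hz : z.pt ∈ D) :
    ∃ g' : FinJet N M k →L[ℝ] E, ∀ v, HasLineDerivAt ℝ f (g' (trunc k v)) z v := by
  obtain ⟨g, hg, hfg⟩ := h
  have h1 : HasFDerivAt g (fderiv ℝ g (trunc k z)) (trunc k z) :=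
    ((hg.contDiffAt ((FinJet.isOpen_pt hD).mem_nhds hz)).differentiableAt (by simp)).hasFDerivAt
  exact ⟨_, fun v => hasLineDerivAt_of_trunc hD hfg hz h1 v⟩

theorem HasOrder.hasLineDerivAt (hD : IsOpen D) {f : Jet N M → E} (h : HasOrder D k f)
    {z : Jet N M} (hz : z.pt ∈ D) (v : Jet N M) : HasLineDerivAt ℝ f (lineDeriv ℝ f z v) z v := by
  obtain ⟨g', hg'⟩ := h.exists_hasLineDerivAt hD hz
  exact (hg' v).lineDifferentiableAt.hasLineDerivAt

/-- The differential at `z` of a function of finite order. -/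
theorem HasOrder.exists_linearMap (hD : IsOpen D) {f : Jet N M → E} (h : HasOrder D k f)
    {z : Jet N M} (hz : z.pt ∈ D) : ∃ L : Jet N M →ₗ[ℝ] E, ∀ v, lineDeriv ℝ f z v = L v := by
  obtain ⟨g', hg'⟩ := h.exists_hasLineDerivAt hD hz
  exact ⟨g'.toLinearMap.comp (truncL k), fun v => (hg' v).lineDeriv⟩

theorem HasOrder.lineDeriv_congr_trunc (hD : IsOpen D) {f : Jet N M → E} (h : HasOrder D k f)
    {z : Jet N M} (hz : z.pt ∈ D) {v w : Jet N M} (hvw : trunc k v = trunc k w) :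
    lineDeriv ℝ f z v = lineDeriv ℝ f z w := by
  obtain ⟨g', hg'⟩ := h.exists_hasLineDerivAt hD hz
  rw [(hg' v).lineDeriv, (hg' w).lineDeriv, hvw]

theorem HasOrder.lineDeriv_field (hD : IsOpen D) {f : Jet N M → E} (h : HasOrder D k f) (hkl : k ≤ l)
    {ξ : Jet N M → Jet N M} (hξ : HasOrder D l (fun z => trunc k (ξ z))) :
    HasOrder D l (fun z => lineDeriv ℝ f z (ξ z)) := by
  obtain ⟨g, hg, hfg⟩ := h
  obtain ⟨Ξ, hΞ, hξΞ⟩ := hξ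
  have hD' := FinJet.isOpen_pt (k := k) hD
  refine ⟨fun ζ => fderiv ℝ g (restrict hkl ζ) (Ξ ζ), ?_, fun z hz => ?_⟩
  · have h1 : ContDiffOn ℝ ∞ (fderiv ℝ g) {z | FinJet.pt z ∈ D} :=
      hg.fderiv_of_isOpen hD' (by simp)
    have h2 : ContDiffOn ℝ ∞ (fun ζ => fderiv ℝ g (restrict hkl ζ)) {z | FinJet.pt z ∈ D} :=
      h1.comp (restrict hkl).contDiff.contDiffOn fun z hz => hz
    exact h2.clm_apply hΞ
  · have h1 : HasFDerivAt g (fderiv ℝ g (trunc k z)) (trunc k z) :=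
      ((hg.contDiffAt (hD'.mem_nhds hz)).differentiableAt (by simp)).hasFDerivAt
    have h2 := hξΞ z hz
    dsimp only at h2 ⊢
    rw [(hasLineDerivAt_of_trunc hD hfg hz h1 (ξ z)).lineDeriv, h2, restrict_trunc]

theorem hasLineDerivAt_trunc {η : Jet N M → Jet N M} {a z v : Jet N M}
    (h₁ : ∀ i, HasLineDerivAt ℝ (fun z' => (η z').1 i) (a.1 i) z v)
    (h₂ : ∀ σ I, HasLineDerivAt ℝ (fun z' => (η z').2 σ I) (a.2 σ I) z v) :
    HasLineDerivAt ℝ (fun z' => trunc k (η z')) (trunc k a) z v := by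
  unfold HasLineDerivAt at *
  exact (hasDerivAt_pi.2 h₁).prodMk (hasDerivAt_pi.2 fun σ => hasDerivAt_pi.2 fun I => h₂ σ I.1)

/-- The commutator of the derivatives along two vector fields is the derivative along their
bracket. -/
theorem HasOrder.lineDeriv_lineDeriv_sub (hD : IsOpen D) {f : Jet N M → ℝ} (h : HasOrder D k f)
    {ξ η : Jet N M → Jet N M} {a b : Jet N M} {z : Jet N M} (hz : z.pt ∈ D)
    (hη : HasLineDerivAt ℝ (fun z' => trunc k (η z')) (trunc k a) z (ξ z))
    (hξ : HasLineDerivAt ℝ (fun z' => trunc k (ξ z')) (trunc k b) z (η z)) :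
    lineDeriv ℝ (fun z' => lineDeriv ℝ f z' (η z')) z (ξ z) -
      lineDeriv ℝ (fun z' => lineDeriv ℝ f z' (ξ z')) z (η z) =
      lineDeriv ℝ f z (a - b) := by
  obtain ⟨g, hg, hfg⟩ := h
  have hD' := FinJet.isOpen_pt (k := k) hD
  have h1 : ∀ z : Jet N M, z.pt ∈ D → HasFDerivAt g (fderiv ℝ g (trunc k z)) (trunc k z) :=
    fun z hz => ((hg.contDiffAt (hD'.mem_nhds hz)).differentiableAt (by simp)).hasFDerivAt
  have h2 : ∀ z : Jet N M, z.pt ∈ D → ∀ v,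
      lineDeriv ℝ f z v = fderiv ℝ g (trunc k z) (trunc k v) :=
    fun z hz v => (hasLineDerivAt_of_trunc hD hfg hz (h1 z hz) v).lineDeriv
  have h3 : HasFDerivAt (fderiv ℝ g) (fderiv ℝ (fderiv ℝ g) (trunc k z)) (trunc k z) :=
    (((hg.fderiv_of_isOpen hD' (m := ∞) (by simp)).contDiffAt (hD'.mem_nhds hz)).differentiableAt
      (by simp)).hasFDerivAt
  -- Second derivatives split into a Hessian term and a term from the derivative of the inner field.
  -- In the commutator the Hessian terms cancel by symmetry.
  have key : ∀ (ξ η : Jet N M → Jet N M) (a : Jet N M),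
      HasLineDerivAt ℝ (fun z' => trunc k (η z')) (trunc k a) z (ξ z) →
      lineDeriv ℝ (fun z' => lineDeriv ℝ f z' (η z')) z (ξ z) =
        fderiv ℝ (fderiv ℝ g) (trunc k z) (trunc k (ξ z)) (trunc k (η z)) +
          fderiv ℝ g (trunc k z) (trunc k a) := by
    intro ξ η a ha
    rw [lineDeriv_congr_of_isOpen hD (fun z hz => h2 z hz (η z)) hz]
    refine HasLineDerivAt.lineDeriv ?_
    have h4 := hasLineDerivAt_of_trunc hD (f := fun z => fderiv ℝ g (trunc k z))
      (fun _ _ => rfl) hz h3 (ξ z)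
    unfold HasLineDerivAt at ha h4 ⊢
    simpa using h4.clm_apply ha
  have hsymm : IsSymmSndFDerivAt ℝ g (trunc k z) :=
    (hg.contDiffAt (hD'.mem_nhds hz)).isSymmSndFDerivAt
      (by simpa using WithTop.coe_le_coe.2 (le_top : (2 : ℕ∞) ≤ ⊤))
  rw [key ξ η a hη, key η ξ b hξ, h2 z hz, hsymm.eq, show trunc k (a - b) = trunc k a - trunc k b from rfl,
    map_sub]
  ring

/-! ### The ring of functions of finite order and its derivations -/

variable (D) in
/-- The ring of the functions that are, over `D`, smooth functions of the jets of some order. -/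
def JetFun : Subalgebra ℝ (Jet N M → ℝ) where
  carrier := {f | ∃ k, HasOrder D k f}
  mul_mem' := by
    rintro f g ⟨k, hk⟩ ⟨l, hl⟩
    exact ⟨max k l, (hk.mono (le_max_left _ _)).mul (hl.mono (le_max_right _ _))⟩
  add_mem' := by
    rintro f g ⟨k, hk⟩ ⟨l, hl⟩
    exact ⟨max k l, (hk.mono (le_max_left _ _)).add (hl.mono (le_max_right _ _))⟩
  algebraMap_mem' c := ⟨0, HasOrder.const c⟩

variable (D) in
/-- Vector fields whose components are functions of finite order over `D`. -/
def IsJetField (ξ : Jet N M → Jet N M) : Prop :=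
  ∀ k, ∃ l, k ≤ l ∧ HasOrder D l (fun z => trunc k (ξ z))

open Classical in
/-- The derivative along a vector field, as a derivation. -/
def JetFun.deriv (hD : IsOpen D) (ξ : Jet N M → Jet N M) (hξ : IsJetField D ξ) :
    Derivation ℝ (JetFun D) (JetFun D) :=
  Derivation.mk'
    -- Off `D` nothing is known about `f`, so the value is set to `0` there; the laws of a
    -- derivation then hold as equalities of functions on the whole space.
    { toFun := fun f => ⟨fun z => if z.pt ∈ D then lineDeriv ℝ f.1 z (ξ z) else 0, by
        obtain ⟨k, hk⟩ := f.2
        obtain ⟨l, hkl, hl⟩ := hξ k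
        exact ⟨l, (hk.lineDeriv_field hD hkl hl).congr fun z hz => if_pos hz⟩⟩
      map_add' := fun f g => by
        ext z
        obtain ⟨k, hk⟩ := f.2
        obtain ⟨l, hl⟩ := g.2
        by_cases hz : z.pt ∈ D
        · simp only [hz, if_true, Subalgebra.coe_add, Pi.add_apply]
          exact (HasDerivAt.add (hk.hasLineDerivAt hD hz (ξ z)) (hl.hasLineDerivAt hD hz (ξ z))).deriv
        · simp [hz]
      map_smul' := fun c f => by
        ext z
        obtain ⟨k, hk⟩ := f.2
        by_cases hz : z.pt ∈ D
        · simp only [hz, if_true, Subalgebra.coe_smul, Pi.smul_apply, RingHom.id_apply, smul_eq_mul]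
          exact (HasDerivAt.const_mul c (hk.hasLineDerivAt hD hz (ξ z))).deriv
        · simp [hz] }
    fun f g => by
      ext z
      obtain ⟨k, hk⟩ := f.2
      obtain ⟨l, hl⟩ := g.2
      by_cases hz : z.pt ∈ D
      · have := (HasDerivAt.mul (hk.hasLineDerivAt hD hz (ξ z)) (hl.hasLineDerivAt hD hz (ξ z))).deriv
        simp only [zero_smul, add_zero] at this
        simp only [LinearMap.coe_mk, AddHom.coe_mk, hz, if_true, Subalgebra.coe_mul, Subalgebra.coe_add,
          smul_eq_mul, Pi.add_apply, Pi.mul_apply]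
        rw [mul_comm (g.1 z), add_comm (_ * _)]
        exact this
      · simp [hz]

theorem JetFun.deriv_apply (hD : IsOpen D) {ξ : Jet N M → Jet N M} (hξ : IsJetField D ξ)
    (f : JetFun D) {z : Jet N M} (hz : z.pt ∈ D) :
    (JetFun.deriv hD ξ hξ f).1 z = lineDeriv ℝ f.1 z (ξ z) := if_pos hz

theorem JetFun.deriv_apply_of_notMem (hD : IsOpen D) {ξ : Jet N M → Jet N M} (hξ : IsJetField D ξ)
    (f : JetFun D) {z : Jet N M} (hz : z.pt ∉ D) : (JetFun.deriv hD ξ hξ f).1 z = 0 := if_neg hz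

theorem JetFun.deriv_comm (hD : IsOpen D) {ξ η : Jet N M → Jet N M} (hξ : IsJetField D ξ)
    (hη : IsJetField D η) {a b : Jet N M → Jet N M}
    (h₁ : ∀ z : Jet N M, z.pt ∈ D → ∀ k,
      HasLineDerivAt ℝ (fun z' => trunc k (η z')) (trunc k (a z)) z (ξ z))
    (h₂ : ∀ z : Jet N M, z.pt ∈ D → ∀ k,
      HasLineDerivAt ℝ (fun z' => trunc k (ξ z')) (trunc k (b z)) z (η z))
    (f : JetFun D) {z : Jet N M} (hz : z.pt ∈ D) :
    (deriv hD ξ hξ (deriv hD η hη f)).1 z =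
      (deriv hD η hη (deriv hD ξ hξ f)).1 z + lineDeriv ℝ f.1 z (a z - b z) := by
  obtain ⟨k, hk⟩ := f.2
  rw [deriv_apply hD hξ _ hz, deriv_apply hD hη _ hz,
    lineDeriv_congr_of_isOpen hD (fun z hz => deriv_apply hD hη f hz) hz,
    lineDeriv_congr_of_isOpen hD (fun z hz => deriv_apply hD hξ f hz) hz,
    ← hk.lineDeriv_lineDeriv_sub hD hz (h₁ z hz k) (h₂ z hz k)]
  ring

end FiniteOrder

/-! ### Formal and vertical derivatives as commuting derivations of functions of finite order -/

section JetDerivations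

variable {N M : ℕ} {D : Set (Pt N M)} {k : ℕ}

theorem hasLineDerivAt_const (c : ℝ) (z v : Jet N M) : HasLineDerivAt ℝ (fun _ => c) 0 z v :=
  hasDerivAt_const (0 : ℝ) c

theorem hasLineDerivAt_coord (σ : Fin M) (I : MIdx N) (z v : Jet N M) :
    HasLineDerivAt ℝ (fun z' : Jet N M => z'.2 σ I) (v.2 σ I) z v := by
  unfold HasLineDerivAt
  simpa using ((hasDerivAt_id (0 : ℝ)).mul_const (v.2 σ I)).const_add (z.2 σ I)

theorem isJetField_totalField (i : Fin N) : IsJetField D (totalField i : Jet N M → Jet N M) := by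
  intro k
  refine ⟨k + 1, k.le_succ, HasOrder.trunc_of_components (fun j => HasOrder.const _) ?_⟩
  intro σ I hI
  refine hasOrder_coord σ ?_
  rw [MIdx.len_add_single]
  exact Nat.succ_le_succ (mem_midx.1 hI)

theorem isJetField_vertField (σ : Fin M) (I : MIdx N) :
    IsJetField D (vertField σ I : Jet N M → Jet N M) :=
  fun k => ⟨k, le_rfl, HasOrder.const (trunc k (vertField σ I 0))⟩

theorem hasLineDerivAt_trunc_totalField (i : Fin N) (z v : Jet N M) (k : ℕ) :
    HasLineDerivAt ℝ (fun z' : Jet N M => trunc k (totalField i z'))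
      (trunc k (0, fun σ I => v.2 σ (I + Pi.single i 1))) z v :=
  hasLineDerivAt_trunc (fun _ => hasLineDerivAt_const _ _ _) fun σ I =>
    hasLineDerivAt_coord σ (I + Pi.single i 1) z v

theorem hasLineDerivAt_trunc_vertField (σ : Fin M) (I : MIdx N) (z v : Jet N M) (k : ℕ) :
    HasLineDerivAt ℝ (fun z' : Jet N M => trunc k (vertField σ I z')) (trunc k 0) z v :=
  hasLineDerivAt_trunc (fun _ => hasLineDerivAt_const _ _ _) fun _ _ => hasLineDerivAt_const _ _ _

/-- The left side is the derivative of the components of `d_j` along `∂/∂y^σ_I`, that is, the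
bracket of the two fields. It is the source of the relation `δ_d` in `jetRing`. -/
theorem vertField_add_single (σ : Fin M) (I : MIdx N) (j : Fin N) (z : Jet N M) :
    ((0, fun τ J => (vertField σ I z).2 τ (J + Pi.single j 1)) : Jet N M) =
      if I j = 0 then 0 else vertField σ (I - Pi.single j 1) z := by
  have h1 : ∀ (τ : Fin M) (J : MIdx N), (vertField σ I z).2 τ (J + Pi.single j 1) =
      if τ = σ ∧ (J + Pi.single j 1 : MIdx N) = I then 1 else 0 := by
    intro τ J
    by_cases hτ : τ = σ
    · subst hτ
      simp [vertField, Pi.single_apply]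
    · simp [vertField, hτ]
  simp only [h1]
  split_ifs with h0
  · refine Prod.ext rfl (funext fun τ => funext fun J => ?_)
    refine if_neg fun h => ?_
    rw [← h.2] at h0
    simp at h0
  · refine Prod.ext rfl (funext fun τ => funext fun J => ?_)
    have h2 : (J + Pi.single j 1 : MIdx N) = I ↔ J = I - Pi.single j 1 := by
      constructor
      · rintro rfl
        rw [MIdx.add_single_sub]
      · rintro rfl
        rw [MIdx.sub_add_single h0]
    by_cases hτ : τ = σ
    · subst hτ
      simp [vertField, Pi.single_apply, h2]
    · simp [vertField, hτ]

/-- The differential ring of the functions of finite order over `D`. -/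
def jetRing (hD : IsOpen D) : JetRing N M (JetFun D) where
  d i := JetFun.deriv hD (totalField i) (isJetField_totalField i)
  δ σ I := JetFun.deriv hD (vertField σ I) (isJetField_vertField σ I)
  d_comm i j a := by
    ext z
    by_cases hz : z.pt ∈ D
    · rw [JetFun.deriv_comm hD _ _ (fun z _ => hasLineDerivAt_trunc_totalField j z (totalField i z))
        (fun z _ => hasLineDerivAt_trunc_totalField i z (totalField j z)) a hz]
      simp only [totalField, add_right_comm _ (Pi.single i 1 : MIdx N), sub_self, lineDeriv_zero,
        add_zero]
    · rw [JetFun.deriv_apply_of_notMem _ _ _ hz, JetFun.deriv_apply_of_notMem _ _ _ hz]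
  δ_comm σ I τ J a := by
    ext z
    by_cases hz : z.pt ∈ D
    · rw [JetFun.deriv_comm hD _ _
        (fun z _ => hasLineDerivAt_trunc_vertField τ J z (vertField σ I z))
        (fun z _ => hasLineDerivAt_trunc_vertField σ I z (vertField τ J z)) a hz, sub_self,
        lineDeriv_zero, add_zero]
    · rw [JetFun.deriv_apply_of_notMem _ _ _ hz, JetFun.deriv_apply_of_notMem _ _ _ hz]
  δ_d σ I j a := by
    ext z
    by_cases hz : z.pt ∈ D
    · rw [JetFun.deriv_comm hD _ _
        (fun z _ => hasLineDerivAt_trunc_totalField j z (vertField σ I z))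
        (fun z _ => hasLineDerivAt_trunc_vertField σ I z (totalField j z)) a hz, sub_zero,
        vertField_add_single, Subalgebra.coe_add, Pi.add_apply]
      congr 1
      split_ifs with h0
      · rw [lineDeriv_zero]; rfl
      · rw [JetFun.deriv_apply _ _ _ hz]
    · rw [JetFun.deriv_apply_of_notMem _ _ _ hz, Subalgebra.coe_add, Pi.add_apply,
        JetFun.deriv_apply_of_notMem _ _ _ hz]
      split_ifs with h0
      · simp
      · rw [JetFun.deriv_apply_of_notMem _ _ _ hz, add_zero]

theorem jetRing_d_apply (hD : IsOpen D) (i : Fin N) (a : JetFun D) {z : Jet N M} (hz : z.pt ∈ D) :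
    ((jetRing hD).d i a).1 z = totalDeriv i a.1 z :=
  JetFun.deriv_apply hD (isJetField_totalField i) a hz

theorem jetRing_δ_apply (hD : IsOpen D) (σ : Fin M) (I : MIdx N) (a : JetFun D) {z : Jet N M}
    (hz : z.pt ∈ D) : ((jetRing hD).δ σ I a).1 z = lineDeriv ℝ a.1 z (vertField σ I z) :=
  JetFun.deriv_apply hD (isJetField_vertField σ I) a hz

theorem totalDeriv_congr (hD : IsOpen D) (i : Fin N) {f g : Jet N M → ℝ}
    (h : ∀ z : Jet N M, z.pt ∈ D → f z = g z) {z : Jet N M} (hz : z.pt ∈ D) :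
    totalDeriv i f z = totalDeriv i g z := lineDeriv_congr_of_isOpen hD h hz _

/-- Agreement over `D` is enough: `D` is open and constrains the 0-jet only, so it is inherited by
each total derivative. This links the formulas written with `totalDeriv` to the algebra of
`jetRing`. -/
theorem iter_totalDeriv_eq (hD : IsOpen D) (I : MIdx N) {f : Jet N M → ℝ} {a : JetFun D}
    (h : ∀ z : Jet N M, z.pt ∈ D → f z = a.1 z) :
    ∀ z : Jet N M, z.pt ∈ D → iter totalDeriv I f z = ((jetRing hD).D I a).1 z :=
  iter_rel (fun (f : Jet N M → ℝ) (a : JetFun D) => ∀ z : Jet N M, z.pt ∈ D → f z = a.1 z)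
    (fun i f a h z hz => by rw [totalDeriv_congr hD i h hz, jetRing_d_apply hD i a hz]) I h

theorem HasOrder.totalDeriv (hD : IsOpen D) {f : Jet N M → ℝ} (h : HasOrder D k f) (i : Fin N) :
    HasOrder D (k + 1) (totalDeriv i f) := by
  refine h.lineDeriv_field hD k.le_succ
    (HasOrder.trunc_of_components (fun j => HasOrder.const _) fun σ I hI => hasOrder_coord σ ?_)
  rw [MIdx.len_add_single]
  exact Nat.succ_le_succ (mem_midx.1 hI)

theorem HasOrder.lineDeriv_vertField (hD : IsOpen D) {f : Jet N M → ℝ} (h : HasOrder D k f)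
    (σ : Fin M) (I : MIdx N) : HasOrder D k (fun z => lineDeriv ℝ f z (vertField σ I z)) :=
  h.lineDeriv_field hD le_rfl (HasOrder.const (trunc k (vertField σ I 0)))

theorem HasOrder.iter_totalDeriv (hD : IsOpen D) {f : Jet N M → ℝ} (h : HasOrder D k f)
    (I : MIdx N) : HasOrder D (k + I.len) (iter VarJet.totalDeriv I f) := by
  have key : ∀ I : MIdx N, HasOrder D (k + I.len) ((jetRing hD).D I ⟨f, k, h⟩).1 := by
    intro I
    induction I using MIdx.induction with
    | zero =>
      rw [MIdx.len_zero, JetRing.D_zero]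
      exact h
    | add I j ih =>
      rw [MIdx.len_add_single, JetRing.D_add_single]
      exact (ih.totalDeriv hD j).congr fun z hz => jetRing_d_apply hD j _ hz
  exact (key I).congr (iter_totalDeriv_eq hD I fun z _ => rfl)

theorem trunc_vertField {σ : Fin M} {I : MIdx N} (hI : k < I.len) (z : Jet N M) :
    trunc k (vertField σ I z) = 0 := by
  refine Prod.ext rfl (funext fun τ => funext fun J => ?_)
  have : J.1 ≠ I := by
    rintro h
    have := mem_midx.1 J.2
    rw [h] at this
    omega
  by_cases hτ : τ = σ
  · subst hτ
    simp [trunc, vertField, this]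
  · simp [trunc, vertField, hτ]

theorem HasOrder.lineDeriv_vertField_eq_zero (hD : IsOpen D) {f : Jet N M → ℝ} (h : HasOrder D k f)
    {σ : Fin M} {I : MIdx N} (hI : k < I.len) {z : Jet N M} (hz : z.pt ∈ D) :
    lineDeriv ℝ f z (vertField σ I z) = 0 := by
  rw [h.lineDeriv_congr_trunc hD hz (w := 0) (trunc_vertField hI z), lineDeriv_zero]

theorem HasOrder.ord (hD : IsOpen D) {a : JetFun D} (h : HasOrder D k a.1) :
    (jetRing hD).Ord k a := by
  intro σ I hI
  ext z
  by_cases hz : z.pt ∈ D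
  · rw [jetRing_δ_apply hD σ I a hz]
    exact h.lineDeriv_vertField_eq_zero hD hI hz
  · exact JetFun.deriv_apply_of_notMem hD (isJetField_vertField σ I) a hz

theorem trunc_eq_sum_vertField {w : Jet N M} (hw : w.1 = 0) (z : Jet N M) :
    trunc k w = trunc k (∑ σ, ∑ I ∈ midx N k, w.2 σ I • vertField σ I z) := by
  refine Prod.ext ?_ (funext fun τ => funext fun J => ?_)
  · simp [trunc, hw, Prod.fst_sum, vertField]
  · have h1 : ∀ σ I, (w.2 σ I • vertField σ I z).2 τ J.1 =
        if σ = τ then (if I = J.1 then w.2 τ J.1 else 0) else 0 := by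
      intro σ I
      by_cases hσ : σ = τ
      · subst hσ
        by_cases hI : I = J.1
        · subst hI
          simp [vertField]
        · simp [vertField, hI, Ne.symm hI]
      · simp [vertField, hσ, Ne.symm hσ]
    simp only [trunc, Prod.snd_sum, Finset.sum_apply, h1]
    simp

theorem HasOrder.lineDeriv_vertical (hD : IsOpen D) {f : Jet N M → ℝ} (h : HasOrder D k f)
    {z : Jet N M} (hz : z.pt ∈ D) {w : Jet N M} (hw : w.1 = 0) :
    lineDeriv ℝ f z w =
      ∑ σ, ∑ I ∈ midx N k, w.2 σ I * lineDeriv ℝ f z (vertField σ I z) := by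
  obtain ⟨L, hL⟩ := h.exists_linearMap hD hz
  rw [h.lineDeriv_congr_trunc hD hz (trunc_eq_sum_vertField hw z)]
  simp only [hL, map_sum, map_smul, smul_eq_mul]

theorem HasOrder.lineDeriv_hor (hD : IsOpen D) {f : Jet N M → ℝ} (h : HasOrder D k f)
    {z : Jet N M} (hz : z.pt ∈ D) (v : Jet N M) :
    lineDeriv ℝ f z (hor z v) = ∑ i, v.1 i * VarJet.totalDeriv i f z := by
  obtain ⟨L, hL⟩ := h.exists_linearMap hD hz
  simp only [VarJet.totalDeriv, hL, hor, map_sum, map_smul, smul_eq_mul]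

/-! ### Prolongations of vertical vector fields -/

variable {ψ : Pt N M → Fin M → ℝ}

theorem hasOrder_component (hψ : ContDiffOn ℝ ∞ ψ D) (σ : Fin M) :
    HasOrder D 0 (fun z : Jet N M => ψ z.pt σ) :=
  (hasOrder_pt (k := 0) hψ).comp (φ := fun a => a σ) (by fun_prop)

/-- The component `ψ^σ`, as an element of the ring of functions of finite order. -/
def component (hψ : ContDiffOn ℝ ∞ ψ D) (σ : Fin M) : JetFun D :=
  ⟨fun z => ψ z.pt σ, 0, hasOrder_component hψ σ⟩

theorem prolong_snd (hD : IsOpen D) (hψ : ContDiffOn ℝ ∞ ψ D) {z : Jet N M} (hz : z.pt ∈ D)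
    (σ : Fin M) (I : MIdx N) :
    (prolong ψ z).2 σ I = ((jetRing hD).D I (component hψ σ)).1 z :=
  iter_totalDeriv_eq hD I (a := component hψ σ) (fun _ _ => rfl) z hz

theorem hasOrder_trunc_prolong (hD : IsOpen D) (hψ : ContDiffOn ℝ ∞ ψ D) :
    HasOrder D k (fun z => trunc k (prolong ψ z)) :=
  HasOrder.trunc_of_components (fun _ => HasOrder.const _) fun σ I hI =>
    ((hasOrder_component hψ σ).iter_totalDeriv hD I).mono (by simpa using mem_midx.1 hI)

theorem isJetField_prolong (hD : IsOpen D) (hψ : ContDiffOn ℝ ∞ ψ D) :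
    IsJetField D (prolong ψ : Jet N M → Jet N M) :=
  fun k => ⟨k, le_rfl, hasOrder_trunc_prolong hD hψ⟩

/-- The bracket vanishes: the derivative of `d_i` along `Jψ` has the components `d_{I+i} ψ^σ`, and
so has the derivative of `Jψ` along `d_i`, being `d_i d_I ψ^σ`. -/
theorem deriv_prolong_d (hD : IsOpen D) (hψ : ContDiffOn ℝ ∞ ψ D) (i : Fin N) (a : JetFun D) :
    JetFun.deriv hD _ (isJetField_prolong hD hψ) ((jetRing hD).d i a) =
      (jetRing hD).d i (JetFun.deriv hD _ (isJetField_prolong hD hψ) a) := by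
  ext z
  by_cases hz : z.pt ∈ D
  · refine (JetFun.deriv_comm hD (isJetField_prolong hD hψ) (isJetField_totalField i)
      (b := fun z => (0, fun σ I => (prolong ψ z).2 σ (I + Pi.single i 1)))
      (fun z _ => hasLineDerivAt_trunc_totalField i z (prolong ψ z)) (fun z hz k => ?_) a hz).trans ?_
    · refine hasLineDerivAt_trunc (fun _ => hasLineDerivAt_const _ _ _) fun σ I => ?_
      have h1 := ((hasOrder_component hψ σ).iter_totalDeriv hD I).hasLineDerivAt hD hz
        (totalField i z)
      have h2 : (prolong ψ z).2 σ (I + Pi.single i 1) =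
          lineDeriv ℝ (iter totalDeriv I fun z => ψ z.pt σ) z (totalField i z) := by
        rw [prolong_snd hD hψ hz, JetRing.D_add_single, jetRing_d_apply hD i _ hz]
        exact totalDeriv_congr hD i (fun z hz => (prolong_snd hD hψ hz σ I).symm) hz
      rw [← h2] at h1
      exact h1
    · rw [sub_self, lineDeriv_zero, add_zero]
      rfl
  · exact (JetFun.deriv_apply_of_notMem _ _ _ hz).trans
      (JetFun.deriv_apply_of_notMem hD (isJetField_totalField i) _ hz).symm

theorem deriv_prolong_apply (hD : IsOpen D) (hψ : ContDiffOn ℝ ∞ ψ D) {r : ℕ} {a : JetFun D}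
    (ha : (jetRing hD).Ord r a) :
    JetFun.deriv hD _ (isJetField_prolong hD hψ) a =
      ∑ σ, ∑ J ∈ midx N r, (jetRing hD).D J (component hψ σ) * (jetRing hD).δ σ J a := by
  obtain ⟨k, hk⟩ := a.2
  -- The order `k` of the representative of `a` is unrelated to `r`; the terms with `|J| > r` vanish
  -- by `Ord`, so the sum may be extended to reach `k`.
  have h1 : ∀ σ, ∑ J ∈ midx N r, (jetRing hD).D J (component hψ σ) * (jetRing hD).δ σ J a =
      ∑ J ∈ midx N (max k r), (jetRing hD).D J (component hψ σ) * (jetRing hD).δ σ J a := by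
    intro σ
    refine Finset.sum_subset (midx_mono (le_max_right k r)) fun I _ hI => ?_
    rw [mem_midx, not_le] at hI
    rw [ha σ I hI, mul_zero]
  simp only [h1]
  ext z
  simp only [AddSubmonoidClass.coe_finsetSum, Finset.sum_apply, Subalgebra.coe_mul, Pi.mul_apply]
  by_cases hz : z.pt ∈ D
  · refine (JetFun.deriv_apply _ _ _ hz).trans ?_
    rw [(hk.mono (le_max_left k r)).lineDeriv_vertical hD hz (w := prolong ψ z) rfl]
    refine Finset.sum_congr rfl fun σ _ => Finset.sum_congr rfl fun J _ => ?_
    rw [prolong_snd hD hψ hz, ← jetRing_δ_apply hD σ J a hz]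
  · refine (JetFun.deriv_apply_of_notMem _ _ _ hz).trans ?_
    refine (Finset.sum_eq_zero fun σ _ => Finset.sum_eq_zero fun J _ => ?_).symm
    exact mul_eq_zero_of_right _ (JetFun.deriv_apply_of_notMem hD (isJetField_vertField σ J) a hz)

end JetDerivations

/-! ### Alternating forms on `ℝ^(n+1)` -/

section Alternating

variable {n : ℕ}

theorem removeNth_succ_cons {q : ℕ} {α : Type*} (b : Fin (q + 1)) (u : α) (x : Fin (q + 1) → α) :
    b.succ.removeNth (Fin.cons u x : Fin (q + 2) → α) =
      (Fin.cons u (b.removeNth x) : Fin (q + 1) → α) := by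
  funext i
  refine Fin.cases ?_ (fun i => ?_) i
  · simp [Fin.removeNth]
  · simp [Fin.removeNth]

variable (n) in
/-- The volume form `dx^1 ∧ ⋯ ∧ dx^(n+1)`. -/
def vol : (Fin (n + 1) → ℝ) [⋀^Fin (n + 1)]→ₗ[ℝ] ℝ := (Pi.basisFun ℝ (Fin (n + 1))).det

/-- The contraction of the volume form with the `i`-th basis vector. -/
def dvol (i : Fin (n + 1)) : (Fin (n + 1) → ℝ) [⋀^Fin n]→ₗ[ℝ] ℝ := (vol n).curryLeft (Pi.single i 1)

theorem dvol_apply (i : Fin (n + 1)) (x : Fin n → Fin (n + 1) → ℝ) :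
    dvol i x = vol n (Fin.cons (Pi.single i 1) x) := rfl

variable (n) in
/-- The standard basis. -/
def unitVec (i : Fin (n + 1)) : Fin (n + 1) → ℝ := Pi.single i 1

theorem basisFun_eq_unitVec : ⇑(Pi.basisFun ℝ (Fin (n + 1))) = unitVec n := by
  funext i
  simp [unitVec]

theorem vol_unitVec : vol n (unitVec n) = 1 := by
  rw [← basisFun_eq_unitVec]
  exact (Pi.basisFun ℝ (Fin (n + 1))).det_self

theorem eq_smul_vol (f : (Fin (n + 1) → ℝ) [⋀^Fin (n + 1)]→ₗ[ℝ] ℝ) (x : Fin (n + 1) → Fin (n + 1) → ℝ) :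
    f x = f (unitVec n) * vol n x := by
  conv_lhs => rw [f.eq_smul_basis_det (Pi.basisFun ℝ (Fin (n + 1)))]
  rw [AlternatingMap.smul_apply, smul_eq_mul, basisFun_eq_unitVec]
  rfl

/-- The form `φ ∧ vol` has degree greater than the dimension, hence is zero. Expanding its value on
`u, x` gives `φ ∧ (u ⌋ vol) = φ(u) vol`. -/
theorem sum_vol_cons_removeNth (φ : (Fin (n + 1) → ℝ) →ₗ[ℝ] ℝ) (u : Fin (n + 1) → ℝ)
    (x : Fin (n + 1) → Fin (n + 1) → ℝ) :
    ∑ a : Fin (n + 1), (-1 : ℝ) ^ (a : ℕ) * (φ (x a) * vol n (Fin.cons u (a.removeNth x))) =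
      φ u * vol n x := by
  have h := (AlternatingMap.alternatizeUncurryFin (φ.smulRight (vol n))).map_linearDependent
    (Fin.cons u x) (by
      intro h
      have := h.fintype_card_le_finrank
      simp at this)
  rw [AlternatingMap.alternatizeUncurryFin_apply, Fin.sum_univ_succ] at h
  simp only [removeNth_succ_cons, Fin.val_succ, Fin.val_zero, pow_zero, one_smul, Fin.cons_zero,
    Fin.cons_succ, LinearMap.smulRight_apply, AlternatingMap.smul_apply, Fin.removeNth_zero,
    Fin.tail_cons, smul_eq_mul, pow_succ] at h
  rw [eq_comm, ← sub_eq_zero, ← h, sub_eq_add_neg, ← Finset.sum_neg_distrib]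
  congr 1
  refine Finset.sum_congr rfl fun a _ => ?_
  simp

/-- Every `n`-form on `ℝ^(n+1)` is a combination of the contractions of the volume form. -/
theorem eq_sum_dvol (Q : (Fin (n + 1) → ℝ) [⋀^Fin n]→ₗ[ℝ] ℝ) (x : Fin n → Fin (n + 1) → ℝ) :
    Q x = ∑ i : Fin (n + 1), ((-1 : ℝ) ^ (i : ℕ) * Q (i.removeNth (unitVec n))) * dvol i x := by
  -- The contraction `e_i ⌋ (dx^i ∧ Q)` is computed twice: as a multiple of `e_i ⌋ vol`, since `dx^i
  -- ∧ Q` has top degree, and by expanding the wedge product. Summed over `i`, the expansion is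
  -- `(dimension - degree) Q = Q`.
  have h1 : ∀ i : Fin (n + 1),
      AlternatingMap.alternatizeUncurryFin ((LinearMap.proj i : (Fin (n + 1) → ℝ) →ₗ[ℝ] ℝ).smulRight Q)
        (Fin.cons (Pi.single i 1) x) =
      ((-1 : ℝ) ^ (i : ℕ) * Q (i.removeNth (unitVec n))) * dvol i x := by
    intro i
    rw [eq_smul_vol, dvol_apply]
    congr 1
    rw [AlternatingMap.alternatizeUncurryFin_apply, Finset.sum_eq_single i]
    · simp [unitVec]
    · intro j _ hj
      simp [unitVec, Ne.symm hj]
    · simp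
  have h2 : ∀ i : Fin (n + 1),
      AlternatingMap.alternatizeUncurryFin ((LinearMap.proj i : (Fin (n + 1) → ℝ) →ₗ[ℝ] ℝ).smulRight Q)
        (Fin.cons (Pi.single i 1) x) =
      Q x + ∑ b : Fin n, (-1 : ℝ) ^ ((b : ℕ) + 1) •
        x b i • Q (b.succ.removeNth (α := fun _ => Fin (n + 1) → ℝ) (Fin.cons (Pi.single i 1) x)) := by
    intro i
    simp [AlternatingMap.alternatizeUncurryFin_apply, Fin.sum_univ_succ]
  simp only [← h1, h2, Finset.sum_add_distrib]
  clear h1 h2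
  cases n with
  | zero => simp
  | succ n =>
    simp only [removeNth_succ_cons]
    rw [Finset.sum_comm]
    have h2 : ∀ b : Fin (n + 1), ∑ i : Fin (n + 2), (-1 : ℝ) ^ ((b : ℕ) + 1) •
        x b i • Q (Fin.cons (Pi.single i 1) (b.removeNth x)) =
        -((-1 : ℝ) ^ (b : ℕ) * Q (Fin.cons (x b) (b.removeNth x))) := by
      intro b
      have h3 : Q (Fin.cons (x b) (b.removeNth x)) =
          ∑ i, x b i • Q (Fin.cons (Pi.single i 1) (b.removeNth x)) := by
        have h4 : x b = ∑ i, x b i • (Pi.single i 1 : Fin (n + 2) → ℝ) := by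
          funext j
          simp [Finset.sum_apply, Pi.single_apply]
        have h5 : ∀ u, Q (Fin.cons u (b.removeNth x)) =
            Q.toMultilinearMap.toLinearMap (Fin.cons 0 (b.removeNth x)) 0 u := fun u => by simp
        simp only [h5]
        conv_lhs => rw [h4]
        simp only [map_sum, map_smul]
      rw [h3, Finset.mul_sum, ← Finset.sum_neg_distrib]
      refine Finset.sum_congr rfl fun i _ => ?_
      simp [pow_succ]
    simp only [h2, Finset.sum_neg_distrib]
    -- Alternatizing an already alternating form multiplies it by its degree.
    have h6 := congrArg (fun f => f x) (AlternatingMap.alternatizeUncurryFin_curryLeft Q)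
    simp only [AlternatingMap.alternatizeUncurryFin_apply, AlternatingMap.smul_apply, nsmul_eq_mul,
      AlternatingMap.curryLeft_apply_apply, Matrix.vecCons] at h6
    have h7 : ∑ b : Fin (n + 1), (-1 : ℝ) ^ (b : ℕ) * Q (Fin.cons (x b) (b.removeNth x)) =
      (n + 1) * Q x := by
      rw [← Nat.cast_add_one, ← h6]
      simp
    rw [h7]
    simp
    ring

/-- Moving an argument of an alternating map to the front. -/
theorem alternating_update {q : ℕ} {V : Type*} [AddCommGroup V] [Module ℝ V]
    (f : V [⋀^Fin (q + 1)]→ₗ[ℝ] ℝ) (v : Fin (q + 1) → V) (a : Fin (q + 1)) (w : V) :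
    f (Function.update v a w) = (-1 : ℝ) ^ (a : ℕ) * f (Fin.cons w (a.removeNth v)) := by
  have h := f.map_insertNth a w (a.removeNth v)
  rw [Fin.insertNth_removeNth] at h
  rw [h]
  simp [Matrix.vecCons]

end Alternating

/-! ### Smoothness of the evaluation of multilinear and alternating maps -/

section Smooth

variable {E F : Type*} [NormedAddCommGroup E] [NormedSpace ℝ E] [NormedAddCommGroup F]
  [NormedSpace ℝ F]

/-- Currying off the first argument reduces the number of arguments by one and leaves the smooth
evaluation of a linear map. -/
theorem ContDiffOn.multilinear_apply {q : ℕ} {s : Set F}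
    {R : F → ContinuousMultilinearMap ℝ (fun _ : Fin q => E) ℝ} (hR : ContDiffOn ℝ ∞ R s)
    {v : Fin q → F → E} (hv : ∀ a, ContDiffOn ℝ ∞ (v a) s) :
    ContDiffOn ℝ ∞ (fun z => R z (fun a => v a z)) s := by
  induction q with
  | zero =>
    have h := (ContinuousMultilinearMap.apply ℝ (fun _ : Fin 0 => E) ℝ 0).contDiff (n := ∞)
    refine (h.comp_contDiffOn hR).congr fun z _ => ?_
    exact congrArg (R z) (Subsingleton.elim _ _)
  | succ q ih =>
    let e : ContinuousMultilinearMap ℝ (fun _ : Fin (q + 1) => E) ℝ ≃ₗᵢ[ℝ]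
        (E →L[ℝ] ContinuousMultilinearMap ℝ (fun _ : Fin q => E) ℝ) :=
      continuousMultilinearCurryLeftEquiv ℝ (fun _ : Fin (q + 1) => E) ℝ
    have h : ContDiff ℝ ∞ e := LinearIsometryEquiv.contDiff (𝕜 := ℝ)
      (E := ContinuousMultilinearMap ℝ (fun _ : Fin (q + 1) => E) ℝ)
      (F := E →L[ℝ] ContinuousMultilinearMap ℝ (fun _ : Fin q => E) ℝ) e
    have h1 := (h.comp_contDiffOn hR).clm_apply (hv 0)
    refine (ih h1 (fun a => hv a.succ)).congr fun z _ => ?_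
    simp only [Function.comp_apply, e, continuousMultilinearCurryLeftEquiv_apply]
    congr 1
    funext a
    refine Fin.cases ?_ (fun a => ?_) a <;> simp

theorem ContDiffOn.alternating_apply {q : ℕ} {s : Set F} {R : F → E [⋀^Fin q]→L[ℝ] ℝ}
    (hR : ContDiffOn ℝ ∞ R s) {v : Fin q → F → E} (hv : ∀ a, ContDiffOn ℝ ∞ (v a) s) :
    ContDiffOn ℝ ∞ (fun z => R z (fun a => v a z)) s := by
  let e : E [⋀^Fin q]→L[ℝ] ℝ →L[ℝ] ContinuousMultilinearMap ℝ (fun _ : Fin q => E) ℝ :=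
    ContinuousAlternatingMap.toContinuousMultilinearMapCLM ℝ
  have h : ContDiff ℝ ∞ e := ContinuousLinearMap.contDiff (𝕜 := ℝ) (E := E [⋀^Fin q]→L[ℝ] ℝ)
    (F := ContinuousMultilinearMap ℝ (fun _ : Fin q => E) ℝ) e
  exact ContDiffOn.multilinear_apply (h.comp_contDiffOn hR) hv

end Smooth

section Forms

variable {N M : ℕ}

/-! ### Horizontal and vertical parts -/

theorem fst_sum_smul_totalField (z : Jet N M) (x : Fin N → ℝ) :
    (∑ i, x i • totalField i z : Jet N M).1 = x := by
  rw [Prod.fst_sum]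
  funext j
  simp [totalField, Pi.single_apply]

theorem snd_sum_smul_totalField (z : Jet N M) (x : Fin N → ℝ) (σ : Fin M) (I : MIdx N) :
    (∑ i, x i • totalField i z : Jet N M).2 σ I = ∑ i, x i * z.2 σ (I + Pi.single i 1) := by
  rw [Prod.snd_sum]
  simp [totalField]

/-- The horizontal lift of a vector on the base. -/
def horL (z : Jet N M) : (Fin N → ℝ) →ₗ[ℝ] Jet N M where
  toFun x := ∑ i, x i • totalField i z
  map_add' x y := by simp [add_smul, Finset.sum_add_distrib]
  map_smul' c x := by simp [Finset.smul_sum, smul_smul]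

theorem hor_eq_horL (z v : Jet N M) : hor z v = horL z v.1 := rfl

theorem horL_single (z : Jet N M) (i : Fin N) : horL z (Pi.single i 1) = totalField i z := by
  simp only [horL, LinearMap.coe_mk, AddHom.coe_mk]
  rw [Finset.sum_eq_single i]
  · simp
  · intro j _ hj
    simp [hj]
  · simp

theorem hor_fst (z v : Jet N M) : (hor z v).1 = v.1 := fst_sum_smul_totalField z v.1

theorem ver_fst (z v : Jet N M) : (ver z v).1 = 0 := by
  rw [ver, Prod.fst_sub, hor_fst, sub_self]

theorem hor_of_vertical (z : Jet N M) {v : Jet N M} (hv : v.1 = 0) : hor z v = 0 := by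
  rw [hor_eq_horL, hv, map_zero]

theorem ver_of_vertical (z : Jet N M) {v : Jet N M} (hv : v.1 = 0) : ver z v = v := by
  rw [ver, hor_of_vertical z hv, sub_zero]

theorem ver_hor (z v : Jet N M) : ver z (hor z v) = 0 := by
  rw [ver, hor_eq_horL z (hor z v), hor_fst, ← hor_eq_horL, sub_self]

theorem ver_snd (z v : Jet N M) (σ : Fin M) (I : MIdx N) :
    (ver z v).2 σ I = v.2 σ I - ∑ i, v.1 i * z.2 σ (I + Pi.single i 1) := by
  rw [ver, Prod.snd_sub, Pi.sub_apply, Pi.sub_apply]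
  congr 1
  exact snd_sum_smul_totalField z v.1 σ I

/-- `ver z` as a linear map. -/
def verL (z : Jet N M) : Jet N M →ₗ[ℝ] Jet N M :=
  LinearMap.id - (horL z).comp (LinearMap.fst ℝ _ _)

theorem verL_apply (z v : Jet N M) : verL z v = ver z v := rfl

/-! ### Contact components -/

theorem p_zero_apply {q : ℕ} (η : Form N M q) (z : Jet N M) (v : Fin q → Jet N M) :
    p 0 η z v = η z (fun a => hor z (v a)) := by
  simp [p]

theorem p_one_apply {q : ℕ} (η : Form N M q) (z : Jet N M) (v : Fin q → Jet N M) :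
    p 1 η z v = ∑ c : Fin q, η z (fun a => if a = c then ver z (v a) else hor z (v a)) := by
  simp [p, Finset.powersetCard_one]

/-- Alternation moves the single vertical argument to the front, giving every 1-contact component
the shape of a wedge product. -/
theorem p_one_of_alternating {q : ℕ} {η : Form N M (q + 1)} {z : Jet N M}
    (f : Jet N M [⋀^Fin (q + 1)]→ₗ[ℝ] ℝ) (hf : ∀ v, η z v = f v) (v : Fin (q + 1) → Jet N M) :
    p 1 η z v = ∑ a : Fin (q + 1),
      (-1 : ℝ) ^ (a : ℕ) * f (Fin.cons (ver z (v a)) fun b => hor z (a.removeNth v b)) := by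
  rw [p_one_apply]
  refine Finset.sum_congr rfl fun c _ => ?_
  rw [hf]
  refine Eq.trans ?_ (alternating_update f (fun a => hor z (v a)) c (ver z (v c)))
  congr 1
  funext a
  by_cases h : a = c
  · subst h
    simp
  · simp [h]

theorem p_congr {q l : ℕ} {η θ : Form N M q} {z : Jet N M} (h : η z = θ z) :
    p l η z = p l θ z := by
  funext v
  simp [p, h]

theorem p_zero_form {q : ℕ} (l : ℕ) : p l (0 : Form N M q) = 0 := by
  funext z v
  simp [p]

/-! ### Products of a linear form on the jets and a form on the base -/

/-- The wedge product of a `1`-form on the jets and of a constant form on the base. -/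
def wsum {q : ℕ} (ℓ : Jet N M → ℝ) (Q : (Fin N → ℝ) [⋀^Fin q]→ₗ[ℝ] ℝ) (v : Fin (q + 1) → Jet N M) : ℝ :=
  ∑ a : Fin (q + 1), (-1 : ℝ) ^ (a : ℕ) * (ℓ (v a) * Q (fun b => (a.removeNth v b).1))

variable {q : ℕ} (Q : (Fin N → ℝ) [⋀^Fin q]→ₗ[ℝ] ℝ)

theorem wsum_congr {ℓ ℓ' : Jet N M → ℝ} {v : Fin (q + 1) → Jet N M} (h : ∀ a, ℓ (v a) = ℓ' (v a)) :
    wsum ℓ Q v = wsum ℓ' Q v := by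
  simp only [wsum, h]

theorem wsum_cons (ℓ : Jet N M → ℝ) (w : Jet N M) (v : Fin q → Jet N M) :
    wsum ℓ Q (Fin.cons w v) = ℓ w * Q (fun b => (v b).1) -
      ∑ b : Fin q, (-1 : ℝ) ^ (b : ℕ) *
        (ℓ (v b) * Q (fun b' => (b.succ.removeNth (α := fun _ => Jet N M) (Fin.cons w v) b').1)) := by
  rw [wsum, Fin.sum_univ_succ, sub_eq_add_neg, ← Finset.sum_neg_distrib]
  simp only [Fin.val_zero, pow_zero, one_mul, Fin.cons_zero, Fin.removeNth_zero, Fin.tail_cons,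
    Fin.val_succ, pow_succ, Fin.cons_succ]
  congr 1
  exact Finset.sum_congr rfl fun b _ => by ring

theorem wsum_cons_vertical (ℓ : Jet N M → ℝ) {w : Jet N M} (hw : w.1 = 0) (v : Fin q → Jet N M) :
    wsum ℓ Q (Fin.cons w v) = ℓ w * Q (fun b => (v b).1) := by
  rw [wsum_cons, sub_eq_self]
  refine Finset.sum_eq_zero fun b _ => ?_
  cases q with
  | zero => exact b.elim0
  | succ q =>
    rw [Q.map_coord_zero 0, mul_zero, mul_zero]
    rw [removeNth_succ_cons, Fin.cons_zero, hw]

/-- `Q` sees only components on the base, and these vanish for a vertical vector. So the only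
surviving term feeds the vertical argument to `ℓ`. -/
theorem p_one_of_wsum {η : Form N M (q + 1)} {z : Jet N M} {ℓ : Jet N M → ℝ}
    (h : ∀ v, η z v = wsum ℓ Q v) (v : Fin (q + 1) → Jet N M) :
    p 1 η z v = wsum (fun u => ℓ (ver z u)) Q v := by
  rw [p_one_apply]
  refine Finset.sum_congr rfl fun c _ => ?_
  rw [h, wsum, Finset.sum_eq_single c]
  · have h1 : ∀ b, (c.removeNth (fun a => if a = c then ver z (v a) else hor z (v a)) b).1 =
        (c.removeNth v b).1 := by
      intro b
      simp [Fin.removeNth, Fin.succAbove_ne, hor_fst]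
    rw [if_pos rfl]
    simp only [h1]
  · intro a _ ha
    obtain ⟨b, hb⟩ := Fin.exists_succAbove_eq (Ne.symm ha)
    rw [Q.map_coord_zero b, mul_zero, mul_zero]
    simp only [Fin.removeNth, hb]
    simp only [if_true, ver_fst]
  · simp

theorem wsum_hor (ℓ : Jet N M → ℝ) (z : Jet N M) (v : Fin (q + 1) → Jet N M) :
    wsum ℓ Q (fun a => hor z (v a)) = wsum (fun u => ℓ (hor z u)) Q v := by
  have h : ∀ (a : Fin (q + 1)) b, (a.removeNth (fun a => hor z (v a)) b).1 = (a.removeNth v b).1 :=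
    fun a b => hor_fst _ _
  simp only [wsum, h]

theorem wsum_sum {ι : Type*} (s : Finset ι) (ℓ : ι → Jet N M → ℝ) (v : Fin (q + 1) → Jet N M) :
    wsum (fun u => ∑ i ∈ s, ℓ i u) Q v = ∑ i ∈ s, wsum (ℓ i) Q v := by
  simp only [wsum, Finset.sum_mul, Finset.mul_sum]
  exact Finset.sum_comm

theorem wsum_add (ℓ ℓ' : Jet N M → ℝ) (v : Fin (q + 1) → Jet N M) :
    wsum (fun u => ℓ u + ℓ' u) Q v = wsum ℓ Q v + wsum ℓ' Q v := by
  simp only [wsum, ← Finset.sum_add_distrib]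
  exact Finset.sum_congr rfl fun a _ => by ring

theorem wsum_const_mul (c : ℝ) (ℓ : Jet N M → ℝ) (v : Fin (q + 1) → Jet N M) :
    wsum (fun u => c * ℓ u) Q v = c * wsum ℓ Q v := by
  simp only [wsum, Finset.mul_sum]
  exact Finset.sum_congr rfl fun a _ => by ring

theorem wsum_vol {n : ℕ} (ℓ : (Fin (n + 1) → ℝ) →ₗ[ℝ] ℝ) (i : Fin (n + 1))
    (v : Fin (n + 1) → Jet (n + 1) M) :
    wsum (fun u => ℓ u.1) (dvol i) v = ℓ (Pi.single i 1) * vol n (fun a => (v a).1) :=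
  sum_vol_cons_removeNth ℓ (Pi.single i 1) fun a => (v a).1

/-- The wedge product of a linear form on the jets and of a form on the base. -/
def wedgeL (ℓ : Jet N M →ₗ[ℝ] ℝ) : Jet N M [⋀^Fin (q + 1)]→ₗ[ℝ] ℝ :=
  AlternatingMap.alternatizeUncurryFin
    (ℓ.smulRight (Q.compLinearMap (LinearMap.fst ℝ (Fin N → ℝ) (Fin M → MIdx N → ℝ))))

theorem wedgeL_apply (ℓ : Jet N M →ₗ[ℝ] ℝ) (v : Fin (q + 1) → Jet N M) :
    wedgeL Q ℓ v = wsum ℓ Q v := by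
  rw [wedgeL, AlternatingMap.alternatizeUncurryFin_apply]
  refine Finset.sum_congr rfl fun a _ => ?_
  simp only [LinearMap.smulRight_apply, AlternatingMap.smul_apply, smul_eq_mul]
  rw [← Int.cast_smul_eq_zsmul ℝ]
  simp only [Int.cast_pow, Int.cast_neg, Int.cast_one, smul_eq_mul]
  rfl

/-! ### Exterior derivatives -/

theorem extD_mul_const {η : Form N M q} {f : Jet N M → ℝ}
    (h : ∀ z v, η z v = f z * Q (fun a => (v a).1)) (z : Jet N M) (v : Fin (q + 1) → Jet N M) :
    extD η z v = wsum (lineDeriv ℝ f z) Q v := by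
  refine Finset.sum_congr rfl fun a _ => ?_
  simp only [h]
  congr 1
  exact deriv_mul_const_field _

variable {D : Set (Pt N M)}

/-- A form which is alternating and of finite order over `D`. -/
structure IsAlternatingForm (D : Set (Pt N M)) (η : Form N M q) : Prop where
  alternating : ∀ z, ∃ f : Jet N M [⋀^Fin q]→ₗ[ℝ] ℝ, ∀ v, η z v = f v
  hasOrder : ∀ v, ∃ k, HasOrder D k (fun z => η z v)

/-- Alternation is not part of the type `Form`, so it has to be shown to pass to `extD`: at `z`,
this is the alternatization of the linear map sending a direction to the derivative of the form. It
makes `p_one_of_alternating` available for `extD`. -/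
theorem IsAlternatingForm.extD (hD : IsOpen D) {η : Form N M q} (h : IsAlternatingForm D η)
    {z : Jet N M} (hz : z.pt ∈ D) :
    ∃ f : Jet N M [⋀^Fin (q + 1)]→ₗ[ℝ] ℝ, ∀ v, extD η z v = f v := by
  choose f hf using h.alternating
  choose k hk using h.hasOrder
  choose L hL using fun v => (hk v).exists_linearMap hD hz
  let g : Jet N M →ₗ[ℝ] Jet N M [⋀^Fin q]→ₗ[ℝ] ℝ :=
    { toFun := fun u =>
        { toFun := fun v => lineDeriv ℝ (fun z' => η z' v) z u
          map_update_add' := by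
            intro _ v a x y
            simp only [hf, AlternatingMap.map_update_add]
            have h1 := (hk (Function.update v a x)).hasLineDerivAt hD hz u
            have h2 := (hk (Function.update v a y)).hasLineDerivAt hD hz u
            simp only [hf] at h1 h2
            exact (HasDerivAt.add h1 h2).deriv
          map_update_smul' := by
            intro _ v a c x
            simp only [hf, AlternatingMap.map_update_smul, smul_eq_mul]
            have h1 := (hk (Function.update v a x)).hasLineDerivAt hD hz u
            simp only [hf] at h1
            exact (HasDerivAt.const_mul c h1).deriv
          map_eq_zero_of_eq' := by
            intro v i j hij hne
            simp only [hf, (f _).map_eq_zero_of_eq v hij hne]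
            exact deriv_const _ _ }
      map_add' := by
        intro u u'
        ext v
        simp [hL]
      map_smul' := by
        intro c u
        ext v
        simp [hL] }
  refine ⟨AlternatingMap.alternatizeUncurryFin g, fun v => ?_⟩
  rw [AlternatingMap.alternatizeUncurryFin_apply]
  refine Finset.sum_congr rfl fun a _ => ?_
  rw [← Int.cast_smul_eq_zsmul ℝ]
  simp only [Int.cast_pow, Int.cast_neg, Int.cast_one, smul_eq_mul]
  rfl

theorem extD_sum (hD : IsOpen D) {ι : Type*} (s : Finset ι) {η : ι → Form N M q}
    (h : ∀ i ∈ s, ∀ v, ∃ k, HasOrder D k (fun z => η i z v)) {z : Jet N M} (hz : z.pt ∈ D) :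
    extD (∑ i ∈ s, η i) z = ∑ i ∈ s, extD (η i) z := by
  funext v
  rw [Finset.sum_apply]
  simp only [extD]
  rw [Finset.sum_comm]
  refine Finset.sum_congr rfl fun a _ => ?_
  rw [← Finset.mul_sum]
  congr 1
  refine HasLineDerivAt.lineDeriv ?_
  have h1 : ∀ i ∈ s, HasLineDerivAt ℝ (fun z' => η i z' (a.removeNth v))
      (lineDeriv ℝ (fun z' => η i z' (a.removeNth v)) z (v a)) z (v a) := by
    intro i hi
    obtain ⟨k, hk⟩ := h i hi (a.removeNth v)
    exact hk.hasLineDerivAt hD hz _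
  unfold HasLineDerivAt at h1 ⊢
  convert HasDerivAt.fun_sum h1 using 1
  funext t
  simp [Finset.sum_apply]

theorem p_sum {ι : Type*} (l : ℕ) (s : Finset ι) (η : ι → Form N M q) (z : Jet N M) :
    p l (∑ i ∈ s, η i) z = ∑ i ∈ s, p l (η i) z := by
  funext v
  simp only [p, Finset.sum_apply]
  exact Finset.sum_comm

end Forms

section Lagrangians

variable {n M : ℕ} {D : Set (Pt (n + 1) M)} {k : ℕ}

/-! ### Lagrangians and their Euler–Lagrange forms -/

/-- The Lagrangian `f dx^1 ∧ ⋯ ∧ dx^(n+1)`. -/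
def volForm (f : Jet (n + 1) M → ℝ) : Form (n + 1) M (n + 1) :=
  fun z v => f z * vol n (fun a => (v a).1)

theorem extD_volForm (f : Jet (n + 1) M → ℝ) (z : Jet (n + 1) M) (v : Fin (n + 2) → Jet (n + 1) M) :
    extD (volForm f) z v = wsum (lineDeriv ℝ f z) (vol n) v :=
  extD_mul_const (vol n) (fun _ _ => rfl) z v

theorem p_one_extD_volForm (f : Jet (n + 1) M → ℝ) (z : Jet (n + 1) M)
    (v : Fin (n + 2) → Jet (n + 1) M) :
    p 1 (extD (volForm f)) z v = wsum (fun u => lineDeriv ℝ f z (ver z u)) (vol n) v :=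
  p_one_of_wsum (vol n) (extD_volForm f z) v

theorem contr_vertField_p_one_extD_volForm (f : Jet (n + 1) M → ℝ) (σ : Fin M)
    (I : MIdx (n + 1)) :
    contr (vertField σ I) (p 1 (extD (volForm f))) =
      volForm (fun z => lineDeriv ℝ f z (vertField σ I z)) := by
  funext z v
  rw [contr, p_one_extD_volForm, wsum_cons_vertical _ _ (by rfl), ver_of_vertical z (by rfl)]
  rfl

/-- In Cartan's formula `d_i ⌋ d(f vol)` equals `(d_i f) vol - df ∧ (∂_i ⌋ vol)`, and `d(d_i ⌋ f
vol)` equals `df ∧ (∂_i ⌋ vol)`, because `d_i` has constant base component. -/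
theorem formalDeriv_volForm (i : Fin (n + 1)) (f : Jet (n + 1) M → ℝ) :
    formalDeriv i (volForm f) = volForm (totalDeriv i f) := by
  funext z v
  have h1 : ∀ z v, contr (totalField i) (volForm f) z v = f z * dvol i (fun a => (v a).1) := by
    intro z v
    rw [contr, volForm, dvol_apply]
    congr 2
    funext a
    refine Fin.cases ?_ (fun a => ?_) a <;> rfl
  change contr (totalField i) (extD (volForm f)) z v +
    extD (contr (totalField i) (volForm f)) z v = _
  rw [extD_mul_const (dvol i) h1, contr, extD_volForm, wsum_cons, wsum, volForm, totalDeriv,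
    sub_add_eq_add_sub, add_sub_assoc, add_eq_left, sub_eq_zero]
  refine Finset.sum_congr rfl fun b _ => ?_
  congr 2
  rw [dvol_apply]
  congr 1
  funext a
  rw [removeNth_succ_cons]
  refine Fin.cases ?_ (fun a => ?_) a <;> rfl

theorem iter_formalDeriv_volForm (I : MIdx (n + 1)) (f : Jet (n + 1) M → ℝ) :
    iter (fun i => formalDeriv i) I (volForm f) = volForm (iter totalDeriv I f) :=
  iter_rel (fun (η : Form (n + 1) M (n + 1)) f => η = volForm f)
    (fun i η f h => by rw [h, formalDeriv_volForm]) I rfl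

/-- The Euler–Lagrange expression of a function, with the sum over `|I| ≤ r`. -/
def eulerExpr (r : ℕ) (σ : Fin M) (f : Jet (n + 1) M → ℝ) (z : Jet (n + 1) M) : ℝ :=
  ∑ I ∈ midx (n + 1) r,
    (-1 : ℝ) ^ I.len * iter totalDeriv I (fun z => lineDeriv ℝ f z (vertField σ I z)) z

theorem interiorEuler_extD_volForm (r : ℕ) (f : Jet (n + 1) M → ℝ) (z : Jet (n + 1) M)
    (v : Fin (n + 2) → Jet (n + 1) M) :
    interiorEuler r (extD (volForm f)) z v =
      wsum (fun u => ∑ σ, (ver z u).2 σ 0 * eulerExpr r σ f z) (vol n) v := by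
  have h : ∀ σ, (∑ I ∈ midx (n + 1) r, (-1 : ℝ) ^ I.len •
      iter (fun i => formalDeriv i) I (contr (vertField σ I) (p 1 (extD (volForm f))))) =
      volForm (eulerExpr r σ f) := by
    intro σ
    funext z v
    simp only [contr_vertField_p_one_extD_volForm, iter_formalDeriv_volForm, Finset.sum_apply,
      Pi.smul_apply, smul_eq_mul, volForm, eulerExpr, Finset.sum_mul, mul_assoc]
  rw [interiorEuler, Finset.sum_apply, Finset.sum_apply, wsum_sum]
  refine Finset.sum_congr rfl fun σ _ => ?_
  rw [h σ]
  refine Finset.sum_congr rfl fun a _ => ?_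
  simp only [volForm, contactForm]
  ring

theorem contr_interiorEuler (r : ℕ) (f : Jet (n + 1) M → ℝ) (ξ : Jet (n + 1) M → Jet (n + 1) M)
    (hξ : ∀ z, (ξ z).1 = 0) :
    contr ξ (interiorEuler r (extD (volForm f))) =
      volForm (fun z => ∑ σ, (ξ z).2 σ 0 * eulerExpr r σ f z) := by
  funext z v
  rw [contr, interiorEuler_extD_volForm, wsum_cons_vertical _ _ (hξ z), ver_of_vertical z (hξ z)]
  rfl

/-- The coefficient of the Lagrangian `p_0 η`. -/
def horCoeff {s : ℕ} (R : FinJet (n + 1) M s → FinJet (n + 1) M s [⋀^Fin (n + 1)]→L[ℝ] ℝ)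
    (z : Jet (n + 1) M) : ℝ := lift R z (fun i => totalField i z)

/-- The value at `z` of the pull-back of a form on a jet space of finite order. -/
def liftAlt {q s : ℕ} (R : FinJet (n + 1) M s → FinJet (n + 1) M s [⋀^Fin q]→L[ℝ] ℝ)
    (z : Jet (n + 1) M) : Jet (n + 1) M [⋀^Fin q]→ₗ[ℝ] ℝ :=
  (R (trunc s z)).toAlternatingMap.compLinearMap (truncL s)

theorem liftAlt_apply {q s : ℕ} (R : FinJet (n + 1) M s → FinJet (n + 1) M s [⋀^Fin q]→L[ℝ] ℝ)
    (z : Jet (n + 1) M) (v : Fin q → Jet (n + 1) M) : liftAlt R z v = lift R z v := rfl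

theorem p_zero_lift {s : ℕ} (R : FinJet (n + 1) M s → FinJet (n + 1) M s [⋀^Fin (n + 1)]→L[ℝ] ℝ) :
    p 0 (lift R) = volForm (horCoeff R) := by
  funext z v
  rw [p_zero_apply, ← liftAlt_apply]
  have h := eq_smul_vol ((liftAlt R z).compLinearMap (horL z)) (fun a => (v a).1)
  simp only [AlternatingMap.compLinearMap_apply, unitVec, horL_single] at h
  exact h

/-- Evaluation of a form of finite order on vector fields of finite order. -/
theorem hasOrder_lift_apply {q s l : ℕ} (hsl : s ≤ l)
    {R : FinJet (n + 1) M s → FinJet (n + 1) M s [⋀^Fin q]→L[ℝ] ℝ}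
    (hR : ContDiffOn ℝ ∞ R {z | FinJet.pt z ∈ D}) {v : Fin q → Jet (n + 1) M → Jet (n + 1) M}
    (hv : ∀ a, HasOrder D l (fun z => trunc s (v a z))) :
    HasOrder D l (fun z => lift R z (fun a => v a z)) := by
  choose g hg hvg using hv
  refine ⟨fun ζ => R (restrict hsl ζ) (fun a => g a ζ), ?_, fun z hz => ?_⟩
  · exact ContDiffOn.alternating_apply
      (hR.comp (restrict hsl).contDiff.contDiffOn fun z hz => hz) hg
  · have h : ∀ a, trunc s (v a z) = g a (trunc l z) := fun a => hvg a z hz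
    simp only [lift, h, restrict_trunc]

theorem hasOrder_trunc_totalField (i : Fin (n + 1)) (s : ℕ) :
    HasOrder D (s + 1) (fun z : Jet (n + 1) M => trunc s (totalField i z)) := by
  refine HasOrder.trunc_of_components (fun j => HasOrder.const _) fun σ I hI => hasOrder_coord σ ?_
  rw [MIdx.len_add_single]
  exact Nat.succ_le_succ (mem_midx.1 hI)

theorem hasOrder_horCoeff {s : ℕ}
    {R : FinJet (n + 1) M s → FinJet (n + 1) M s [⋀^Fin (n + 1)]→L[ℝ] ℝ}
    (hR : ContDiffOn ℝ ∞ R {z | FinJet.pt z ∈ D}) : HasOrder D (s + 1) (horCoeff R) :=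
  hasOrder_lift_apply s.le_succ hR fun i => hasOrder_trunc_totalField i s

theorem eulerExpr_eq (hD : IsOpen D) (r : ℕ) (σ : Fin M) (a : JetFun D) {f : Jet (n + 1) M → ℝ}
    (hf : ∀ z : Jet (n + 1) M, z.pt ∈ D → f z = a.1 z) {z : Jet (n + 1) M} (hz : z.pt ∈ D) :
    eulerExpr r σ f z = ((jetRing hD).E r σ a).1 z := by
  simp only [eulerExpr, JetRing.E, AddSubmonoidClass.coe_finsetSum, Finset.sum_apply,
    Subalgebra.coe_smul, Pi.smul_apply, smul_eq_mul]
  refine Finset.sum_congr rfl fun I _ => ?_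
  congr 1
  refine iter_totalDeriv_eq hD I (fun z hz => ?_) z hz
  rw [jetRing_δ_apply hD σ I a hz, lineDeriv_congr_of_isOpen hD hf hz]

theorem hasOrder_eulerExpr (hD : IsOpen D) {f : Jet (n + 1) M → ℝ} (hf : HasOrder D k f) (r : ℕ)
    (σ : Fin M) : HasOrder D (k + r) (eulerExpr r σ f) := by
  have h : HasOrder D (k + r) (∑ I ∈ midx (n + 1) r, fun z =>
      (-1 : ℝ) ^ I.len * iter totalDeriv I (fun z => lineDeriv ℝ f z (vertField σ I z)) z) := by
    refine HasOrder.sum fun I hI => ?_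
    have h1 := ((hf.lineDeriv_vertField hD σ I).iter_totalDeriv hD I).mono
      (Nat.add_le_add_left (mem_midx.1 hI) k)
    exact h1.comp (φ := fun a => (-1 : ℝ) ^ I.len * a) (by fun_prop)
  refine h.congr fun z _ => ?_
  rw [Finset.sum_apply]
  rfl

/-! ### Contact forms of degree one -/

/-- The form `b ω^σ_I ∧ (∂_i ⌋ dx^1 ∧ ⋯ ∧ dx^(n+1))`. -/
def contactTerm (b : Jet (n + 1) M → ℝ) (σ : Fin M) (I : MIdx (n + 1)) (i : Fin (n + 1)) :
    Form (n + 1) M (n + 1) :=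
  fun z v => b z * wsum (fun u => (ver z u).2 σ I) (dvol i) v

/-- The linear form `ω^σ_I` at `z`. -/
def contactL (σ : Fin M) (I : MIdx (n + 1)) (z : Jet (n + 1) M) : Jet (n + 1) M →ₗ[ℝ] ℝ where
  toFun u := (ver z u).2 σ I
  map_add' u v := by simp [← verL_apply]
  map_smul' c u := by simp [← verL_apply]

theorem hasOrder_ver_snd (σ : Fin M) (I : MIdx (n + 1)) (u : Jet (n + 1) M) :
    HasOrder D (I.len + 1) (fun z => (ver z u).2 σ I) := by
  have h : HasOrder D (I.len + 1) (fun z : Jet (n + 1) M => fun i : Fin (n + 1) =>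
      z.2 σ (I + Pi.single i 1)) :=
    HasOrder.pi fun i => hasOrder_coord σ (by rw [MIdx.len_add_single])
  exact (h.comp (φ := fun a => u.2 σ I - ∑ i, u.1 i * a i) (by fun_prop)).congr
    fun z _ => ver_snd z u σ I

theorem hasOrder_contactTerm {b : Jet (n + 1) M → ℝ} (hb : HasOrder D k b) (σ : Fin M)
    (I : MIdx (n + 1)) (i : Fin (n + 1)) (v : Fin (n + 1) → Jet (n + 1) M) :
    ∃ l, HasOrder D l (fun z => contactTerm b σ I i z v) := by
  refine ⟨max k (I.len + 1), ?_⟩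
  have h : HasOrder D (max k (I.len + 1)) (fun z : Jet (n + 1) M => fun a => (ver z (v a)).2 σ I) :=
    HasOrder.pi fun a => (hasOrder_ver_snd σ I (v a)).mono (le_max_right _ _)
  refine ((hb.mono (le_max_left k (I.len + 1))).prodMk h).comp (φ := fun a => a.1 *
    ∑ j : Fin (n + 1), (-1 : ℝ) ^ (j : ℕ) * (a.2 j * dvol i (fun b => (j.removeNth v b).1))) ?_
  fun_prop

theorem isAlternatingForm_contactTerm {b : Jet (n + 1) M → ℝ} (hb : HasOrder D k b) (σ : Fin M)
    (I : MIdx (n + 1)) (i : Fin (n + 1)) : IsAlternatingForm D (contactTerm b σ I i) where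
  alternating z := ⟨b z • wedgeL (dvol i) (contactL σ I z), fun v => by
    rw [AlternatingMap.smul_apply, wedgeL_apply]
    rfl⟩
  hasOrder := hasOrder_contactTerm hb σ I i

theorem p_one_contactTerm (b : Jet (n + 1) M → ℝ) (σ : Fin M) (I : MIdx (n + 1))
    (i : Fin (n + 1)) : p 1 (contactTerm b σ I i) = contactTerm b σ I i := by
  funext z v
  rw [p_one_of_wsum (dvol i) (ℓ := fun u => b z * (ver z u).2 σ I)
    (fun v => (wsum_const_mul (dvol i) _ _ v).symm), contactTerm, ← wsum_const_mul (dvol i)]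
  refine wsum_congr _ fun a => ?_
  rw [ver_of_vertical z (ver_fst z _)]

theorem p_zero_contactTerm (b : Jet (n + 1) M → ℝ) (σ : Fin M) (I : MIdx (n + 1))
    (i : Fin (n + 1)) : p 0 (contactTerm b σ I i) = 0 := by
  funext z v
  rw [p_zero_apply, contactTerm, wsum_hor]
  simp [ver_hor, wsum]

/-- The structure equation `dω^σ_I = -∑ dy^σ_{I+l} ∧ dx^l` in coordinates, together with `dx^l ∧
(∂_i ⌋ vol) = δ^l_i vol`. The derivative of `b` contributes only through `d_i b`, since all
arguments but `w` are horizontal. -/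
theorem extD_contactTerm_cons (hD : IsOpen D) {b : Jet (n + 1) M → ℝ} (hb : HasOrder D k b)
    (σ : Fin M) (I : MIdx (n + 1)) (i : Fin (n + 1)) {z : Jet (n + 1) M} (hz : z.pt ∈ D)
    {w : Jet (n + 1) M} (hw : w.1 = 0) (v : Fin (n + 1) → Jet (n + 1) M) :
    extD (contactTerm b σ I i) z (Fin.cons w fun a => hor z (v a)) =
      -((totalDeriv i b z * w.2 σ I + b z * w.2 σ (I + Pi.single i 1)) *
        vol n (fun a => (v a).1)) := by
  -- The arguments `hor z (v a)` stay frozen while the point moves. They are annihilated by the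
  -- contact forms at `z`, but the coefficients `y^σ_{I+l}` of these forms vary with the point, and
  -- their derivative remains.
  have h0 : lineDeriv ℝ (fun z' => contactTerm b σ I i z' fun a => hor z (v a)) z w =
      -(b z * w.2 σ (I + Pi.single i 1) * vol n (fun a => (v a).1)) := by
    refine HasLineDerivAt.lineDeriv ?_
    have h1 : ∀ a, HasLineDerivAt ℝ (fun z' => (ver z' (hor z (v a))).2 σ I)
        (-∑ l, (v a).1 l * w.2 σ (I + Pi.single l 1)) z w := by
      intro a
      simp only [ver_snd, hor_fst]
      have h2 := fun l => hasLineDerivAt_coord σ (I + Pi.single l 1) z w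
      unfold HasLineDerivAt at h2 ⊢
      exact (HasDerivAt.fun_sum fun l _ => (h2 l).const_mul ((v a).1 l)).const_sub _
    have h3 := hb.hasLineDerivAt hD hz w
    unfold HasLineDerivAt at h1 h3 ⊢
    have h4 := h3.mul (HasDerivAt.fun_sum (u := Finset.univ) fun (a : Fin (n + 1)) _ =>
      ((h1 a).mul_const (dvol i (fun b => (a.removeNth v b).1))).const_mul ((-1 : ℝ) ^ (a : ℕ)))
    refine (h4.congr_deriv ?_).congr_of_eventuallyEq (Filter.Eventually.of_forall fun t => ?_)
    · simp only [zero_smul, add_zero, ver_hor]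
      have h5 := wsum_vol (M := M) (∑ l, w.2 σ (I + Pi.single l 1) •
        (LinearMap.proj l : (Fin (n + 1) → ℝ) →ₗ[ℝ] ℝ)) i v
      simp only [wsum, LinearMap.sum_apply, LinearMap.smul_apply, LinearMap.proj_apply,
        smul_eq_mul] at h5
      rw [Finset.sum_eq_single i (f := fun l => _ * (Pi.single i (1 : ℝ) : Fin (n + 1) → ℝ) l)] at h5
      · rw [Pi.single_eq_same, mul_one] at h5
        rw [mul_assoc, ← h5]
        simp [mul_comm]
      · intro j _ hj
        simp [hj]
      · simp
    · simp only [contactTerm, wsum, Pi.mul_apply]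
      congr 1
      refine Finset.sum_congr rfl fun a _ => ?_
      congr 3
      funext c
      exact hor_fst _ _
  -- Here `w` is among the arguments; being vertical it must go to the contact form, whose value on
  -- it does not depend on the point. Only `b` is differentiated.
  have h1 : ∀ c : Fin (n + 1), lineDeriv ℝ (fun z' => contactTerm b σ I i z'
      (c.succ.removeNth (α := fun _ => Jet (n + 1) M) (Fin.cons w fun a => hor z (v a)))) z (hor z (v c)) =
      (∑ l, (v c).1 l * totalDeriv l b z) * (w.2 σ I * dvol i (fun a => (c.removeNth v a).1)) := by
    intro c
    rw [removeNth_succ_cons]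
    have h2 : ∀ z', contactTerm b σ I i z' (Fin.cons w (c.removeNth fun a => hor z (v a))) =
        b z' * (w.2 σ I * dvol i (fun a => (c.removeNth v a).1)) := by
      intro z'
      rw [contactTerm, wsum_cons_vertical _ _ hw, ver_of_vertical z' hw]
      congr 3
      funext a
      exact hor_fst _ _
    simp only [h2]
    rw [← hb.lineDeriv_hor hD hz]
    exact deriv_mul_const_field _
  rw [extD, Fin.sum_univ_succ]
  simp only [Fin.val_zero, pow_zero, one_mul, Fin.cons_zero, Fin.removeNth_zero, Fin.tail_cons,
    Fin.val_succ, Fin.cons_succ, h0, h1]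
  have h5 := wsum_vol (M := M) (∑ l, totalDeriv l b z •
    (LinearMap.proj l : (Fin (n + 1) → ℝ) →ₗ[ℝ] ℝ)) i v
  simp only [wsum, LinearMap.sum_apply, LinearMap.smul_apply, LinearMap.proj_apply,
    smul_eq_mul] at h5
  rw [Finset.sum_eq_single i (f := fun l => _ * (Pi.single i (1 : ℝ) : Fin (n + 1) → ℝ) l)] at h5
  · rw [Pi.single_eq_same, mul_one] at h5
    rw [add_mul, neg_add, add_comm, mul_right_comm (totalDeriv i b z), ← h5, Finset.sum_mul, ← Finset.sum_neg_distrib]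
    congr 1
    refine Finset.sum_congr rfl fun c _ => ?_
    simp only [mul_comm (totalDeriv _ b z)]
    ring
  · intro j _ hj
    simp [hj]
  · simp

/-- Up to sign this is the formal divergence that appears in `exists_byParts`, with `ω^σ_I` in place
of `w_I`. It is the bridge between residual forms and integration by parts. -/
theorem p_one_extD_contactTerm (hD : IsOpen D) {b : Jet (n + 1) M → ℝ} (hb : HasOrder D k b)
    (σ : Fin M) (I : MIdx (n + 1)) (i : Fin (n + 1)) {z : Jet (n + 1) M} (hz : z.pt ∈ D)
    (v : Fin (n + 2) → Jet (n + 1) M) :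
    p 1 (extD (contactTerm b σ I i)) z v =
      -wsum (fun u => totalDeriv i b z * (ver z u).2 σ I +
        b z * (ver z u).2 σ (I + Pi.single i 1)) (vol n) v := by
  obtain ⟨f, hf⟩ := (isAlternatingForm_contactTerm hb σ I i).extD hD hz
  rw [p_one_of_alternating f hf, wsum, ← Finset.sum_neg_distrib]
  refine Finset.sum_congr rfl fun a _ => ?_
  rw [← hf, extD_contactTerm_cons hD hb σ I i hz (ver_fst z _)]
  ring

end Lagrangians

section Residual

variable {n M : ℕ} {D : Set (Pt (n + 1) M)} {k s : ℕ}

/-! ### The contact component of degree one of a form on a jet space -/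

/-- The indices of the coefficients of `1`-contact forms on the jets of order `s`. -/
abbrev contactIdx (n M s : ℕ) : Finset (Fin M × MIdx (n + 1) × Fin (n + 1)) :=
  Finset.univ ×ˢ midx (n + 1) s ×ˢ Finset.univ

/-- The contraction of a form with one vector and with all but one of the formal derivatives. -/
def contactCoeff (R : FinJet (n + 1) M s → FinJet (n + 1) M s [⋀^Fin (n + 1)]→L[ℝ] ℝ)
    (i : Fin (n + 1)) (w z : Jet (n + 1) M) : ℝ :=
  (-1 : ℝ) ^ (i : ℕ) * lift R z (Fin.cons w fun b => totalField (i.succAbove b) z)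

theorem hasOrder_contactCoeff {R : FinJet (n + 1) M s → FinJet (n + 1) M s [⋀^Fin (n + 1)]→L[ℝ] ℝ}
    (hR : ContDiffOn ℝ ∞ R {z | FinJet.pt z ∈ D}) (i : Fin (n + 1)) (w : Jet (n + 1) M) :
    HasOrder D (s + 1) (contactCoeff R i w) := by
  have h : HasOrder D (s + 1) (fun z => lift R z (fun a : Fin (n + 1) =>
      (Fin.cons (fun _ => w) fun b z => totalField (i.succAbove b) z :
        Fin (n + 1) → Jet (n + 1) M → Jet (n + 1) M) a z)) := by
    refine hasOrder_lift_apply s.le_succ hR fun a => ?_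
    refine Fin.cases ?_ (fun b => ?_) a
    · exact HasOrder.const (trunc s w)
    · exact hasOrder_trunc_totalField _ s
  refine (h.comp (φ := fun a => (-1 : ℝ) ^ (i : ℕ) * a) (by fun_prop)).congr fun z _ => ?_
  rw [contactCoeff]
  congr 2
  funext a
  refine Fin.cases ?_ (fun b => ?_) a <;> rfl

theorem contactCoeff_vertical (R : FinJet (n + 1) M s → FinJet (n + 1) M s [⋀^Fin (n + 1)]→L[ℝ] ℝ)
    (i : Fin (n + 1)) {w : Jet (n + 1) M} (hw : w.1 = 0) (z : Jet (n + 1) M) :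
    contactCoeff R i w z =
      ∑ σ, ∑ I ∈ midx (n + 1) s, w.2 σ I * contactCoeff R i (vertField σ I z) z := by
  let L : Jet (n + 1) M →ₗ[ℝ] ℝ := (liftAlt R z).toMultilinearMap.toLinearMap
    (Fin.cons 0 fun b => totalField (i.succAbove b) z) 0
  have hL : ∀ w, contactCoeff R i w z = (-1 : ℝ) ^ (i : ℕ) * L w := by
    intro w
    simp [contactCoeff, L, liftAlt_apply]
  have hL' : ∀ w w', trunc s w = trunc s w' → L w = L w' := by
    intro w w' h
    have : ∀ w, L w = lift R z (Fin.cons w fun b => totalField (i.succAbove b) z) := by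
      intro w
      simp [L, liftAlt_apply]
    rw [this, this, lift, lift]
    congr 1
    funext a
    refine Fin.cases ?_ (fun b => ?_) a
    · exact h
    · rfl
  simp only [hL]
  rw [hL' _ _ (trunc_eq_sum_vertField hw z)]
  simp only [map_sum, map_smul, smul_eq_mul, Finset.mul_sum]
  exact Finset.sum_congr rfl fun σ _ => Finset.sum_congr rfl fun I _ => by ring

/-- Once the vertical argument is in front, the rest is an `n`-form in the base components and is
expanded by `eq_sum_dvol`; the vertical argument is then expanded in the fields `∂/∂y^σ_I`. An
arbitrary residual form is thereby reduced to terms whose differential is known. -/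
theorem p_one_lift (R : FinJet (n + 1) M s → FinJet (n + 1) M s [⋀^Fin (n + 1)]→L[ℝ] ℝ) :
    p 1 (lift R) = ∑ j ∈ contactIdx n M s,
      contactTerm (fun z => contactCoeff R j.2.2 (vertField j.1 j.2.1 z) z) j.1 j.2.1 j.2.2 := by
  funext z v
  have h1 : p 1 (lift R) z v = ∑ i, wsum (fun u => contactCoeff R i (ver z u) z) (dvol i) v := by
    rw [p_one_of_alternating (liftAlt R z) (fun _ => rfl)]
    simp only [wsum]
    rw [Finset.sum_comm]
    refine Finset.sum_congr rfl fun a _ => ?_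
    rw [← Finset.mul_sum]
    congr 1
    have h2 := eq_sum_dvol (((liftAlt R z).curryLeft (ver z (v a))).compLinearMap (horL z))
      (fun b => (a.removeNth v b).1)
    refine h2.trans (Finset.sum_congr rfl fun i _ => ?_)
    congr 2
    rw [AlternatingMap.compLinearMap_apply]
    have h3 : (fun b => horL z (i.removeNth (unitVec n) b)) =
        fun b => totalField (i.succAbove b) z := by
      funext b
      exact horL_single z _
    rw [h3]
    rfl
  rw [h1]
  simp only [Finset.sum_apply, contactIdx, Finset.sum_product]
  simp only [fun i u => contactCoeff_vertical R i (ver_fst z u) z, wsum_sum]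
  rw [Finset.sum_comm]
  refine Finset.sum_congr rfl fun σ _ => ?_
  rw [Finset.sum_comm]
  refine Finset.sum_congr rfl fun I _ => Finset.sum_congr rfl fun i _ => ?_
  rw [contactTerm, ← wsum_const_mul]
  exact wsum_congr _ fun a => mul_comm _ _

theorem p_one_extD_sum_contactTerm (hD : IsOpen D) {b : Fin M × MIdx (n + 1) × Fin (n + 1) → Jet (n + 1) M → ℝ}
    (hb : ∀ j, HasOrder D k (b j)) (S : Finset (Fin M × MIdx (n + 1) × Fin (n + 1)))
    {z : Jet (n + 1) M} (hz : z.pt ∈ D) (v : Fin (n + 2) → Jet (n + 1) M) :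
    p 1 (extD (∑ j ∈ S, contactTerm (b j) j.1 j.2.1 j.2.2)) z v =
      -wsum (fun u => ∑ j ∈ S, (totalDeriv j.2.2 (b j) z * (ver z u).2 j.1 j.2.1 +
        b j z * (ver z u).2 j.1 (j.2.1 + Pi.single j.2.2 1))) (vol n) v := by
  have h1 := extD_sum hD S (η := fun j => contactTerm (b j) j.1 j.2.1 j.2.2)
    (fun j _ => hasOrder_contactTerm (hb j) j.1 j.2.1 j.2.2) hz
  have h2 : p 1 (extD (∑ j ∈ S, contactTerm (b j) j.1 j.2.1 j.2.2)) z =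
      p 1 (∑ j ∈ S, extD (contactTerm (b j) j.1 j.2.1 j.2.2)) z :=
    p_congr (by rw [h1, Finset.sum_apply])
  rw [h2, p_sum, Finset.sum_apply, wsum_sum, ← Finset.sum_neg_distrib]
  exact Finset.sum_congr rfl fun j _ => p_one_extD_contactTerm hD (hb j) _ _ _ hz v

/-! ### Noether currents -/

theorem p_pos_of_base {q l : ℕ} {η : Form (n + 1) M q} (hl : l ≠ 0)
    (h : ∀ z v a, (v a).1 = 0 → η z v = 0) : p l η = 0 := by
  funext z v
  refine Finset.sum_eq_zero fun S hS => ?_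
  rw [Finset.mem_powersetCard] at hS
  obtain ⟨a, ha⟩ : S.Nonempty := Finset.card_pos.1 (by omega)
  refine h z _ a ?_
  simp only [if_pos ha, ver_fst]

/-- The horizontal differential of a horizontal `n`-form. -/
theorem dH_of_base (hD : IsOpen D) {η : Form (n + 1) M n} {F : Fin (n + 1) → Jet (n + 1) M → ℝ}
    (hF : ∀ i, HasOrder D k (F i)) (h : ∀ z v, η z v = ∑ i, F i z * dvol i (fun a => (v a).1))
    {z : Jet (n + 1) M} (hz : z.pt ∈ D) (v : Fin (n + 1) → Jet (n + 1) M) :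
    dH η z v = (∑ i, totalDeriv i (F i) z) * vol n (fun a => (v a).1) := by
  have hη : η = ∑ i, fun z v => F i z * dvol i (fun a => (v a).1) := by
    funext z v
    rw [h, Finset.sum_apply, Finset.sum_apply]
  have h0 : p 0 η = η := by
    funext z v
    rw [p_zero_apply, h, h]
    simp only [hor_fst]
  have hl : ∀ l, l ≠ 0 → p l η = 0 := fun l hl => p_pos_of_base hl fun z v a ha => by
    rw [h]
    exact Finset.sum_eq_zero fun i _ => by rw [(dvol i).map_coord_zero a ha, mul_zero]
  have hext : extD (0 : Form (n + 1) M n) = 0 := by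
    funext z v
    refine Finset.sum_eq_zero fun a _ => ?_
    rw [show lineDeriv ℝ (fun z' => (0 : Form (n + 1) M n) z' (a.removeNth v)) z (v a) = 0 from
      deriv_const _ _, mul_zero]
  have hdH : dH η = p 0 (extD η) := by
    rw [dH, Finset.sum_eq_single 0, h0]
    · intro l _ h
      rw [hl l h, hext, p_zero_form]
    · simp
  have h1 := extD_sum hD Finset.univ (η := fun i z v => F i z * dvol i (fun a => (v a).1))
    (fun i _ v => ⟨k, (hF i).comp (φ := fun a => a * dvol i (fun a => (v a).1)) (by fun_prop)⟩) hz
  rw [hdH, p_zero_apply, hη, h1, Finset.sum_apply, Finset.sum_mul]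
  refine Finset.sum_congr rfl fun i _ => ?_
  rw [extD_mul_const (dvol i) (fun _ _ => rfl), wsum_hor]
  have h5 := wsum_vol (M := M) (∑ l, totalDeriv l (F i) z •
    (LinearMap.proj l : (Fin (n + 1) → ℝ) →ₗ[ℝ] ℝ)) i v
  simp only [LinearMap.sum_apply, LinearMap.smul_apply, LinearMap.proj_apply, smul_eq_mul] at h5
  rw [Finset.sum_eq_single i (f := fun l => _ * (Pi.single i (1 : ℝ) : Fin (n + 1) → ℝ) l)] at h5
  · rw [Pi.single_eq_same, mul_one] at h5
    rw [← h5]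
    refine wsum_congr _ fun a => ?_
    rw [(hF i).lineDeriv_hor hD hz]
    exact Finset.sum_congr rfl fun l _ => mul_comm _ _
  · intro j _ hj
    simp [hj]
  · simp

/-- The first variation formula: the horizontal differential of the Noether current is the
difference of the variation of the Lagrangian and of its Euler–Lagrange expressions. -/
theorem dH_noetherCurrent (hD : IsOpen D) {L : Jet (n + 1) M → ℝ} {r : ℕ}
    {R : FinJet (n + 1) M s → FinJet (n + 1) M s [⋀^Fin (n + 1)]→L[ℝ] ℝ}
    (hR : IsResidual D r (extD (volForm L)) R) {ψ : Pt (n + 1) M → Fin M → ℝ}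
    (hψ : ContDiffOn ℝ ∞ ψ D) {z : Jet (n + 1) M} (hz : z.pt ∈ D)
    (v : Fin (n + 1) → Jet (n + 1) M) :
    dH (noetherCurrent ψ R) z v =
      (lineDeriv ℝ L z (prolong ψ z) - ∑ σ, (prolong ψ z).2 σ 0 * eulerExpr r σ L z) *
        vol n (fun a => (v a).1) := by
  let b : Fin M × MIdx (n + 1) × Fin (n + 1) → Jet (n + 1) M → ℝ :=
    fun j z => contactCoeff R j.2.2 (vertField j.1 j.2.1 z) z
  have hb : ∀ j, HasOrder D (s + 1) (b j) := fun j =>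
    hasOrder_contactCoeff hR.smooth j.2.2 (vertField j.1 j.2.1 0)
  have hp := p_one_lift R
  have hψI : ∀ σ, ∀ I ∈ midx (n + 1) s, HasOrder D (s + 1) (fun z => (prolong ψ z).2 σ I) :=
    fun σ I hI => ((hasOrder_component hψ σ).iter_totalDeriv hD I).mono (by
      have := mem_midx.1 hI
      omega)
  let F : Fin (n + 1) → Jet (n + 1) M → ℝ := fun i => ∑ σ, ∑ I ∈ midx (n + 1) s,
    (fun z => -(b (σ, I, i) z * (prolong ψ z).2 σ I))
  have hF : ∀ i, HasOrder D (s + 1) (F i) := fun i => HasOrder.sum fun σ _ => HasOrder.sum fun I hI =>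
    ((hb _).mul (hψI σ I hI)).comp (φ := fun a => -a) (by fun_prop)
  have hN : ∀ z v, noetherCurrent ψ R z v = ∑ i, F i z * dvol i (fun a => (v a).1) := by
    intro z v
    rw [noetherCurrent, contr, Pi.neg_apply, Pi.neg_apply, hp]
    simp only [Finset.sum_apply, contactIdx, Finset.sum_product, F, Finset.sum_mul]
    rw [← Finset.sum_neg_distrib]
    rw [Finset.sum_comm (s := (Finset.univ : Finset (Fin (n + 1))))]
    refine Finset.sum_congr rfl fun σ _ => ?_
    rw [Finset.sum_comm, ← Finset.sum_neg_distrib]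
    refine Finset.sum_congr rfl fun i _ => ?_
    rw [← Finset.sum_neg_distrib]
    refine Finset.sum_congr rfl fun I _ => ?_
    rw [contactTerm, wsum_cons_vertical _ _ (by rfl), ver_of_vertical z (by rfl)]
    ring
  have hdF : ∀ i, totalDeriv i (F i) z = -∑ σ, ∑ I ∈ midx (n + 1) s,
      (totalDeriv i (b (σ, I, i)) z * (prolong ψ z).2 σ I +
        b (σ, I, i) z * (prolong ψ z).2 σ (I + Pi.single i 1)) := by
    intro i
    rw [← Finset.sum_neg_distrib]
    refine HasLineDerivAt.lineDeriv ?_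
    have h1 : ∀ σ, ∀ I ∈ midx (n + 1) s, HasLineDerivAt ℝ (fun z => -(b (σ, I, i) z * (prolong ψ z).2 σ I))
        (-(totalDeriv i (b (σ, I, i)) z * (prolong ψ z).2 σ I +
        b (σ, I, i) z * (prolong ψ z).2 σ (I + Pi.single i 1))) z (totalField i z) := by
      intro σ I hI
      have h2 := (hb (σ, I, i)).hasLineDerivAt hD hz (totalField i z)
      have h3 := (hψI σ I hI).hasLineDerivAt hD hz (totalField i z)
      have h4 : lineDeriv ℝ (fun z => (prolong ψ z).2 σ I) z (totalField i z) =
          (prolong ψ z).2 σ (I + Pi.single i 1) := by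
        rw [prolong_snd hD hψ hz, JetRing.D_add_single, jetRing_d_apply hD i _ hz]
        exact totalDeriv_congr hD i (fun z hz => prolong_snd hD hψ hz σ I) hz
      rw [h4] at h3
      unfold HasLineDerivAt at h2 h3 ⊢
      have h5 := (h2.mul h3).neg
      simp only [zero_smul, add_zero] at h5
      exact h5
    unfold HasLineDerivAt at h1 ⊢
    have h6 := HasDerivAt.fun_sum (u := Finset.univ) fun σ _ =>
      HasDerivAt.fun_sum (u := midx (n + 1) s) fun I hI => h1 σ I hI
    simp only [Finset.sum_neg_distrib] at h6 ⊢
    convert h6 using 1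
    funext t
    simp [F, Finset.sum_apply]
  rw [dH_of_base hD hF hN hz]
  congr 1
  -- The identity defining the residual form is contracted with `Jψ` and evaluated on lifts of the
  -- unit vectors. Their vertical components do not matter, and the volume form takes the value `1`
  -- on them.
  have h1 := congrFun (hR.decomposition z hz) (Fin.cons (prolong ψ z) fun i => (unitVec n i, 0))
  rw [Pi.add_apply, hp, p_one_extD_sum_contactTerm hD hb _ hz, p_one_extD_volForm,
    interiorEuler_extD_volForm, wsum_cons_vertical _ _ (by rfl), wsum_cons_vertical _ _ (by rfl),
    wsum_cons_vertical _ _ (by rfl), ver_of_vertical z (by rfl)] at h1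
  simp only [vol_unitVec, mul_one, contactIdx, Finset.sum_product] at h1
  rw [h1, add_sub_cancel_left, ← Finset.sum_neg_distrib]
  simp only [hdF, Finset.sum_neg_distrib]
  congr 1
  rw [Finset.sum_comm]
  exact Finset.sum_congr rfl fun σ _ => Finset.sum_comm

end Residual

section ResidualExistence

variable {n M : ℕ} {D : Set (Pt (n + 1) M)} {k s : ℕ}

/-! ### Existence of residual forms -/

theorem continuous_vol : Continuous (vol n) := by
  have h : ∀ x, vol n x = Matrix.det (fun i j => x j i) := by
    intro x
    rw [vol, Module.Basis.det_apply]
    congr 1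
  have h' : (vol n : (Fin (n + 1) → Fin (n + 1) → ℝ) → ℝ) = fun x => Matrix.det (fun i j => x j i) :=
    funext h
  rw [h']
  refine Continuous.matrix_det ?_
  fun_prop

/-- The form `∂_i ⌋ dx^1 ∧ ⋯ ∧ dx^(n+1)` on a jet space of finite order. -/
def dvolC (s : ℕ) (i : Fin (n + 1)) : FinJet (n + 1) M s [⋀^Fin n]→L[ℝ] ℝ :=
  { (dvol i).compLinearMap (LinearMap.fst ℝ (Fin (n + 1) → ℝ) _) with
    cont := by
      refine continuous_vol.comp (continuous_pi fun a => ?_)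
      refine Fin.cases ?_ (fun b => ?_) a
      · exact continuous_const
      · exact continuous_fst.comp (continuous_apply b) }

theorem dvolC_apply (i : Fin (n + 1)) (v : Fin n → FinJet (n + 1) M s) :
    dvolC s i v = dvol i (fun b => (v b).1) := rfl

/-- The coordinate function `y^σ_I` on the jets of order `s`. -/
def coordC (s : ℕ) (σ : Fin M) (I : MIdx (n + 1)) : FinJet (n + 1) M s →L[ℝ] ℝ :=
  if h : I ∈ midx (n + 1) s then
    (ContinuousLinearMap.proj (R := ℝ) (φ := fun _ : {I : MIdx (n + 1) // I ∈ midx (n + 1) s} => ℝ)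
      ⟨I, h⟩).comp ((ContinuousLinearMap.proj (R := ℝ)
        (φ := fun _ : Fin M => {I : MIdx (n + 1) // I ∈ midx (n + 1) s} → ℝ) σ).comp
          (ContinuousLinearMap.snd ℝ _ _))
  else 0

theorem coordC_trunc {I : MIdx (n + 1)} (h : I.len ≤ s) (σ : Fin M) (z : Jet (n + 1) M) :
    coordC s σ I (trunc s z) = z.2 σ I := by
  rw [coordC, dif_pos (mem_midx.2 h)]
  rfl

/-- The base coordinate function `x^l` on the jets of order `s`. -/
def baseC (s : ℕ) (l : Fin (n + 1)) : FinJet (n + 1) M s →L[ℝ] ℝ :=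
  (ContinuousLinearMap.proj (R := ℝ) (φ := fun _ : Fin (n + 1) => ℝ) l).comp
    (ContinuousLinearMap.fst ℝ _ _)

/-- The form `ω^σ_I ∧ (∂_i ⌋ dx^1 ∧ ⋯ ∧ dx^(n+1))` on the jets of order `s`. -/
def contactTermC (s : ℕ) (σ : Fin M) (I : MIdx (n + 1)) (i : Fin (n + 1)) (ζ : FinJet (n + 1) M s) :
    FinJet (n + 1) M s [⋀^Fin (n + 1)]→L[ℝ] ℝ :=
  ContinuousAlternatingMap.alternatizeUncurryFin ((coordC s σ I).smulRight (dvolC s i)) -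
    ∑ l, coordC s σ (I + Pi.single l 1) ζ •
      ContinuousAlternatingMap.alternatizeUncurryFin ((baseC s l).smulRight (dvolC s i))

theorem contDiff_contactTermC (σ : Fin M) (I : MIdx (n + 1)) (i : Fin (n + 1)) :
    ContDiff ℝ ∞ (contactTermC s σ I i) := by
  refine contDiff_const.sub (ContDiff.sum fun l _ => ?_)
  exact (coordC s σ (I + Pi.single l 1)).contDiff.smul contDiff_const

theorem contactTermC_apply {I : MIdx (n + 1)} (hI : I.len + 1 ≤ s) (σ : Fin M) (i : Fin (n + 1))
    (z : Jet (n + 1) M) (v : Fin (n + 1) → Jet (n + 1) M) :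
    contactTermC s σ I i (trunc s z) (fun a => trunc s (v a)) =
      wsum (fun u => (ver z u).2 σ I) (dvol i) v := by
  have h1 : ∀ ℓ : FinJet (n + 1) M s →L[ℝ] ℝ,
      ContinuousAlternatingMap.alternatizeUncurryFin (ℓ.smulRight (dvolC s i))
        (fun a => trunc s (v a)) = wsum (fun u => ℓ (trunc s u)) (dvol i) v := by
    intro ℓ
    rw [ContinuousAlternatingMap.alternatizeUncurryFin_apply]
    refine Finset.sum_congr rfl fun a _ => ?_
    rw [ContinuousLinearMap.smulRight_apply, ContinuousAlternatingMap.smul_apply, dvolC_apply,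
      ← Int.cast_smul_eq_zsmul ℝ]
    simp only [Int.cast_pow, Int.cast_neg, Int.cast_one, smul_eq_mul]
    rfl
  have h2 : ∀ l : Fin (n + 1), (I + Pi.single l 1).len ≤ s := fun l => by
    rw [MIdx.len_add_single]
    exact hI
  simp only [contactTermC, ContinuousAlternatingMap.sub_apply, ContinuousAlternatingMap.sum_apply,
    ContinuousAlternatingMap.smul_apply, h1, coordC_trunc (h2 _), smul_eq_mul]
  simp only [← wsum_const_mul, ← wsum_sum]
  rw [sub_eq_iff_eq_add, ← wsum_add]
  refine wsum_congr _ fun a => ?_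
  rw [ver_snd, coordC_trunc (by omega)]
  have h3 : ∀ l, baseC s l (trunc s (v a)) = (v a).1 l := fun l => rfl
  simp only [h3, mul_comm (z.2 σ _)]
  ring

/-- The decomposition of the differential of a Lagrangian, obtained by integration by parts. -/
theorem exists_divergence (hD : IsOpen D) {L : Jet (n + 1) M → ℝ} (hL : HasOrder D k L) {r : ℕ}
    (hr : k ≤ r) : ∃ B : Fin M × MIdx (n + 1) × Fin (n + 1) → JetFun D,
      ∀ z : Jet (n + 1) M, z.pt ∈ D → ∀ w : Jet (n + 1) M, w.1 = 0 →
        lineDeriv ℝ L z w = ∑ σ, w.2 σ 0 * eulerExpr r σ L z -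
          ∑ j ∈ contactIdx n M r, (totalDeriv j.2.2 (B j).1 z * w.2 j.1 j.2.1 +
            (B j).1 z * w.2 j.1 (j.2.1 + Pi.single j.2.2 1)) := by
  let a : JetFun D := ⟨L, k, hL⟩
  choose B hB using fun (σ : Fin M) (I : MIdx (n + 1)) =>
    (jetRing hD).exists_byParts I ((jetRing hD).δ σ I a)
  refine ⟨fun j => ∑ I ∈ midx (n + 1) r, B j.1 I j.2.1 j.2.2, fun z hz w hw => ?_⟩
  have h1 : ∀ σ, ∑ I ∈ midx (n + 1) r, w.2 σ I * lineDeriv ℝ L z (vertField σ I z) =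
      w.2 σ 0 * eulerExpr r σ L z - ∑ J ∈ midx (n + 1) r, ∑ j,
        (totalDeriv j (∑ I ∈ midx (n + 1) r, B σ I J j : JetFun D).1 z * w.2 σ J +
          (∑ I ∈ midx (n + 1) r, B σ I J j : JetFun D).1 z * w.2 σ (J + Pi.single j 1)) := by
    intro σ
    have h2 : ∀ I ∈ midx (n + 1) r, w.2 σ I * lineDeriv ℝ L z (vertField σ I z) =
        ((-1 : ℝ) ^ I.len • (jetRing hD).D I ((jetRing hD).δ σ I a) : JetFun D).1 z * w.2 σ 0 -
        ∑ J ∈ midx (n + 1) r, ∑ j, (((jetRing hD).d j (B σ I J j)).1 z * w.2 σ J +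
          (B σ I J j).1 z * w.2 σ (J + Pi.single j 1)) := by
      intro I hI
      -- The components of the fixed vector `w` are regarded as constant elements of the module of
      -- all functions of `z`. The identity is linear over the ring and never differentiates them.
      have h3 := congrFun (hB σ I r (mem_midx.1 hI) (Jet (n + 1) M → ℝ) fun I _ => w.2 σ I) z
      rw [mul_comm, ← jetRing_δ_apply hD σ I a hz]
      refine h3.trans ?_
      simp only [Pi.sub_apply, Finset.sum_apply, Pi.add_apply]
      rfl
    rw [Finset.sum_congr rfl h2, Finset.sum_sub_distrib, eulerExpr_eq hD r σ a (fun _ _ => rfl) hz,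
      ← Finset.sum_mul]
    congr 1
    · rw [mul_comm, JetRing.E, AddSubmonoidClass.coe_finsetSum, Finset.sum_apply]
    · rw [Finset.sum_comm]
      refine Finset.sum_congr rfl fun J _ => ?_
      rw [Finset.sum_comm]
      refine Finset.sum_congr rfl fun j _ => ?_
      rw [Finset.sum_add_distrib, ← Finset.sum_mul, ← Finset.sum_mul,
        ← jetRing_d_apply hD j _ hz, map_sum]
      simp only [AddSubmonoidClass.coe_finsetSum, Finset.sum_apply]
  rw [(hL.mono hr).lineDeriv_vertical hD hz hw, Finset.sum_congr rfl fun σ _ => h1 σ,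
    Finset.sum_sub_distrib]
  congr 1
  simp only [contactIdx, Finset.sum_product]

/-- The differential of a Lagrangian of finite order has a residual form. -/
theorem exists_isResidual (hD : IsOpen D) {L : Jet (n + 1) M → ℝ} (hL : HasOrder D k L) {r : ℕ}
    (hr : k ≤ r) : ∃ (s : ℕ) (R : FinJet (n + 1) M s → FinJet (n + 1) M s [⋀^Fin (n + 1)]→L[ℝ] ℝ),
      IsResidual D r (extD (volForm L)) R := by
  obtain ⟨B, hB⟩ := exists_divergence hD hL hr
  choose o ho using fun j => (B j).2
  -- The finitely many coefficients get a common order. It is taken at least `r + 1`, since `ω^σ_I`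
  -- with `|I| ≤ r` involves the coordinates `y^σ_{I+l}`.
  obtain ⟨s₀, hs₀⟩ := Finset.exists_le ((contactIdx n M r).image o)
  have hs : ∀ j ∈ contactIdx n M r, HasOrder D (max s₀ (r + 1)) (B j).1 := fun j hj =>
    (ho j).mono ((hs₀ _ (Finset.mem_image_of_mem o hj)).trans (le_max_left _ _))
  generalize hsr : max s₀ (r + 1) = s at hs
  have hrs : r + 1 ≤ s := hsr ▸ le_max_right _ _
  choose! g hg hBg using hs
  -- Defined from the representatives `g j`, so that the expression of `lift R` by contact terms
  -- holds everywhere and not just over `D`; zero off the index set, so that every `b j` has finite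
  -- order.
  let b : Fin M × MIdx (n + 1) × Fin (n + 1) → Jet (n + 1) M → ℝ := fun j z =>
    if j ∈ contactIdx n M r then g j (trunc s z) else 0
  have hb : ∀ j, HasOrder D s (b j) := by
    intro j
    by_cases hj : j ∈ contactIdx n M r
    · simp only [b, hj, if_true]
      exact ⟨g j, hg j hj, fun _ _ => rfl⟩
    · simp only [b, hj, if_false]
      exact HasOrder.const 0
  have hbB : ∀ j ∈ contactIdx n M r, ∀ z : Jet (n + 1) M, z.pt ∈ D → b j z = (B j).1 z :=
    fun j hj z hz => (if_pos hj).trans (hBg j hj z hz).symm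
  let R : FinJet (n + 1) M s → FinJet (n + 1) M s [⋀^Fin (n + 1)]→L[ℝ] ℝ := fun ζ =>
    ∑ j ∈ contactIdx n M r, g j ζ • contactTermC s j.1 j.2.1 j.2.2 ζ
  have hR : lift R = ∑ j ∈ contactIdx n M r, contactTerm (b j) j.1 j.2.1 j.2.2 := by
    funext z v
    simp only [lift, R, ContinuousAlternatingMap.sum_apply, Finset.sum_apply]
    refine Finset.sum_congr rfl fun j hj => ?_
    have hj' : j.2.1.len + 1 ≤ s := by
      have := mem_midx.1 (Finset.mem_product.1 (Finset.mem_product.1 hj).2).1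
      omega
    rw [ContinuousAlternatingMap.smul_apply, contactTermC_apply hj', contactTerm, smul_eq_mul]
    exact congrArg (· * _) (if_pos hj).symm
  have hp1 : p 1 (lift R) = lift R := by
    funext z
    rw [hR, p_sum, Finset.sum_apply]
    simp only [p_one_contactTerm]
  refine ⟨s, R, ?_, ?_, ?_⟩
  · exact ContDiffOn.sum fun j hj => (hg j hj).smul (contDiff_contactTermC _ _ _).contDiffOn
  · intro z _
    rw [hR, p_sum]
    refine Finset.sum_eq_zero fun j _ => ?_
    rw [p_zero_contactTerm]
    rfl
  · intro z hz
    funext v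
    rw [hp1, hR, Pi.add_apply, p_one_extD_volForm, interiorEuler_extD_volForm,
      p_one_extD_sum_contactTerm hD hb _ hz, ← sub_eq_add_neg, eq_sub_iff_add_eq, ← wsum_add]
    refine wsum_congr _ fun a => ?_
    rw [hB z hz _ (ver_fst z _), sub_add_eq_add_sub, sub_eq_iff_eq_add]
    congr 1
    refine Finset.sum_congr rfl fun j hj => ?_
    rw [hbB j hj z hz, totalDeriv_congr hD _ (hbB j hj) hz]

end ResidualExistence

/-! ### Iterated partial derivatives of smooth functions -/

section SmoothOn

variable {E : Type*} [NormedAddCommGroup E] [NormedSpace ℝ E] {W : Set E}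

theorem lineDeriv_congr_of_mem (hW : IsOpen W) {f g : E → ℝ} (h : ∀ x ∈ W, f x = g x) {x : E}
    (hx : x ∈ W) (v : E) : lineDeriv ℝ f x v = lineDeriv ℝ g x v :=
  Filter.EventuallyEq.lineDeriv_eq (Filter.eventually_of_mem (hW.mem_nhds hx) h)

theorem ContDiffOn.hasFDerivAt_of_isOpen {F : Type*} [NormedAddCommGroup F] [NormedSpace ℝ F]
    (hW : IsOpen W) {f : E → F} (hf : ContDiffOn ℝ ∞ f W) {x : E}
    (hx : x ∈ W) : HasFDerivAt f (fderiv ℝ f x) x :=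
  ((hf.contDiffAt (hW.mem_nhds hx)).differentiableAt (by simp)).hasFDerivAt

theorem ContDiffOn.lineDeriv_of_isOpen (hW : IsOpen W) {f : E → ℝ} (hf : ContDiffOn ℝ ∞ f W)
    (v : E) : ContDiffOn ℝ ∞ (fun x => lineDeriv ℝ f x v) W := by
  have h : ContDiffOn ℝ ∞ (fun x => fderiv ℝ f x v) W :=
    (hf.fderiv_of_isOpen hW (by simp)).clm_apply contDiffOn_const
  exact h.congr fun x hx => ((ContDiffOn.hasFDerivAt_of_isOpen hW hf hx).hasLineDerivAt v).lineDeriv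

theorem ContDiffOn.lineDeriv_comm (hW : IsOpen W) {f : E → ℝ} (hf : ContDiffOn ℝ ∞ f W)
    (v w : E) {x : E} (hx : x ∈ W) :
    lineDeriv ℝ (fun x => lineDeriv ℝ f x v) x w = lineDeriv ℝ (fun x => lineDeriv ℝ f x w) x v := by
  have h1 : ∀ v, ∀ x ∈ W, lineDeriv ℝ f x v = fderiv ℝ f x v := fun v x hx =>
    ((ContDiffOn.hasFDerivAt_of_isOpen hW hf hx).hasLineDerivAt v).lineDeriv
  have h2 : ∀ v w, lineDeriv ℝ (fun x => lineDeriv ℝ f x v) x w = fderiv ℝ (fderiv ℝ f) x w v := by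
    intro v w
    rw [lineDeriv_congr_of_mem hW (h1 v) hx]
    have h3 := ContDiffOn.hasFDerivAt_of_isOpen hW (hf.fderiv_of_isOpen hW (m := ∞) (by simp)) hx
    have h4 := (h3.clm_apply (hasFDerivAt_const v x)).hasLineDerivAt w
    rw [h4.lineDeriv]
    simp
  have hsymm : IsSymmSndFDerivAt ℝ f x := (hf.contDiffAt (hW.mem_nhds hx)).isSymmSndFDerivAt
    (by simpa using WithTop.coe_le_coe.2 (le_top : (2 : ℕ∞) ≤ ⊤))
  rw [h2, h2, hsymm.eq]

variable (W) in
/-- The functions that are smooth on `W`. -/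
def SmoothFun : Type _ := {f : E → ℝ // ContDiffOn ℝ ∞ f W}

open Classical in
/-- The derivative in a fixed direction, made to vanish off `W`. -/
def SmoothFun.dir (hW : IsOpen W) (v : E) (f : SmoothFun W) : SmoothFun W :=
  ⟨fun x => if x ∈ W then lineDeriv ℝ f.1 x v else 0,
    (ContDiffOn.lineDeriv_of_isOpen hW f.2 v).congr fun _ hx => if_pos hx⟩

theorem SmoothFun.dir_apply (hW : IsOpen W) (v : E) (f : SmoothFun W) {x : E} (hx : x ∈ W) :
    (f.dir hW v).1 x = lineDeriv ℝ f.1 x v := if_pos hx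

/-- An equality of functions on the whole space, thanks to the value `0` off `W`. `iter_add_single`
requires commutation in this unconditional form. -/
theorem SmoothFun.dir_comm (hW : IsOpen W) (v w : E) (f : SmoothFun W) :
    (f.dir hW v).dir hW w = (f.dir hW w).dir hW v := by
  refine Subtype.ext (funext fun x => ?_)
  by_cases hx : x ∈ W
  · rw [dir_apply hW _ _ hx, dir_apply hW _ _ hx,
      lineDeriv_congr_of_mem hW (fun x hx => dir_apply hW v f hx) hx,
      lineDeriv_congr_of_mem hW (fun x hx => dir_apply hW w f hx) hx,
      ContDiffOn.lineDeriv_comm hW f.2 v w hx]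
  · exact (if_neg hx).trans (if_neg hx).symm

end SmoothOn

section Sections

variable {N M : ℕ} {W : Set (Fin N → ℝ)}

theorem iter_pderiv_eq (hW : IsOpen W) (f : SmoothFun W) (I : MIdx N) : ∀ x ∈ W,
    iter pderiv I f.1 x = (iter (fun i f => f.dir hW (Pi.single i 1)) I f).1 x :=
  iter_rel (fun (g : (Fin N → ℝ) → ℝ) (f : SmoothFun W) => ∀ x ∈ W, g x = f.1 x)
    (fun i g f h x hx => by
      rw [SmoothFun.dir_apply hW _ _ hx, pderiv, lineDeriv_congr_of_mem hW h hx]) I fun _ _ => rfl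

theorem iter_pderiv_congr (hW : IsOpen W) {f g : (Fin N → ℝ) → ℝ} (h : ∀ x ∈ W, f x = g x)
    (I : MIdx N) : ∀ x ∈ W, iter pderiv I f x = iter pderiv I g x :=
  iter_rel (fun f g : (Fin N → ℝ) → ℝ => ∀ x ∈ W, f x = g x)
    (F := pderiv) (G := pderiv) (fun _ _ _ h _ hx => lineDeriv_congr_of_mem hW h hx _) I h

/-! ### Jets of sections -/

theorem jet_pt (u : (Fin N → ℝ) → Fin M → ℝ) (x : Fin N → ℝ) : (jet u x).pt = (x, u x) := by
  simp [Jet.pt, jet, iter_zero]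

/-- By symmetry of mixed partial derivatives, `∂_i ∂_I u` is the coordinate of index `I + i` of the
jet, which is the corresponding component of `d_i`. -/
theorem hasLineDerivAt_trunc_jet (hW : IsOpen W) {u : (Fin N → ℝ) → Fin M → ℝ}
    (hu : ContDiffOn ℝ ∞ u W) (i : Fin N) {x : Fin N → ℝ} (hx : x ∈ W) (k : ℕ) :
    HasLineDerivAt ℝ (fun x => trunc k (jet u x)) (trunc k (totalField i (jet u x))) x
      (Pi.single i 1) := by
  have h1 : ∀ j, HasLineDerivAt ℝ (fun x : Fin N → ℝ => x j) ((Pi.single i 1 : Fin N → ℝ) j) x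
      (Pi.single i 1) := fun j =>
    (ContinuousLinearMap.proj (R := ℝ) (φ := fun _ : Fin N => ℝ) j).hasFDerivAt.hasLineDerivAt _
  have h2 : ∀ σ I, HasLineDerivAt ℝ (fun x => (jet u x).2 σ I) ((totalField i (jet u x)).2 σ I) x
      (Pi.single i 1) := by
    intro σ I
    let f : SmoothFun W := ⟨fun x => u x σ, contDiffOn_pi.1 hu σ⟩
    let g := iter (fun i (f : SmoothFun W) => f.dir hW (Pi.single i 1)) I f
    have h3 : ∀ x ∈ W, (jet u x).2 σ I = g.1 x := iter_pderiv_eq hW f I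
    have h4 := (ContDiffOn.hasFDerivAt_of_isOpen hW g.2 hx).hasLineDerivAt (Pi.single i 1)
    have h5 := h4.congr_of_eventuallyEq (Filter.eventually_of_mem (hW.mem_nhds hx) h3)
    have h6 := iter_pderiv_eq hW f (I + Pi.single i 1) x hx
    rw [iter_add_single (F := fun i (f : SmoothFun W) => f.dir hW (Pi.single i 1))
      fun i j a => SmoothFun.dir_comm hW _ _ a] at h6
    have h7 : (totalField i (jet u x)).2 σ I = fderiv ℝ g.1 x (Pi.single i 1) :=
      h6.trans ((SmoothFun.dir_apply hW _ _ hx).trans h4.lineDeriv)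
    rw [h7]
    exact h5
  unfold HasLineDerivAt at h1 h2 ⊢
  exact (hasDerivAt_pi.2 h1).prodMk (hasDerivAt_pi.2 fun σ => hasDerivAt_pi.2 fun I => h2 σ I.1)

variable {D : Set (Pt N M)}

/-- The chain rule: the formal derivative along the jets of a section is the derivative. -/
theorem pderiv_comp_jet (hD : IsOpen D) (hW : IsOpen W) {u : (Fin N → ℝ) → Fin M → ℝ}
    (hu : ContDiffOn ℝ ∞ u W) (huD : ∀ x ∈ W, (x, u x) ∈ D) {k : ℕ} {f : Jet N M → ℝ}
    (hf : HasOrder D k f) {φ : (Fin N → ℝ) → ℝ} (hφ : ∀ x ∈ W, φ x = f (jet u x)) (i : Fin N)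
    {x : Fin N → ℝ} (hx : x ∈ W) : pderiv i φ x = totalDeriv i f (jet u x) := by
  obtain ⟨g, hg, hfg⟩ := hf
  have hz : (jet u x).pt ∈ D := by
    rw [jet_pt]
    exact huD x hx
  have h1 := ContDiffOn.hasFDerivAt_of_isOpen (FinJet.isOpen_pt hD) hg (x := trunc k (jet u x)) hz
  have h2 := hasLineDerivAt_of_trunc hD hfg hz h1 (totalField i (jet u x))
  rw [totalDeriv, h2.lineDeriv]
  refine HasLineDerivAt.lineDeriv ?_
  have h3 := hasLineDerivAt_trunc_jet hW hu i hx k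
  have h4 : HasLineDerivAt ℝ (fun x => g (trunc k (jet u x)))
      (fderiv ℝ g (trunc k (jet u x)) (trunc k (totalField i (jet u x)))) x (Pi.single i 1) := by
    unfold HasLineDerivAt at h3 ⊢
    refine HasFDerivAt.comp_hasDerivAt (0 : ℝ) ?_ h3
    simpa using h1
  refine h4.congr_of_eventuallyEq (Filter.eventually_of_mem (hW.mem_nhds hx) fun x hx => ?_)
  rw [hφ x hx]
  refine hfg _ ?_
  rw [jet_pt]
  exact huD x hx

theorem iter_pderiv_comp_jet (hD : IsOpen D) (hW : IsOpen W) {u : (Fin N → ℝ) → Fin M → ℝ}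
    (hu : ContDiffOn ℝ ∞ u W) (huD : ∀ x ∈ W, (x, u x) ∈ D) {f : Jet N M → ℝ}
    (hf : ∃ k, HasOrder D k f) {φ : (Fin N → ℝ) → ℝ} (hφ : ∀ x ∈ W, φ x = f (jet u x)) (I : MIdx N) :
    ∀ x ∈ W, iter pderiv I φ x = iter totalDeriv I f (jet u x) :=
  (iter_rel (fun (φ : (Fin N → ℝ) → ℝ) (f : Jet N M → ℝ) =>
      (∃ k, HasOrder D k f) ∧ ∀ x ∈ W, φ x = f (jet u x))
    (fun i φ f h => ⟨h.1.imp' _ fun _ hk => hk.totalDeriv hD i, fun x hx => by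
      obtain ⟨k, hk⟩ := h.1
      exact pderiv_comp_jet hD hW hu huD hk h.2 i hx⟩) I ⟨hf, hφ⟩).2

/-! ### Variations -/

variable {O : Set (ℝ × (Fin N → ℝ))}

/-- Partial derivatives of a slice are values of partial derivatives of the joint function, so their
smooth dependence on `t` becomes visible. -/
theorem iter_pderiv_slice (hO : IsOpen O) (f : SmoothFun O) (I : MIdx N) (t : ℝ) :
    ∀ x, (t, x) ∈ O → iter pderiv I (fun x => f.1 (t, x)) x =
      (iter (fun i f => f.dir hO (0, Pi.single i 1)) I f).1 (t, x) :=
  iter_rel (fun (g : (Fin N → ℝ) → ℝ) (f : SmoothFun O) => ∀ x, (t, x) ∈ O → g x = f.1 (t, x))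
    (fun i g f h x hx => by
      rw [SmoothFun.dir_apply hO _ _ hx, pderiv]
      refine Filter.EventuallyEq.deriv_eq ?_
      have h1 : ContinuousAt (fun s : ℝ => (t, x) + s • ((0 : ℝ), (Pi.single i 1 : Fin N → ℝ))) 0 := by
        fun_prop
      filter_upwards [h1.eventually_mem (hO.mem_nhds (by simpa using hx))] with s hs
      have h2 : (t, x) + s • ((0 : ℝ), (Pi.single i 1 : Fin N → ℝ)) = (t, x + s • Pi.single i 1) := by
        simp
      rw [h2] at hs ⊢
      exact h _ hs) I fun _ _ => rfl

/-- The derivative of the jets of a family of sections. -/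
theorem hasDerivAt_trunc_jet (hO : IsOpen O) {U : ℝ × (Fin N → ℝ) → Fin M → ℝ}
    (hU : ContDiffOn ℝ ∞ U O) {x : Fin N → ℝ} (hx : (0, x) ∈ O) (k : ℕ) :
    HasDerivAt (fun t => trunc k (jet (fun x => U (t, x)) x))
      (trunc k (0, fun σ I => iter pderiv I (fun x => lineDeriv ℝ (fun a => U a σ) (0, x) (1, 0)) x))
      0 := by
  have h2 : ∀ σ I, HasDerivAt (fun t => iter pderiv I (fun x => U (t, x) σ) x)
      (iter pderiv I (fun x => lineDeriv ℝ (fun a => U a σ) (0, x) (1, 0)) x) 0 := by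
    intro σ I
    let f : SmoothFun O := ⟨fun a => U a σ, contDiffOn_pi.1 hU σ⟩
    let g := iter (fun i (f : SmoothFun O) => f.dir hO (0, Pi.single i 1)) I f
    -- The derivative in `t` commutes with the partial derivatives in `x`.
    have h3 : iter pderiv I (fun x => lineDeriv ℝ (fun a => U a σ) (0, x) (1, 0)) x =
        lineDeriv ℝ g.1 (0, x) (1, 0) := by
      have h4 := iter_pderiv_slice hO (f.dir hO (1, 0)) I 0 x hx
      have h5 := iter_comp (F := fun i (f : SmoothFun O) => f.dir hO (0, Pi.single i 1))
        (g := fun f : SmoothFun O => f.dir hO (1, 0)) (fun i a => SmoothFun.dir_comm hO _ _ a) I f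
      rw [← h5, SmoothFun.dir_apply hO _ _ hx] at h4
      rw [← h4]
      have hO' : IsOpen {x : Fin N → ℝ | ((0 : ℝ), x) ∈ O} := hO.preimage (by fun_prop)
      exact iter_pderiv_congr hO' (fun x hx => (SmoothFun.dir_apply hO _ f hx).symm) I x hx
    have h5 := (ContDiffOn.hasFDerivAt_of_isOpen hO g.2 hx).hasLineDerivAt (1, 0)
    rw [h3, h5.lineDeriv]
    unfold HasLineDerivAt at h5
    refine h5.congr_of_eventuallyEq ?_
    have h6 : ContinuousAt (fun s : ℝ => (s, x)) 0 := by fun_prop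
    filter_upwards [h6.eventually_mem (hO.mem_nhds hx)] with s hs
    have h7 : ((0 : ℝ), x) + s • ((1 : ℝ), (0 : Fin N → ℝ)) = (s, x) := by simp
    rw [h7]
    exact iter_pderiv_slice hO f I s x hs
  exact (hasDerivAt_const _ _).prodMk (hasDerivAt_pi.2 fun σ => hasDerivAt_pi.2 fun I => h2 σ I.1)

/-- If a function of finite order vanishes along the jets of a family of sections then so does
its derivative along the prolongation of the variation field. -/
theorem lineDeriv_prolong_eq_zero (hD : IsOpen D) (hO : IsOpen O) {U : ℝ × (Fin N → ℝ) → Fin M → ℝ}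
    (hU : ContDiffOn ℝ ∞ U O) (hUD : ∀ x, (0, x) ∈ O → (x, U (0, x)) ∈ D)
    {ψ : Pt N M → Fin M → ℝ} (hψ : ContDiffOn ℝ ∞ ψ D)
    (hUψ : ∀ x, (0, x) ∈ O → ∀ σ, lineDeriv ℝ (fun a => U a σ) (0, x) (1, 0) = ψ (x, U (0, x)) σ)
    {k : ℕ} {f : Jet N M → ℝ} (hf : HasOrder D k f) {x : Fin N → ℝ} (hx : (0, x) ∈ O)
    (h0 : ∀ᶠ t in 𝓝 (0 : ℝ), f (jet (fun x => U (t, x)) x) = 0) :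
    lineDeriv ℝ f (jet (fun x => U (0, x)) x) (prolong ψ (jet (fun x => U (0, x)) x)) = 0 := by
  obtain ⟨g, hg, hfg⟩ := hf
  set z := jet (fun x => U (0, x)) x with hz'
  have hz : z.pt ∈ D := by
    rw [hz', jet_pt]
    exact hUD x hx
  have h1 := ContDiffOn.hasFDerivAt_of_isOpen (FinJet.isOpen_pt hD) hg (x := trunc k z) hz
  rw [(hasLineDerivAt_of_trunc hD hfg hz h1 (prolong ψ z)).lineDeriv]
  have hW : IsOpen {x : Fin N → ℝ | ((0 : ℝ), x) ∈ O} := hO.preimage (by fun_prop)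
  have hu : ContDiffOn ℝ ∞ (fun x => U (0, x)) {x : Fin N → ℝ | ((0 : ℝ), x) ∈ O} :=
    hU.comp (by fun_prop) fun x hx => hx
  -- Along the section the variation field is `ψ` composed with the section, and its partial
  -- derivatives are the formal derivatives of `ψ` at the jets. So the velocity of the jets is the
  -- prolongation of `ψ`.
  have h2 : trunc k (prolong ψ z) = trunc k (0, fun σ I =>
      iter pderiv I (fun x => lineDeriv ℝ (fun a => U a σ) (0, x) (1, 0)) x) := by
    refine congrArg (trunc k) (Prod.ext rfl (funext fun σ => funext fun I => ?_))
    refine (iter_pderiv_comp_jet hD hW hu hUD ⟨0, hasOrder_component hψ σ⟩ (fun x hx => ?_) I x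
      hx).symm
    rw [hUψ x hx, jet_pt]
  have h3 := hasDerivAt_trunc_jet hO hU hx k
  rw [← h2] at h3
  have h4 := HasFDerivAt.comp_hasDerivAt (0 : ℝ) h1 h3
  -- The derivative of `f` along the moving jet is computed twice: by the chain rule, and from the
  -- vanishing of `f` there for small `t`.
  refine h4.unique ((hasDerivAt_const (0 : ℝ) (0 : ℝ)).congr_of_eventuallyEq ?_)
  have h5 : ContinuousAt (fun t => (trunc k (jet (fun x => U (t, x)) x)).pt) 0 :=
    FinJet.contDiff_pt.continuous.continuousAt.comp h3.continuousAt
  filter_upwards [h0, h5.eventually_mem (hD.mem_nhds hz)] with t ht ht'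
  rw [← ht, hfg _ ht']
  rfl

end Sections

/-! ### Local expressions in fibred charts -/

theorem jet_congr {N M : ℕ} {W : Set (Fin N → ℝ)} (hW : IsOpen W)
    {u v : (Fin N → ℝ) → Fin M → ℝ} (h : ∀ x ∈ W, u x = v x) {x : Fin N → ℝ} (hx : x ∈ W) :
    jet u x = jet v x :=
  Prod.ext rfl <| funext fun σ => funext fun I =>
    iter_pderiv_congr hW (fun x hx => congrFun (h x hx) σ) I x hx

section Charts

variable {N M : ℕ} {X Y : Type*} [TopologicalSpace X] [ChartedSpace (Fin N → ℝ) X]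
  [TopologicalSpace Y] [ChartedSpace (Pt N M) Y] {π : Y → X}

section

variable [IsManifold 𝓘(ℝ, Pt N M) ∞ Y]

/-- The components of a smooth vertical field in a fibred chart are smooth. -/
theorem contDiffOn_comps (c : FibredChart (N := N) (M := M) π)
    {ψ : ∀ y : Y, TangentSpace 𝓘(ℝ, Pt N M) y} (hψ : IsVerticalField π ψ) :
    ContDiffOn ℝ ∞ (comps c ψ) c.total.target := by
  have h1 : ContMDiffOn 𝓘(ℝ, Pt N M).tangent 𝓘(ℝ, Pt N M).tangent ∞
      (tangentMapWithin 𝓘(ℝ, Pt N M) 𝓘(ℝ, Pt N M) c.total c.total.source)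
      (Bundle.TotalSpace.proj ⁻¹' c.total.source) :=
    (contMDiffOn_of_mem_maximalAtlas c.total_mem).contMDiffOn_tangentMapWithin (m := ∞) (by simp)
      c.total.open_source.uniqueMDiffOn
  have h2 : ContMDiffOn 𝓘(ℝ, Pt N M) 𝓘(ℝ, Pt N M).tangent ∞
      (fun a => (⟨c.total.symm a, ψ (c.total.symm a)⟩ : TangentBundle 𝓘(ℝ, Pt N M) Y))
      c.total.target :=
    hψ.smooth.comp_contMDiffOn (contMDiffOn_symm_of_mem_maximalAtlas c.total_mem)
  have h3 := (contMDiff_snd_tangentBundle_modelSpace (Pt N M) 𝓘(ℝ, Pt N M) (n := ∞)).comp_contMDiffOn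
    (h1.comp h2 fun a ha => c.total.map_target ha)
  have h4 := contDiff_snd.comp_contDiffOn h3.contDiffOn
  refine h4.congr fun a ha => ?_
  simp only [comps, tangentMapWithin, Function.comp]
  rw [mfderivWithin_of_isOpen c.total.open_source (c.total.map_target ha)]

end

theorem total_symm_section (c : FibredChart (N := N) (M := M) π) {γ : X → Y} {x' : Fin N → ℝ}
    (hx : x' ∈ c.base.target) (hγ : π (γ (c.base.symm x')) = c.base.symm x')
    (hs : γ (c.base.symm x') ∈ c.total.source) :
    c.total (γ (c.base.symm x')) = (x', (c.total (γ (c.base.symm x'))).2) := by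
  refine Prod.ext ?_ rfl
  rw [c.fibred _ hs, hγ, c.base.right_inv hx]

theorem IsLocalSection.mem_base {V : Set X} {γ : X → Y}
    (hγ : IsLocalSection (N := N) (M := M) π V γ) (c : FibredChart (N := N) (M := M) π) {x : X}
    (hx : x ∈ V) (hs : γ x ∈ c.total.source) : x ∈ c.base.source := by
  have h := c.mapsTo _ hs
  rwa [hγ.proj_eq x hx] at h

theorem IsLocalSection.jetOf_pt {V : Set X} {γ : X → Y}
    (hγ : IsLocalSection (N := N) (M := M) π V γ) (c : FibredChart (N := N) (M := M) π) {x : X}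
    (hx : x ∈ V) (hs : γ x ∈ c.total.source) : (jetOf c γ x).pt = c.total (γ x) := by
  have hb := hγ.mem_base c hx hs
  rw [jetOf, jet_pt, c.base.left_inv hb]
  refine Prod.ext ?_ rfl
  rw [c.fibred _ hs, hγ.proj_eq x hx]

variable [IsManifold 𝓘(ℝ, Pt N M) ∞ Y]

/-- If the Euler–Lagrange form controls a function of finite order then, along `γ`, the derivative
of this function along the prolonged generator of symmetry transformations of `γ` vanishes. -/
theorem lineDeriv_prolong_comps_eq_zero {k q : ℕ} {ρ : JetForm (N := N) (M := M) π k q}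
    {ψ : ∀ y : Y, TangentSpace 𝓘(ℝ, Pt N M) y} (hψ : IsVerticalField π ψ)
    {V : Set X} {γ : X → Y} (hγ : IsLocalSection (N := N) (M := M) π V γ)
    (hsym : GeneratesSymmetries ρ V γ ψ)
    (c : FibredChart (N := N) (M := M) π) {s : ℕ} {f : Jet N M → ℝ}
    (hf : HasOrder c.total.target s f) (hf0 : ∀ z, eulerLagrange ρ c z = 0 → f z = 0)
    {x : X} (hx : x ∈ V) (hs : γ x ∈ c.total.source) :
    lineDeriv ℝ f (jetOf c γ x) (prolong (comps c ψ) (jetOf c γ x)) = 0 := by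
  obtain ⟨U, ε, Φ, hxU, hΦ, hext⟩ := hsym x hx
  have h0 : (0 : ℝ) ∈ Set.Ioo (-ε) ε := ⟨neg_lt_zero.2 hΦ.pos, hΦ.pos⟩
  have hb := hγ.mem_base c hx hs
  let A : Set (Fin N → ℝ) := c.base.target ∩ c.base.symm ⁻¹' (V ∩ γ ⁻¹' U)
  -- Openness of `V ∩ γ ⁻¹' U` comes from the transformed section at time `0` being a local section
  -- on it.
  have hA : IsOpen A := c.base.isOpen_inter_preimage_symm (hext 0 h0).isLocalSection.isOpen
  let G : ℝ × (Fin N → ℝ) → Y := fun a => Φ a.1 (γ (c.base.symm a.2))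
  have hG : ContMDiffOn 𝓘(ℝ, ℝ × (Fin N → ℝ)) 𝓘(ℝ, Pt N M) ∞ G (Set.Ioo (-ε) ε ×ˢ A) := by
    have h1 : ContMDiffOn 𝓘(ℝ, ℝ × (Fin N → ℝ)) 𝓘(ℝ, Fin N → ℝ) ∞
        (fun a : ℝ × (Fin N → ℝ) => a.2) (Set.Ioo (-ε) ε ×ˢ A) :=
      contDiff_snd.contMDiff.contMDiffOn
    have h2 : ContMDiffOn 𝓘(ℝ, ℝ × (Fin N → ℝ)) 𝓘(ℝ, ℝ) ∞
        (fun a : ℝ × (Fin N → ℝ) => a.1) (Set.Ioo (-ε) ε ×ˢ A) :=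
      contDiff_fst.contMDiff.contMDiffOn
    have h3 : ContMDiffOn 𝓘(ℝ, ℝ × (Fin N → ℝ)) 𝓘(ℝ, Fin N → ℝ) ∞
        (fun a : ℝ × (Fin N → ℝ) => c.base.symm a.2) (Set.Ioo (-ε) ε ×ˢ A) :=
      (contMDiffOn_symm_of_mem_maximalAtlas c.base_mem).comp h1 fun a ha => ha.2.1
    have h4 := hγ.smooth.comp h3 fun a ha => ha.2.2.1
    exact hΦ.smooth.comp (h2.prodMk h4) fun a ha => ⟨ha.1, ha.2.2.2⟩
  -- The times and base points for which the transformed section is defined and stays in the chart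
  -- `c`; only there can the variation be written in coordinates.
  let O : Set (ℝ × (Fin N → ℝ)) := (Set.Ioo (-ε) ε ×ˢ A) ∩ G ⁻¹' c.total.source
  have hO : IsOpen O :=
    hG.continuousOn.isOpen_inter_preimage (isOpen_Ioo.prod hA) c.total.open_source
  have hU : ContDiffOn ℝ ∞ (fun a => (c.total (G a)).2) O := by
    have h1 := (contMDiffOn_of_mem_maximalAtlas c.total_mem).comp
      (hG.mono Set.inter_subset_left) fun a (ha : a ∈ O) => ha.2
    exact contDiff_snd.comp_contDiffOn h1.contDiffOn
  have hG0 : ∀ x', (0, x') ∈ O → G (0, x') = γ (c.base.symm x') := fun x' hx' =>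
    hΦ.start _ hx'.1.2.2.2
  have hpt : ∀ x', (0, x') ∈ O → c.total (γ (c.base.symm x')) = (x', (c.total (G (0, x'))).2) := by
    intro x' hx'
    have h1 := hx'.2
    rw [Set.mem_preimage, hG0 x' hx'] at h1
    rw [hG0 x' hx']
    exact total_symm_section c hx'.1.2.1 (hγ.proj_eq _ hx'.1.2.2.1) h1
  have hsource : ∀ x', (0, x') ∈ O → γ (c.base.symm x') ∈ c.total.source := by
    intro x' hx'
    rw [← hG0 x' hx']
    exact hx'.2
  have hUψ : ∀ x', (0, x') ∈ O → ∀ σ, lineDeriv ℝ (fun a => (c.total (G a)).2 σ) (0, x') (1, 0) =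
      comps c ψ (x', (c.total (G (0, x'))).2) σ := by
    intro x' hx' σ
    set y := γ (c.base.symm x') with hy
    have hΦ0 : Φ 0 y = y := hG0 x' hx'
    have h1 := (hΦ.integral y hx'.1.2.2.2 0 h0).hasMFDerivAt (Ioo_mem_nhds h0.1 h0.2)
    have h2 : HasMFDerivAt 𝓘(ℝ, Pt N M) 𝓘(ℝ, Pt N M) c.total (Φ 0 y)
        (mfderiv 𝓘(ℝ, Pt N M) 𝓘(ℝ, Pt N M) c.total (Φ 0 y)) :=
      ((contMDiffAt_of_mem_maximalAtlas c.total_mem hx'.2).mdifferentiableAt (by simp)).hasMFDerivAt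
    let L : Pt N M →L[ℝ] Pt N M := mfderiv 𝓘(ℝ, Pt N M) 𝓘(ℝ, Pt N M) c.total (Φ 0 y)
    let w : Pt N M := ψ (Φ 0 y)
    have h3 : HasFDerivAt (fun t : ℝ => c.total (Φ t y))
        (L.comp ((1 : ℝ →L[ℝ] ℝ).smulRight w)) 0 :=
      hasMFDerivAt_iff_hasFDerivAt.1 (h2.comp 0 h1)
    have h4 : HasDerivAt (fun t : ℝ => (c.total (Φ t y)).2 σ) ((L w).2 σ) 0 := by
      have h5 := hasDerivAt_pi.1 h3.hasDerivAt.snd σ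
      simpa using h5
    have h6 : comps c ψ (x', (c.total (G (0, x'))).2) σ = (L w).2 σ := by
      rw [← hpt x' hx', comps, c.total.left_inv (hsource x' hx')]
      simp only [L, w]
      rw [hΦ0]
      rfl
    rw [h6]
    refine HasLineDerivAt.lineDeriv ?_
    unfold HasLineDerivAt
    have h7 : ∀ t : ℝ, G ((0, x') + t • ((1 : ℝ), (0 : Fin N → ℝ))) = Φ t y := by
      intro t
      simp [G, hy]
    simpa only [h7] using h4
  have hx0 : ((0 : ℝ), c.base x) ∈ O := by
    have h1 : c.base.symm (c.base x) = x := c.base.left_inv hb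
    refine ⟨⟨h0, c.base.map_source hb, ?_, ?_⟩, ?_⟩
    · rwa [h1]
    · simpa [h1] using hxU
    · simp only [G, Set.mem_preimage]
      rwa [h1, hΦ.start _ hxU]
  have hjet : jetOf c γ x = jet (fun x' => (c.total (G (0, x'))).2) (c.base x) := by
    have hW : IsOpen {x : Fin N → ℝ | ((0 : ℝ), x) ∈ O} := hO.preimage (by fun_prop)
    exact jet_congr hW (fun x' hx' => by rw [hG0 x' hx']) hx0
  rw [hjet]
  refine lineDeriv_prolong_eq_zero c.total.open_target hO hU (fun x' hx' => ?_)
    (contDiffOn_comps c hψ) hUψ hf hx0 ?_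
  · rw [← hpt x' hx']
    exact c.total.map_source (hsource x' hx')
  -- For small `t` the transformed section is still in the chart over `x`, and it is extremal, so
  -- `f` vanishes at its jet.
  · have h1 : ContinuousAt (fun t : ℝ => (t, c.base x)) 0 := by fun_prop
    filter_upwards [h1.eventually_mem (hO.mem_nhds hx0)] with t ht
    refine hf0 _ ((hext t ht.1.1).vanish c x ⟨hx, hxU⟩ ?_)
    have h2 := ht.2
    simp only [G, Set.mem_preimage, c.base.left_inv hb] at h2
    exact h2

end Charts

/-! ### Deformed Lagrangians -/

section Deformed

variable {n M : ℕ} {D : Set (Pt (n + 1) M)} {k r : ℕ} {L : Jet (n + 1) M → ℝ}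

/-- Contracting the Euler–Lagrange form with `∂/∂y^σ` isolates one expression, read off on unit
vectors. -/
theorem eulerExpr_eq_zero {z : Jet (n + 1) M} (h : interiorEuler r (extD (volForm L)) z = 0)
    (σ : Fin M) : eulerExpr r σ L z = 0 := by
  have h1 := congrFun (congrFun (contr_interiorEuler r L (vertField σ 0) fun _ => rfl) z)
    fun a => (unitVec n a, 0)
  rw [contr, h, volForm, vol_unitVec, mul_one, Finset.sum_eq_single σ
    (fun τ _ hτ => by simp [vertField, hτ]) (by simp)] at h1
  simpa [vertField] using h1.symm

/-- The coefficient of the Lagrangian deformed by the vertical field `ψ`. -/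
def deformedCoeff (r : ℕ) (ψ : Pt (n + 1) M → Fin M → ℝ) (L : Jet (n + 1) M → ℝ)
    (z : Jet (n + 1) M) : ℝ := ∑ σ, (prolong ψ z).2 σ 0 * eulerExpr r σ L z

variable {ψ : Pt (n + 1) M → Fin M → ℝ}

theorem hasOrder_deformedCoeff (hD : IsOpen D) (hL : HasOrder D k L)
    (hψ : ContDiffOn ℝ ∞ ψ D) (r : ℕ) : HasOrder D (k + r) (deformedCoeff r ψ L) := by
  refine (HasOrder.sum (s := Finset.univ) fun σ _ =>
    ((hasOrder_component hψ σ).mono (Nat.zero_le (k + r))).mul (hasOrder_eulerExpr hD hL r σ)).congr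
    fun z _ => ?_
  simp [deformedCoeff, prolong, iter_zero]

theorem deformedCoeff_eq (hD : IsOpen D) (a : JetFun D) (hψ : ContDiffOn ℝ ∞ ψ D) (r : ℕ)
    {z : Jet (n + 1) M} (hz : z.pt ∈ D) :
    deformedCoeff r ψ a.1 z = (∑ σ, component hψ σ * (jetRing hD).E r σ a : JetFun D).1 z := by
  simp only [deformedCoeff, AddSubmonoidClass.coe_finsetSum, Finset.sum_apply,
    Subalgebra.coe_mul, Pi.mul_apply]
  refine Finset.sum_congr rfl fun σ _ => ?_
  rw [eulerExpr_eq hD r σ a (fun _ _ => rfl) hz]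
  simp [prolong, iter_zero, component]

variable {z : Jet (n + 1) M}

theorem deriv_E_eq_zero (hD : IsOpen D) (hψ : ContDiffOn ℝ ∞ ψ D) (a : JetFun D) (hz : z.pt ∈ D)
    (h : ∀ σ, lineDeriv ℝ (eulerExpr r σ a.1) z (prolong ψ z) = 0) (σ : Fin M) :
    (JetFun.deriv hD _ (isJetField_prolong hD hψ) ((jetRing hD).E r σ a)).1 z = 0 := by
  rw [JetFun.deriv_apply hD _ _ hz, ← h σ]
  exact lineDeriv_congr_of_isOpen hD (fun z hz => (eulerExpr_eq hD r σ a (fun _ _ => rfl) hz).symm) hz _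

/-- Where the Euler–Lagrange expressions and their derivatives along `ψ` vanish, so does the
derivative along `ψ` of any deformed Lagrangian. -/
theorem lineDeriv_deformedCoeff_eq_zero (hD : IsOpen D) (hL : HasOrder D k L)
    {ψ' : Pt (n + 1) M → Fin M → ℝ} (hψ' : ContDiffOn ℝ ∞ ψ' D) (hψ : ContDiffOn ℝ ∞ ψ D)
    (hz : z.pt ∈ D) (h0 : ∀ σ, eulerExpr r σ L z = 0)
    (h1 : ∀ σ, lineDeriv ℝ (eulerExpr r σ L) z (prolong ψ z) = 0) :
    lineDeriv ℝ (deformedCoeff r ψ' L) z (prolong ψ z) = 0 := by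
  let a : JetFun D := ⟨L, k, hL⟩
  rw [lineDeriv_congr_of_isOpen hD (fun z hz => deformedCoeff_eq hD a hψ' r hz) hz,
    ← JetFun.deriv_apply hD (isJetField_prolong hD hψ) _ hz, map_sum]
  simp only [Derivation.leibniz, smul_eq_mul, AddSubmonoidClass.coe_finsetSum, Finset.sum_apply,
    Subalgebra.coe_add, Subalgebra.coe_mul, Pi.add_apply, Pi.mul_apply]
  refine Finset.sum_eq_zero fun σ _ => ?_
  rw [deriv_E_eq_zero hD hψ a hz h1, ← eulerExpr_eq hD r σ a (fun _ _ => rfl) hz, h0]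
  ring

/-- The Euler–Lagrange expressions of the Lagrangian deformed by `ψ` vanish where those of the
Lagrangian and their derivatives along `ψ` do. -/
theorem eulerExpr_deformedCoeff_eq_zero (hD : IsOpen D) (hL : HasOrder D r L) {s : ℕ}
    (hs : 2 * r ≤ s) (hψ : ContDiffOn ℝ ∞ ψ D) (hz : z.pt ∈ D) (h0 : ∀ σ, eulerExpr r σ L z = 0)
    (h1 : ∀ σ, lineDeriv ℝ (eulerExpr r σ L) z (prolong ψ z) = 0) (ν : Fin M) :
    eulerExpr s ν (deformedCoeff r ψ L) z = 0 := by
  let a : JetFun D := ⟨L, r, hL⟩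
  rw [eulerExpr_eq hD s ν _ (fun z hz => deformedCoeff_eq hD a hψ r hz) hz,
    JetRing.E_deformed (HasOrder.ord hD hL) hs _ (fun σ => HasOrder.ord hD (hasOrder_component hψ σ))
      (JetFun.deriv hD _ (isJetField_prolong hD hψ)) (deriv_prolong_d hD hψ)
      (fun b hb => deriv_prolong_apply hD hψ hb)]
  simp only [AddSubmonoidClass.coe_finsetSum, Finset.sum_apply,
    Subalgebra.coe_add, Subalgebra.coe_mul, Pi.add_apply, Pi.mul_apply]
  rw [deriv_E_eq_zero hD hψ a hz h1, zero_add]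
  refine Finset.sum_eq_zero fun σ _ => ?_
  rw [← eulerExpr_eq hD r σ a (fun _ _ => rfl) hz, h0, mul_zero]

end Deformed

end VarJet

end

/-! ### The weak conservation law -/

open VarJet in
theorem theorem4p6 {n m : ℕ} {X Y : Type*}
    [TopologicalSpace X] [ChartedSpace (Fin (n + 1) → ℝ) X]
    [IsManifold 𝓘(ℝ, Fin (n + 1) → ℝ) ∞ X]
    [TopologicalSpace Y] [ChartedSpace (Pt (n + 1) m) Y] [IsManifold 𝓘(ℝ, Pt (n + 1) m) ∞ Y]
    (π : Y → X) (hπ : ContMDiff 𝓘(ℝ, Pt (n + 1) m) 𝓘(ℝ, Fin (n + 1) → ℝ) ∞ π)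
    (hπ_surj : Function.Surjective π)
    (hπ_subm : ∀ y, Function.Surjective
      (mfderiv 𝓘(ℝ, Pt (n + 1) m) 𝓘(ℝ, Fin (n + 1) → ℝ) π y))
    {k : ℕ} (ρ : JetForm (N := n + 1) (M := m) π k (n + 1))
    (ψ₁ ψ₂ : ∀ y : Y, TangentSpace 𝓘(ℝ, Pt (n + 1) m) y)
    (hψ₁ : IsVerticalField π ψ₁) (hψ₂ : IsVerticalField π ψ₂)
    (V : Set X) (γ : X → Y) (hγ : IsExtremal ρ V γ)
    (hsym₁ : GeneratesSymmetries ρ V γ ψ₁) (hsym₂ : GeneratesSymmetries ρ V γ ψ₂)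
    (c : FibredChart (N := n + 1) (M := m) π) :
    (∃ (s : ℕ) (R : FinJet (n + 1) m s → FinJet (n + 1) m s [⋀^Fin (n + 1)]→L[ℝ] ℝ),
      IsResidual c.total.target (2 * (k + 1) + 1) (extD (deformedLagrangian ρ ψ₁ c)) R) ∧
    ∀ (s : ℕ) (R : FinJet (n + 1) m s → FinJet (n + 1) m s [⋀^Fin (n + 1)]→L[ℝ] ℝ),
      IsResidual c.total.target (2 * (k + 1) + 1) (extD (deformedLagrangian ρ ψ₁ c)) R →
      ∀ x ∈ V, γ x ∈ c.total.source →
        dH (noetherCurrent (comps c ψ₂) R) (jetOf c γ x) = 0 := by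
  have hD := c.total.open_target
  have hc₁ := contDiffOn_comps c hψ₁
  have hc₂ := contDiffOn_comps c hψ₂
  set L := horCoeff (ρ.expr c) with hLdef
  have hL : HasOrder c.total.target (k + 1) L := hasOrder_horCoeff (ρ.smooth c)
  have hEL : eulerLagrange ρ c = interiorEuler (k + 1) (extD (volForm L)) := by
    rw [eulerLagrange, lagrangian, p_zero_lift]
  have hdef : deformedLagrangian ρ ψ₁ c = volForm (deformedCoeff (k + 1) (comps c ψ₁) L) := by
    rw [deformedLagrangian, hEL]
    exact contr_interiorEuler (k + 1) L _ fun _ => rfl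
  rw [hdef]
  -- The deformed coefficient has order `(k + 1) + (k + 1)`, within the bound `2 * (k + 1) + 1` on
  -- the multi-indices in the interior Euler operator.
  refine ⟨exists_isResidual hD (hasOrder_deformedCoeff hD hL hc₁ (k + 1)) (by omega),
    fun s R hR x hx hs => ?_⟩
  have hz : (jetOf c γ x).pt ∈ c.total.target := by
    rw [hγ.isLocalSection.jetOf_pt c hx hs]
    exact c.total.map_source hs
  have hE : ∀ σ z, eulerLagrange ρ c z = 0 → eulerExpr (k + 1) σ L z = 0 := fun σ z hz =>
    eulerExpr_eq_zero (by rw [← hEL, hz]) σ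
  have h0 : ∀ σ, eulerExpr (k + 1) σ L (jetOf c γ x) = 0 := fun σ =>
    hE σ _ (hγ.vanish c x hx hs)
  have h1 : ∀ {ψ : ∀ y : Y, TangentSpace 𝓘(ℝ, Pt (n + 1) m) y}, IsVerticalField π ψ →
      GeneratesSymmetries ρ V γ ψ → ∀ σ, lineDeriv ℝ (eulerExpr (k + 1) σ L) (jetOf c γ x)
        (prolong (comps c ψ) (jetOf c γ x)) = 0 := fun hψ hsym σ =>
    lineDeriv_prolong_comps_eq_zero hψ hγ.isLocalSection hsym c (hasOrder_eulerExpr hD hL _ σ) (hE σ)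
      hx hs
  funext v
  -- Of the two terms of the first variation formula, the variation along `ψ₂` vanishes by the
  -- symmetry property of `ψ₂`, and the Euler–Lagrange expressions of the deformed Lagrangian vanish
  -- by that of `ψ₁`.
  rw [dH_noetherCurrent hD hR hc₂ hz,
    lineDeriv_deformedCoeff_eq_zero hD hL hc₁ hc₂ hz h0 (h1 hψ₂ hsym₂)]
  simp only [eulerExpr_deformedCoeff_eq_zero hD hL (by omega : 2 * (k + 1) ≤ 2 * (k + 1) + 1) hc₁ hz
    h0 (h1 hψ₁ hsym₁)]
  simp
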